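/- Let $n, q$ be integers with $1 \le q \le n-2$. Let $\xi$ be a germ of holomorphic vector field on $(\mathbb C^n,0)$ with a non-resonant singularity at the origin: $\xi(0)=0$ and the eigenvalues $\lambda_1,\dots,\lambda_n$ of the linear part $D\xi(0)$ are linearly independent over $\mathbb Z$. Let $\mathcal D$ be a germ of (singular) holomorphic distribution of codimension $q$ on $(\mathbb C^n,0)$, that is, $\mathcal D=\{v : i_v\omega=0\}$ for a germ of holomorphic $q$-form $\omega\not\equiv 0$ whose zero set contains no germ of hypersurface and such that $\ker\omega_x=\{v: i_v\omega_x=0\}$ has codimension $q$ at every point $x$ near $0$ with $\omega_x\neq 0$; the singular set of $\mathcal D$ is the zero set of $\omega$. Suppose that $\xi$ is an infinitesimal automorphism of $\mathcal D$, i.e. on a neighborhood of $0$ the bracket $[\xi,V]$ is tangent to $\mathcal D$ for every local holomorphic vector field $V$ tangent to $\mathcal D$. Then $\mathcal D$ is integrable, i.e. on a neighborhood of $0$ the local holomorphic vector fields tangent to $\mathcal D$ are closed under the Lie bracket. If moreover $\xi$ is tangent to $\mathcal D$, then the germ at $0$ of the singular set of $\mathcal D$ has positive dimension. -/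

import Mathlib

open Filter Topology

/-- The ring `𝒪ₙ` of germs at the origin of holomorphic functions on `ℂⁿ`. -/
def holomorphicGerms (n : ℕ) : Subring (Germ (𝓝 (0 : Fin n → ℂ)) ℂ) where
  carrier := {g | ∃ f : (Fin n → ℂ) → ℂ, AnalyticAt ℂ f 0 ∧ (f : Germ (𝓝 (0 : Fin n → ℂ)) ℂ) = g}
  mul_mem' := by
    rintro _ _ ⟨f, hf, rfl⟩ ⟨g, hg, rfl⟩
    exact ⟨f * g, hf.mul hg, rfl⟩
  one_mem' := ⟨1, analyticAt_const, rfl⟩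
  add_mem' := by
    rintro _ _ ⟨f, hf, rfl⟩ ⟨g, hg, rfl⟩
    exact ⟨f + g, hf.add hg, rfl⟩
  zero_mem' := ⟨0, analyticAt_const, rfl⟩
  neg_mem' := by
    rintro _ ⟨f, hf, rfl⟩
    exact ⟨-f, hf.neg, rfl⟩

/-- The ideal of `𝒪ₙ` of the germs that vanish on the germ of `S` at the origin. -/
def germVanishingIdeal {n : ℕ} (S : Set (Fin n → ℂ)) : Ideal (holomorphicGerms n) where
  carrier := {g | ∃ f : (Fin n → ℂ) → ℂ,
    (f : Germ (𝓝 (0 : Fin n → ℂ)) ℂ) = g ∧ ∀ᶠ x in 𝓝 0, x ∈ S → f x = 0}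
  add_mem' := by
    rintro a b ⟨f, hf, hf0⟩ ⟨g, hg, hg0⟩
    refine ⟨f + g, ?_, ?_⟩
    · rw [Germ.coe_add, hf, hg]; rfl
    · filter_upwards [hf0, hg0] with x h1 h2 hx
      simp [h1 hx, h2 hx]
  zero_mem' := ⟨0, rfl, by simp⟩
  smul_mem' := by
    rintro ⟨c0, hc0⟩ a ⟨f, hf, hf0⟩
    obtain ⟨c, hc, rfl⟩ := hc0
    refine ⟨c * f, ?_, ?_⟩
    · rw [Germ.coe_mul, hf]; rfl
    · filter_upwards [hf0] with x h1 hx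
      simp [h1 hx]

/-- The dimension at the origin of the germ of an analytic set `S`: the Krull dimension of its
local ring `𝒪ₙ / I(S)` (it is `⊥` if the germ is empty). -/
noncomputable def germDim {n : ℕ} (S : Set (Fin n → ℂ)) : WithBot ℕ∞ :=
  ringKrullDim (holomorphicGerms n ⧸ germVanishingIdeal S)

/-- `ξ` represents a germ of holomorphic vector field with a non-resonant singularity at the
origin: `ξ(0) = 0` and the linear part `Dξ(0)` has `n` eigenvalues that are linearly independent
over `ℤ`. (They are then all the eigenvalues, and are nonzero, so `Dξ(0)` is invertible and the
singularity is isolated.) -/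
def IsNonResonantSingularity {n : ℕ} (ξ : (Fin n → ℂ) → (Fin n → ℂ)) : Prop :=
  AnalyticAt ℂ ξ 0 ∧ ξ 0 = 0 ∧
    ∃ lam : Fin n → ℂ, LinearIndependent ℤ lam ∧
      ∀ i, Module.End.HasEigenvalue
        (fderiv ℂ ξ 0 : (Fin n → ℂ) →ₗ[ℂ] (Fin n → ℂ)) (lam i)

/-- The kernel `{v | i_v α = 0}` of an alternating `q`-form `α` on `ℂⁿ`. -/
def formKer {n q : ℕ} (α : (Fin n → ℂ) [⋀^Fin q]→L[ℂ] ℂ) : Submodule ℂ (Fin n → ℂ) where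
  carrier := {v | ∀ (w : Fin q → Fin n → ℂ) (i : Fin q), α (Function.update w i v) = 0}
  add_mem' := by
    intro a b ha hb w i
    rw [α.map_update_add, ha, hb, add_zero]
  zero_mem' := by
    intro w i
    exact α.map_coord_zero i (by simp)
  smul_mem' := by
    intro c a ha w i
    rw [α.map_update_smul, ha, smul_zero]

/-- `ω` represents a germ at the origin of holomorphic `q`-form that defines a (singular)
distribution `𝒟 = {v | i_v ω = 0}` of codimension `q`. -/
structure DefinesDistribution {n q : ℕ} (ω : (Fin n → ℂ) → (Fin n → ℂ) [⋀^Fin q]→L[ℂ] ℂ) :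
    Prop where
  analytic : AnalyticAt ℂ ω 0
  ne_zero : ∃ᶠ x in 𝓝 0, ω x ≠ 0
  /-- The zero set has no divisorial component: it contains no germ of hypersurface `{f = 0}`. -/
  no_divisor : ∀ f : (Fin n → ℂ) → ℂ, AnalyticAt ℂ f 0 → f 0 = 0 → (∃ᶠ x in 𝓝 0, f x ≠ 0) →
    ¬ ∀ᶠ x in 𝓝 0, f x = 0 → ω x = 0
  /-- Off the zero set of `ω`, the kernel of `ω` has codimension `q`. -/
  codim : ∀ᶠ x in 𝓝 0, ω x ≠ 0 → Module.finrank ℂ (formKer (ω x)) + q = n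

/-- The singular set of the distribution defined by `ω`. -/
def singularSet {n q : ℕ} (ω : (Fin n → ℂ) → (Fin n → ℂ) [⋀^Fin q]→L[ℂ] ℂ) :
    Set (Fin n → ℂ) :=
  {x | ω x = 0}

/-- `V` is, near `x`, a holomorphic vector field tangent to the distribution defined by `ω`. -/
def IsTangentAt {n q : ℕ} (V : (Fin n → ℂ) → (Fin n → ℂ))
    (ω : (Fin n → ℂ) → (Fin n → ℂ) [⋀^Fin q]→L[ℂ] ℂ) (x : Fin n → ℂ) : Prop :=
  AnalyticAt ℂ V x ∧ ∀ᶠ y in 𝓝 x, V y ∈ formKer (ω y)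

/-- `ξ` is an infinitesimal automorphism of the distribution `𝒟` defined by `ω`: on a neighborhood
of the origin, `[ξ, V]` is tangent to `𝒟` for every local holomorphic vector field `V` tangent
to `𝒟`. (At points of the singular set the condition is void, since there `formKer (ω x) = ⊤`.) -/
def IsInfinitesimalAutomorphism {n q : ℕ} (ξ : (Fin n → ℂ) → (Fin n → ℂ))
    (ω : (Fin n → ℂ) → (Fin n → ℂ) [⋀^Fin q]→L[ℂ] ℂ) : Prop :=
  ∀ᶠ x in 𝓝 0, ∀ V : (Fin n → ℂ) → (Fin n → ℂ), IsTangentAt V ω x →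
    VectorField.lieBracket ℂ ξ V x ∈ formKer (ω x)

/-- The distribution `𝒟` defined by `ω` is integrable: on a neighborhood of the origin, the local
holomorphic vector fields tangent to `𝒟` are closed under the Lie bracket. -/
def IsIntegrableDistribution {n q : ℕ}
    (ω : (Fin n → ℂ) → (Fin n → ℂ) [⋀^Fin q]→L[ℂ] ℂ) : Prop :=
  ∀ᶠ x in 𝓝 0, ∀ V W : (Fin n → ℂ) → (Fin n → ℂ), IsTangentAt V ω x → IsTangentAt W ω x →
    VectorField.lieBracket ℂ V W x ∈ formKer (ω x)

/-! ### Formal power series: order, fixed points, leading exponents -/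

section FormalSeries

open MvPowerSeries

variable {n : ℕ}

/-! Nonresonance makes everything diagonal, but only formally, so the argument runs in the ring of
formal power series and then returns to germs. After a linear change that diagonalizes the linear
part of ξ, `exists_linearizing_coordinate` gives formal coordinates yᵢ = xᵢ + … with ξ(yᵢ) = λᵢ yᵢ.
The fields vᵢ = yᵢ ∂/∂yᵢ commute, and ξ = ∑ λᵢ vᵢ.

A q-form whose kernel has codimension q is decomposable. Hence, if F = ω(v_{I₁}, …, v_{I_q}) ≠ 0 and
Gₖⱼ is the value of ω after vⱼ is put in place k, the field F vⱼ − ∑ₖ Gₖⱼ v_{Iₖ} is tangent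
(`contractionField`). The bracket with ξ differentiates only its coefficients, and comparison of the
two tangent fields gives ξ(Gₖⱼ / F) = 0. A nonresonant ξ has only constant formal meromorphic first
integrals (`exists_eq_smul_of_mul_derivAlong_eq`), so Gₖⱼ = cₖⱼ F with cₖⱼ ∈ ℂ. Over the fraction
field the distribution is therefore spanned by the commuting fields vⱼ − ∑ₖ cₖⱼ v_{Iₖ}
(`exists_logarithmic_structure`), hence involutive. An analytic germ with zero Taylor series is
zero, so tangency can be read off formally (`HasTaylorForm.mem_ker_iff`), and integrability need
only be tested on the analytic fields `contractionField` (`isIntegrable_of_contractionField`).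

For the singular set, the value of ω on the v_{K} is the minor det_K(c) times F. Since the yᵢ are
pairwise coprime primes, ω = f η formally, where η = ∑_I det_I(c) ∏_{i ∈ S∖I} yᵢ dy_I and S is the
set of indices that occur in nonzero minors (`IsFormalModel.exists_factorization`). It is enough to
find zeros of ω other than 0 that accumulate at 0 (`germDim_pos_of_frequently`).

If f is not a unit, the components of ω have a formal common divisor, which need not converge. A
disc is chosen on which the initial form of f vanishes only at the centre and that of one cofactor
has no zero. On small multiples of the disc the corresponding component has zeros
(`exists_zero_smul_disc`), and a Cauchy integral that is flat in the scaling parameter shows that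
the other components vanish there too (`eq_zero_of_common_formal_factor`).

If f is a unit and ξ is tangent, then λ annihilates every row of c. So the columns of c have a
circuit J of at most q + 1 < n elements (`exists_minimal_nonface`), and η vanishes on the formal
subspace yⱼ = 0, j ∈ J. The implicit function theorem, applied after a blow-up to one component for
each j ∈ J, gives a convergent curve of common zeros; Cramer's rule puts the remaining components,
up to a factor that is not flat on the curve, in the ideal of the chosen ones
(`frequently_eq_zero_of_minimal_nonface`). -/

theorem le_order_add {a b : MvPowerSeries (Fin n) ℂ} {N : ℕ∞} (ha : N ≤ a.order)
    (hb : N ≤ b.order) : N ≤ (a + b).order :=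
  (le_min ha hb).trans min_order_le_add

theorem le_order_sub {a b : MvPowerSeries (Fin n) ℂ} {N : ℕ∞} (ha : N ≤ a.order)
    (hb : N ≤ b.order) : N ≤ (a - b).order := by
  rw [sub_eq_add_neg]
  exact le_order_add ha (by rwa [order_neg])

theorem le_order_sum {ι : Type*} (s : Finset ι) {f : ι → MvPowerSeries (Fin n) ℂ} {N : ℕ∞}
    (h : ∀ i ∈ s, N ≤ (f i).order) : N ≤ (∑ i ∈ s, f i).order := by
  classical
  induction s using Finset.induction_on with
  | empty => simp
  | insert i s hi ih =>
    rw [Finset.sum_insert hi]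
    exact le_order_add (h i (by simp)) (ih fun j hj => h j (by simp [hj]))

theorem add_le_order_mul {a b : MvPowerSeries (Fin n) ℂ} {N M : ℕ∞} (ha : N ≤ a.order)
    (hb : M ≤ b.order) : N + M ≤ (a * b).order :=
  (add_le_add ha hb).trans le_order_mul

theorem le_order_mul_left {a b : MvPowerSeries (Fin n) ℂ} {N : ℕ∞} (hb : N ≤ b.order) :
    N ≤ (a * b).order := by
  simpa using add_le_order_mul (zero_le : 0 ≤ a.order) hb

theorem le_order_mul_right {a b : MvPowerSeries (Fin n) ℂ} {N : ℕ∞} (ha : N ≤ a.order) :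
    N ≤ (a * b).order := by
  rw [mul_comm]
  exact le_order_mul_left ha

theorem le_order_pderiv {f : MvPowerSeries (Fin n) ℂ} {N : ℕ} (i : Fin n)
    (h : (N : ℕ∞) ≤ f.order) : ((N - 1 : ℕ) : ℕ∞) ≤ (pderiv ℂ i f).order := by
  refine nat_le_order fun d hd => ?_
  rw [coeff_pderiv, coeff_of_lt_order, zero_mul]
  refine lt_of_lt_of_le ?_ h
  have : (d + Finsupp.single i 1).degree = d.degree + 1 := by simp
  rw [this]
  exact_mod_cast (by omega)

theorem eq_of_forall_le_order_sub {a b : MvPowerSeries (Fin n) ℂ}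
    (h : ∀ N : ℕ, (N : ℕ∞) ≤ (a - b).order) : a = b := by
  rw [← sub_eq_zero, ← order_eq_top_iff]
  exact ENat.eq_top_iff_forall_ge.2 h

/-- Banach's fixed point principle for the adic topology. It replaces recursions on coefficients,
both in the linearization and in Weierstrass division. -/
theorem exists_fixedPoint_of_order_contraction
    (Φ : MvPowerSeries (Fin n) ℂ → MvPowerSeries (Fin n) ℂ)
    (h : ∀ a b (N : ℕ), (N : ℕ∞) ≤ (a - b).order → ((N + 1 : ℕ) : ℕ∞) ≤ (Φ a - Φ b).order) :
    ∃ y, Φ y = y := by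
  have hstep : ∀ k : ℕ, (k : ℕ∞) ≤ (Φ^[k + 1] 0 - Φ^[k] 0).order := by
    intro k
    induction k with
    | zero => simp
    | succ k ih =>
      rw [Function.iterate_succ_apply' Φ (k + 1), Function.iterate_succ_apply' Φ k]
      rw [Function.iterate_succ_apply' Φ k] at ih
      exact h _ _ _ ih
  have hcauchy : ∀ k l : ℕ, (k : ℕ∞) ≤ (Φ^[k + l] 0 - Φ^[k] 0).order := by
    intro k l
    induction l with
    | zero => simp
    | succ l ih =>
      have : Φ^[k + (l + 1)] 0 - Φ^[k] 0
          = (Φ^[k + l + 1] 0 - Φ^[k + l] 0) + (Φ^[k + l] 0 - Φ^[k] 0) := by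
        rw [add_assoc]; ring
      rw [this]
      exact le_order_add (le_trans (by exact_mod_cast Nat.le_add_right k l) (hstep (k + l))) ih
  -- Iterates agree with all later ones below degree k from the k-th on, so a coefficient of degree
  -- d is final at iterate d + 1.
  let y : MvPowerSeries (Fin n) ℂ := fun m => coeff m (Φ^[m.degree + 1] 0)
  have hy : ∀ k : ℕ, (k : ℕ∞) ≤ (y - Φ^[k] 0).order := by
    intro k
    refine nat_le_order fun d hd => ?_
    obtain ⟨l, rfl⟩ := Nat.exists_eq_add_of_lt hd
    have h1 := hcauchy (d.degree + 1) l
    have h2 : coeff d (Φ^[d.degree + 1 + l] 0 - Φ^[d.degree + 1] 0) = 0 :=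
      coeff_of_lt_order (lt_of_lt_of_le (by exact_mod_cast Nat.lt_succ_self _) h1)
    have h3 : coeff d y = coeff d (Φ^[d.degree + 1] 0) := rfl
    rw [map_sub, h3]
    rw [map_sub] at h2
    rw [show d.degree + l + 1 = d.degree + 1 + l by ring]
    linear_combination -h2
  refine ⟨y, eq_of_forall_le_order_sub fun N => ?_⟩
  have h1 := h _ _ _ (hy N)
  rw [← Function.iterate_succ_apply' Φ N] at h1
  have h2 := hy (N + 1)
  have : Φ y - y = (Φ y - Φ^[N + 1] 0) - (y - Φ^[N + 1] 0) := by ring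
  rw [this]
  refine le_trans ?_ (le_order_sub h1 h2)
  exact_mod_cast Nat.le_succ N

/-- `m` is a lower bound, for the graded lexicographic order, of the exponents of `f`. -/
def VanishesBelow (f : MvPowerSeries (Fin n) ℂ) (m : Fin n →₀ ℕ) : Prop :=
  ∀ k : Fin n →₀ ℕ, toDegLex k < toDegLex m → coeff k f = 0

theorem exists_vanishesBelow {f : MvPowerSeries (Fin n) ℂ} (hf : f ≠ 0) :
    ∃ m, VanishesBelow f m ∧ coeff m f ≠ 0 := by
  have hne : ∃ m : DegLex (Fin n →₀ ℕ), coeff (ofDegLex m) f ≠ 0 := by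
    by_contra hcon
    push Not at hcon
    exact hf (MvPowerSeries.ext fun m => hcon (toDegLex m))
  let S : Set (DegLex (Fin n →₀ ℕ)) := {m | coeff (ofDegLex m) f ≠ 0}
  have wf : WellFounded ((· < ·) : DegLex (Fin n →₀ ℕ) → _ → Prop) := wellFounded_lt
  refine ⟨ofDegLex (wf.min S hne), fun k hk => ?_, wf.min_mem S hne⟩
  by_contra hk0
  exact wf.not_lt_min S (x := toDegLex k) hk0 hk

/-- Leading coefficients multiply because the order on exponents is compatible with addition: any
other pair with sum m + k has a component below its bound. -/
theorem coeff_add_mul_of_vanishesBelow {f g : MvPowerSeries (Fin n) ℂ} {m k : Fin n →₀ ℕ}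
    (hf : VanishesBelow f m) (hg : VanishesBelow g k) :
    coeff (m + k) (f * g) = coeff m f * coeff k g := by
  classical
  rw [coeff_mul, Finset.sum_eq_single (m, k)]
  · rintro ⟨a, b⟩ hab hne
    rw [Finset.HasAntidiagonal.mem_antidiagonal] at hab
    rcases lt_trichotomy (toDegLex a) (toDegLex m) with h | h | h
    · rw [hf a h, zero_mul]
    · have ham : a = m := h
      subst ham
      exact absurd (by simpa using hab) hne
    · rcases lt_or_ge (toDegLex b) (toDegLex k) with h' | h'
      · rw [hg b h', mul_zero]
      · have := add_lt_add_of_lt_of_le h h'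
        rw [← toDegLex_add, ← toDegLex_add, hab] at this
        exact absurd this (lt_irrefl _)
  · intro h
    exact absurd (by simp) h

theorem le_order_of_vanishesBelow {f : MvPowerSeries (Fin n) ℂ} {m : Fin n →₀ ℕ}
    (hf : VanishesBelow f m) : (m.degree : ℕ∞) ≤ f.order := by
  refine nat_le_order fun d hd => hf d ?_
  rw [Finsupp.DegLex.lt_iff]
  exact Or.inl hd

theorem degree_le_of_toDegLex_le {k m : Fin n →₀ ℕ} (h : toDegLex k ≤ toDegLex m) :
    k.degree ≤ m.degree := by
  rw [Finsupp.DegLex.le_iff] at h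
  rcases h with h | h
  · exact h.le
  · exact h.1.le

/-- The derivation `∑ Vᵢ ∂ᵢ` of the ring of formal power series. -/
noncomputable def derivAlong (V : Fin n → MvPowerSeries (Fin n) ℂ) :
    Derivation ℂ (MvPowerSeries (Fin n) ℂ) (MvPowerSeries (Fin n) ℂ) :=
  ∑ i, V i • pderiv ℂ i

theorem derivAlong_apply (V : Fin n → MvPowerSeries (Fin n) ℂ) (f : MvPowerSeries (Fin n) ℂ) :
    derivAlong V f = ∑ i, V i * pderiv ℂ i f := by
  rw [derivAlong, ← Derivation.coeFnAddMonoidHom_apply, map_sum, Finset.sum_apply]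
  rfl

/-- The linear part of the formal vector field `ξ` is `∑ λᵢ xᵢ ∂ᵢ`, and `ξ` vanishes at `0`. -/
def HasDiagLinearPart (ξ : Fin n → MvPowerSeries (Fin n) ℂ) (lam : Fin n → ℂ) : Prop :=
  ∀ i, (2 : ℕ∞) ≤ (ξ i - lam i • X i).order

/-- The eigenvalue `∑ mᵢ λᵢ` of `∑ λᵢ xᵢ ∂ᵢ` on the monomial `x ^ m`. -/
noncomputable def monomialWeight (lam : Fin n → ℂ) (m : Fin n →₀ ℕ) : ℂ := ∑ i, (m i : ℂ) * lam i

theorem monomialWeight_injective {lam : Fin n → ℂ} (hlam : LinearIndependent ℤ lam) :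
    Function.Injective (monomialWeight lam) := by
  intro m k h
  have h0 : ∑ i, ((m i : ℤ) - k i) • lam i = 0 := by
    simp only [monomialWeight] at h
    rw [← sub_eq_zero, ← Finset.sum_sub_distrib] at h
    rw [← h]
    refine Finset.sum_congr rfl fun i _ => ?_
    simp [sub_mul]
  ext i
  have := Fintype.linearIndependent_iff.1 hlam _ h0 i
  omega

theorem monomialWeight_single (lam : Fin n → ℂ) (i : Fin n) :
    monomialWeight lam (Finsupp.single i 1) = lam i := by
  classical
  simp [monomialWeight, Finsupp.single_apply]

theorem coeff_X_mul_pderiv (i : Fin n) (f : MvPowerSeries (Fin n) ℂ) (m : Fin n →₀ ℕ) :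
    coeff m (X i * pderiv ℂ i f) = (m i : ℂ) * coeff m f := by
  classical
  rw [X_def, coeff_monomial_mul]
  split_ifs with h
  · have h1 : 1 ≤ m i := by simpa using h i
    rw [coeff_pderiv, tsub_add_cancel_of_le h, one_mul, mul_comm]
    congr 1
    have : (m - Finsupp.single i 1 : Fin n →₀ ℕ) i + 1 = m i := by
      simp; omega
    exact_mod_cast this
  · have h1 : m i = 0 := by
      by_contra hne
      exact h (Finsupp.single_le_iff.2 (Nat.one_le_iff_ne_zero.2 hne))
    simp [h1]

/-- The part of order at least two of the derivation along `ξ`. -/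
theorem derivAlong_eq_diag_add {ξ : Fin n → MvPowerSeries (Fin n) ℂ} (lam : Fin n → ℂ)
    (f : MvPowerSeries (Fin n) ℂ) (m : Fin n →₀ ℕ) :
    coeff m (derivAlong ξ f) = monomialWeight lam m * coeff m f
      + coeff m (∑ i, (ξ i - lam i • X i) * pderiv ℂ i f) := by
  rw [derivAlong_apply, ← sub_eq_iff_eq_add, ← map_sub, ← Finset.sum_sub_distrib]
  have : ∀ i, ξ i * pderiv ℂ i f - (ξ i - lam i • X i) * pderiv ℂ i f
      = lam i • (X i * pderiv ℂ i f) := by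
    intro i
    rw [← sub_mul, sub_sub_cancel, smul_mul_assoc]
  simp only [this, map_sum, monomialWeight, Finset.sum_mul]
  refine Finset.sum_congr rfl fun i _ => ?_
  rw [coeff_smul, coeff_X_mul_pderiv]
  ring

theorem le_order_higher_part {ξ : Fin n → MvPowerSeries (Fin n) ℂ} {lam : Fin n → ℂ}
    (hξ : HasDiagLinearPart ξ lam) {f : MvPowerSeries (Fin n) ℂ} {N : ℕ}
    (hf : (N : ℕ∞) ≤ f.order) :
    ((N + 1 : ℕ) : ℕ∞) ≤ (∑ i, (ξ i - lam i • X i) * pderiv ℂ i f).order := by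
  refine le_order_sum _ fun i _ => ?_
  refine le_trans ?_ (add_le_order_mul (hξ i) (le_order_pderiv i hf))
  exact_mod_cast (by omega)

/-- The order on exponents compares degrees first, and the part of ξ of order at least two raises
degrees. Up to the exponent m only the diagonal part acts. -/
theorem derivAlong_vanishesBelow {ξ : Fin n → MvPowerSeries (Fin n) ℂ} {lam : Fin n → ℂ}
    (hξ : HasDiagLinearPart ξ lam) {f : MvPowerSeries (Fin n) ℂ} {m : Fin n →₀ ℕ}
    (hf : VanishesBelow f m) :
    VanishesBelow (derivAlong ξ f) m ∧
      coeff m (derivAlong ξ f) = monomialWeight lam m * coeff m f := by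
  have key : ∀ k : Fin n →₀ ℕ, toDegLex k ≤ toDegLex m →
      coeff k (derivAlong ξ f) = monomialWeight lam k * coeff k f := by
    intro k hk
    rw [derivAlong_eq_diag_add lam, add_eq_left]
    refine coeff_of_lt_order (lt_of_lt_of_le ?_
      (le_order_higher_part hξ (le_order_of_vanishesBelow hf)))
    have := degree_le_of_toDegLex_le hk
    exact_mod_cast (by omega)
  exact ⟨fun k hk => by rw [key k hk.le, hf k hk, mul_zero], key m le_rfl⟩

/-- A nonresonant vector field has no formal meromorphic first integrals. -/
theorem exists_eq_smul_of_mul_derivAlong_eq {ξ : Fin n → MvPowerSeries (Fin n) ℂ}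
    {lam : Fin n → ℂ} (hlam : LinearIndependent ℤ lam) (hξ : HasDiagLinearPart ξ lam)
    {g h : MvPowerSeries (Fin n) ℂ} (hg : g ≠ 0)
    (hgh : g * derivAlong ξ h = h * derivAlong ξ g) : ∃ c : ℂ, h = c • g := by
  obtain ⟨m, hm, hm0⟩ := exists_vanishesBelow hg
  -- The relation is linear in h, so a multiple of g may be subtracted to kill the coefficient at
  -- the leading exponent m of g. If the difference had a leading exponent k, the coefficients at m
  -- + k would force equal weights, hence k = m, which was killed.
  have key : ∀ h' : MvPowerSeries (Fin n) ℂ, g * derivAlong ξ h' = h' * derivAlong ξ g →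
      coeff m h' = 0 → h' = 0 := by
    intro h' hgh' hm'
    by_contra hne
    obtain ⟨k, hk, hk0⟩ := exists_vanishesBelow hne
    obtain ⟨h1, h2⟩ := derivAlong_vanishesBelow hξ hm
    obtain ⟨h3, h4⟩ := derivAlong_vanishesBelow hξ hk
    have e1 := coeff_add_mul_of_vanishesBelow hm h3
    have e2 := coeff_add_mul_of_vanishesBelow hk h1
    rw [hgh', add_comm m k, e2, h2, h4] at e1
    have : monomialWeight lam m = monomialWeight lam k := by
      have h0 : coeff k h' * coeff m g ≠ 0 := mul_ne_zero hk0 hm0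
      apply mul_left_cancel₀ h0
      linear_combination e1
    have hmk := monomialWeight_injective hlam this
    exact hk0 (hmk ▸ hm')
  refine ⟨coeff m h / coeff m g, sub_eq_zero.1 (key _ ?_ ?_)⟩
  · rw [map_sub, Derivation.map_smul, mul_sub, hgh, mul_smul_comm, sub_mul, smul_mul_assoc]
  · rw [map_sub, coeff_smul, div_mul_cancel₀ _ hm0, sub_self]

/-- A nonresonant vector field is formally linearizable: the coordinates of a linearization. -/
theorem exists_linearizing_coordinate {ξ : Fin n → MvPowerSeries (Fin n) ℂ} {lam : Fin n → ℂ}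
    (hlam : LinearIndependent ℤ lam) (hξ : HasDiagLinearPart ξ lam) (i : Fin n) :
    ∃ y : MvPowerSeries (Fin n) ℂ, derivAlong ξ y = lam i • y ∧ (2 : ℕ∞) ≤ (y - X i).order := by
  classical
  let E : MvPowerSeries (Fin n) ℂ → MvPowerSeries (Fin n) ℂ :=
    fun f => ∑ j, (ξ j - lam j • X j) * pderiv ℂ j f
  have hE2 : ∀ f, (2 : ℕ∞) ≤ (E f).order := fun f =>
    le_order_sum _ fun j _ => le_order_mul_right (hξ j)
  -- `T` inverts the diagonal part of ξ − λᵢ. The divisor is zero only at the exponent of xᵢ, where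
  -- division by zero gives 0; this is harmless, as `T` is applied to series of order at least two.
  let T : MvPowerSeries (Fin n) ℂ → MvPowerSeries (Fin n) ℂ :=
    fun f m => coeff m f / (monomialWeight lam m - lam i)
  have hT : ∀ f m, coeff m (T f) = coeff m f / (monomialWeight lam m - lam i) := fun _ _ => rfl
  have hTord : ∀ f g (N : ℕ), (N : ℕ∞) ≤ (f - g).order → (N : ℕ∞) ≤ (T f - T g).order := by
    intro f g N h
    refine nat_le_order fun d hd => ?_
    have h1 : coeff d (f - g) = 0 := coeff_of_lt_order (lt_of_lt_of_le (by exact_mod_cast hd) h)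
    rw [map_sub] at h1
    rw [map_sub, hT, hT, ← sub_div, h1, zero_div]
  -- With ξ = diagonal part + `E`, the equation ξ(y) = λᵢ y with linear part xᵢ is y = xᵢ − T(E y).
  -- It is a contraction because `E` raises the order.
  obtain ⟨y, hy⟩ := exists_fixedPoint_of_order_contraction (fun f => X i - T (E f)) (by
    intro a b N hab
    have e : X i - T (E a) - (X i - T (E b)) = T (E b) - T (E a) := by ring
    simp only [e]
    refine hTord _ _ _ ?_
    have : E b - E a = E (b - a) := by
      simp only [E, map_sub, mul_sub, Finset.sum_sub_distrib]
    rw [this]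
    refine le_order_higher_part hξ ?_
    rwa [← neg_sub, order_neg])
  have hTE : (2 : ℕ∞) ≤ (T (E y)).order := by
    have h0 : T 0 = 0 := MvPowerSeries.ext fun m => by rw [hT]; simp
    have := hTord (E y) 0 2 (by simpa using hE2 y)
    simpa [h0] using this
  refine ⟨y, ?_, ?_⟩
  · ext m
    rw [derivAlong_eq_diag_add lam, coeff_smul]
    change _ + coeff m (E y) = _
    have hym : coeff m y = coeff m (X i) - coeff m (E y) / (monomialWeight lam m - lam i) := by
      rw [← hT, ← map_sub, hy]
    by_cases hmi : m = Finsupp.single i 1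
    · subst hmi
      have : coeff (Finsupp.single i 1) (E y) = 0 :=
        coeff_of_lt_order (lt_of_lt_of_le (by simp) (hE2 y))
      rw [this, monomialWeight_single, add_zero]
    · have hne : monomialWeight lam m - lam i ≠ 0 := by
        rw [sub_ne_zero, ← monomialWeight_single lam i]
        exact fun h => hmi (monomialWeight_injective hlam h)
      rw [coeff_X, if_neg hmi] at hym
      rw [hym]
      field_simp
      ring
  · rw [show y - X i = -(T (E y)) by nth_rewrite 1 [← hy]; ring, order_neg]
    exact hTE

/-- Weierstrass division by a series with the linear part `xᵢ`. -/
theorem exists_division_by_coordinate {y : MvPowerSeries (Fin n) ℂ} {i : Fin n}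
    (hy : (2 : ℕ∞) ≤ (y - X i).order) (b : MvPowerSeries (Fin n) ℂ) :
    ∃ a r : MvPowerSeries (Fin n) ℂ, b = y * a + r ∧ ∀ m, m i ≠ 0 → coeff m r = 0 := by
  classical
  -- `Q` is the quotient in the division by xᵢ itself. A quotient a by y = xᵢ + (y − xᵢ) satisfies a
  -- = Q(b − (y − xᵢ) a).
  let Q : MvPowerSeries (Fin n) ℂ → MvPowerSeries (Fin n) ℂ :=
    fun f m => coeff (m + Finsupp.single i 1) f
  have hQ : ∀ f m, coeff m (Q f) = coeff (m + Finsupp.single i 1) f := fun _ _ => rfl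
  obtain ⟨a, ha⟩ := exists_fixedPoint_of_order_contraction (fun a => Q (b - (y - X i) * a)) (by
    intro a a' N h
    refine nat_le_order fun d hd => ?_
    rw [map_sub, hQ, hQ, ← map_sub]
    have e : b - (y - X i) * a - (b - (y - X i) * a') = -((y - X i) * (a - a')) := by ring
    have hord : 2 + (N : ℕ∞) ≤ (-((y - X i) * (a - a'))).order := by
      rw [order_neg]
      exact add_le_order_mul hy h
    rw [e]
    refine coeff_of_lt_order (lt_of_lt_of_le ?_ hord)
    have : (d + Finsupp.single i 1).degree = d.degree + 1 := by simp
    rw [this]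
    calc ((d.degree + 1 : ℕ) : ℕ∞) < ((2 + N : ℕ) : ℕ∞) := by exact_mod_cast (by omega)
      _ = 2 + N := by push_cast; rfl)
  refine ⟨a, b - y * a, by ring, fun m hm => ?_⟩
  have hle : Finsupp.single i 1 ≤ m := Finsupp.single_le_iff.2 (Nat.one_le_iff_ne_zero.2 hm)
  have e : b - y * a = (b - (y - X i) * a) - X i * a := by ring
  have h1 : coeff m (X i * a) = coeff (m - Finsupp.single i 1) a := by
    rw [X_def, coeff_monomial_mul, if_pos hle, one_mul]
  rw [e, map_sub, h1]
  conv_lhs => rw [← ha]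
  rw [hQ, tsub_add_cancel_of_le hle, ha, sub_self]

theorem vanishesBelow_coordinate {y : MvPowerSeries (Fin n) ℂ} {i : Fin n}
    (hy : (2 : ℕ∞) ≤ (y - X i).order) :
    (∀ m : Fin n →₀ ℕ, m.degree ≤ 1 → coeff m y = coeff m (X i)) := by
  intro m hm
  rw [← sub_eq_zero, ← map_sub]
  exact coeff_of_lt_order (lt_of_lt_of_le (by exact_mod_cast (by omega : m.degree < 2)) hy)

/-- Since y = xᵢ + higher order, multiplication by y acts on leading terms as multiplication by xᵢ.
-/
theorem toDegLex_single_add_mem {y g : MvPowerSeries (Fin n) ℂ} {i : Fin n}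
    (hy : (2 : ℕ∞) ≤ (y - X i).order) {k : Fin n →₀ ℕ} (hk : VanishesBelow g k) :
    coeff (Finsupp.single i 1 + k) (y * g) = coeff k g ∧
      (∀ l : Fin n →₀ ℕ, toDegLex l < toDegLex (Finsupp.single i 1 + k) → coeff l (y * g) = 0) := by
  classical
  have hX : ∀ l : Fin n →₀ ℕ, toDegLex l ≤ toDegLex (Finsupp.single i 1 + k) →
      coeff l (y * g) = coeff l (X i * g) := by
    intro l hl
    have hdeg := degree_le_of_toDegLex_le hl
    rw [← sub_eq_zero, ← map_sub, ← sub_mul]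
    refine coeff_of_lt_order (lt_of_lt_of_le ?_
      (add_le_order_mul hy (le_order_of_vanishesBelow hk)))
    have : (Finsupp.single i 1 + k).degree = 1 + k.degree := by simp
    exact_mod_cast (by omega)
  refine ⟨?_, fun l hl => ?_⟩
  · rw [hX _ le_rfl, X_def, coeff_add_monomial_mul, one_mul]
  · rw [hX _ hl.le, X_def, coeff_monomial_mul]
    split_ifs with h
    · rw [hk, mul_zero]
      have e : l = Finsupp.single i 1 + (l - Finsupp.single i 1) := (add_tsub_cancel_of_le h).symm
      rw [e, toDegLex_add, toDegLex_add] at hl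
      exact lt_of_add_lt_add_left hl
    · rfl

/-- The leading exponent of a nonzero multiple of y involves the index i. -/
theorem eq_zero_of_coordinate_dvd {y r : MvPowerSeries (Fin n) ℂ} {i : Fin n}
    (hy : (2 : ℕ∞) ≤ (y - X i).order) (hr : ∀ k, VanishesBelow r k → coeff k r ≠ 0 → k i = 0)
    (h : y ∣ r) : r = 0 := by
  obtain ⟨a, rfl⟩ := h
  by_contra hne
  have ha : a ≠ 0 := right_ne_zero_of_mul hne
  obtain ⟨k, hk, hk0⟩ := exists_vanishesBelow ha
  obtain ⟨h1, h2⟩ := toDegLex_single_add_mem hy hk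
  have := hr _ h2 (by rwa [h1])
  simp at this

/-- Division by y leaves remainders free of xᵢ. Their product is again free of xᵢ, so it is
divisible by y only if it is zero, and the ring of power series is a domain. -/
theorem prime_coordinate {y : MvPowerSeries (Fin n) ℂ} {i : Fin n}
    (hy : (2 : ℕ∞) ≤ (y - X i).order) : Prime y := by
  classical
  refine ⟨?_, ?_, ?_⟩
  · rintro rfl
    have := vanishesBelow_coordinate hy (Finsupp.single i 1) (by simp)
    simp [coeff_X] at this
  · intro hu
    have h0 := vanishesBelow_coordinate hy 0 (by simp)
    have hu' := hu.map (constantCoeff (σ := Fin n) (R := ℂ))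
    rw [← coeff_zero_eq_constantCoeff_apply, h0] at hu'
    simp at hu'
  · intro b c hbc
    obtain ⟨a₁, r₁, rfl, hr₁⟩ := exists_division_by_coordinate hy b
    obtain ⟨a₂, r₂, rfl, hr₂⟩ := exists_division_by_coordinate hy c
    have hdvd : y ∣ r₁ * r₂ := by
      have : r₁ * r₂ = (y * a₁ + r₁) * (y * a₂ + r₂) - y * (a₁ * (y * a₂ + r₂) + r₁ * a₂) := by
        ring
      rw [this]
      exact dvd_sub hbc (dvd_mul_right _ _)
    have hz : r₁ * r₂ = 0 := by
      refine eq_zero_of_coordinate_dvd hy (fun k _ hk0 => ?_) hdvd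
      by_contra hki
      apply hk0
      rw [coeff_mul]
      refine Finset.sum_eq_zero fun x hx => ?_
      rw [Finset.HasAntidiagonal.mem_antidiagonal] at hx
      have : x.1 i + x.2 i = k i := by rw [← hx]; rfl
      by_cases h1 : x.1 i = 0
      · rw [hr₂ x.2 (by omega), mul_zero]
      · rw [hr₁ x.1 h1, zero_mul]
    rcases mul_eq_zero.1 hz with h | h
    · left; rw [h, add_zero]; exact dvd_mul_right _ _
    · right; rw [h, add_zero]; exact dvd_mul_right _ _

theorem not_coordinate_dvd {y z : MvPowerSeries (Fin n) ℂ} {i j : Fin n} (hij : i ≠ j)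
    (hy : (2 : ℕ∞) ≤ (y - X i).order) (hz : (2 : ℕ∞) ≤ (z - X j).order) : ¬ y ∣ z := by
  classical
  intro h
  refine (prime_coordinate hz).ne_zero (eq_zero_of_coordinate_dvd hy (fun k hk hk0 => ?_) h)
  by_contra hki
  have hle : toDegLex k ≤ toDegLex (Finsupp.single j 1) := by
    by_contra hcon
    have := hk _ (not_le.1 hcon)
    rw [vanishesBelow_coordinate hz _ (by simp)] at this
    simp [coeff_X] at this
  have hdeg := degree_le_of_toDegLex_le hle
  rw [vanishesBelow_coordinate hz _ (by simpa using hdeg), coeff_X] at hk0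
  have : k = Finsupp.single j 1 := by
    by_contra hne
    simp [hne] at hk0
  rw [this, Finsupp.single_apply, if_neg hij.symm] at hki
  exact hki rfl

/-- Coordinate functions are pairwise coprime. -/
theorem prod_coordinate_dvd {y : Fin n → MvPowerSeries (Fin n) ℂ}
    (hy : ∀ i, (2 : ℕ∞) ≤ (y i - X i).order) (s : Finset (Fin n)) {F : MvPowerSeries (Fin n) ℂ}
    (h : ∀ i ∈ s, y i ∣ F) : ∏ i ∈ s, y i ∣ F := by
  classical
  induction s using Finset.induction_on with
  | empty => simp
  | insert i s hi ih =>
    rw [Finset.prod_insert hi]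
    obtain ⟨G, hG⟩ := ih fun j hj => h j (by simp [hj])
    have hd : y i ∣ (∏ j ∈ s, y j) * G := hG ▸ h i (by simp)
    rcases (prime_coordinate (hy i)).dvd_or_dvd hd with h1 | h1
    · obtain ⟨j, hj, hij⟩ := (prime_coordinate (hy i)).exists_mem_finset_dvd h1
      exact absurd hij (not_coordinate_dvd (by rintro rfl; exact hi hj) (hy i) (hy j))
    · obtain ⟨G', rfl⟩ := h1
      exact ⟨G', by rw [hG]; ring⟩

end FormalSeries

/-! ### Formal vector fields and the kernel of a formal form -/

section FormalFields

open MvPowerSeries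

variable {n q : ℕ}

theorem pderiv_pderiv_comm (i j : Fin n) (f : MvPowerSeries (Fin n) ℂ) :
    pderiv ℂ i (pderiv ℂ j f) = pderiv ℂ j (pderiv ℂ i f) := by
  classical
  ext m
  simp only [coeff_pderiv]
  rw [add_right_comm]
  by_cases h : i = j
  · subst h; ring
  · simp [h, Ne.symm h]
    ring

/-- The Lie bracket of formal vector fields. -/
noncomputable def formalBracket (V W : Fin n → MvPowerSeries (Fin n) ℂ) :
    Fin n → MvPowerSeries (Fin n) ℂ :=
  fun i => derivAlong V (W i) - derivAlong W (V i)

theorem derivAlong_add_left (V W : Fin n → MvPowerSeries (Fin n) ℂ)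
    (f : MvPowerSeries (Fin n) ℂ) :
    derivAlong (V + W) f = derivAlong V f + derivAlong W f := by
  simp [derivAlong_apply, add_mul, Finset.sum_add_distrib]

theorem derivAlong_smul_left (a : MvPowerSeries (Fin n) ℂ) (V : Fin n → MvPowerSeries (Fin n) ℂ)
    (f : MvPowerSeries (Fin n) ℂ) : derivAlong (a • V) f = a * derivAlong V f := by
  simp [derivAlong_apply, Finset.mul_sum, mul_assoc]

theorem derivAlong_sum_left {ι : Type*} (s : Finset ι) (V : ι → Fin n → MvPowerSeries (Fin n) ℂ)
    (f : MvPowerSeries (Fin n) ℂ) :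
    derivAlong (∑ i ∈ s, V i) f = ∑ i ∈ s, derivAlong (V i) f := by
  simp only [derivAlong_apply, Finset.sum_apply, Finset.sum_mul]
  exact Finset.sum_comm

theorem derivAlong_formalBracket (V W : Fin n → MvPowerSeries (Fin n) ℂ)
    (f : MvPowerSeries (Fin n) ℂ) :
    derivAlong (formalBracket V W) f
      = derivAlong V (derivAlong W f) - derivAlong W (derivAlong V f) := by
  -- A second derivative splits into a first-order part and a part symmetric in V and W; the latter
  -- cancels in the commutator.
  have key : ∀ V W : Fin n → MvPowerSeries (Fin n) ℂ, derivAlong V (derivAlong W f)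
      = ∑ i, derivAlong V (W i) * pderiv ℂ i f
        + ∑ i, ∑ j, W i * V j * pderiv ℂ i (pderiv ℂ j f) := by
    intro V W
    rw [derivAlong_apply W f, map_sum, ← Finset.sum_add_distrib]
    refine Finset.sum_congr rfl fun i _ => ?_
    rw [Derivation.leibniz, smul_eq_mul, smul_eq_mul, add_comm, mul_comm, derivAlong_apply V
      (pderiv ℂ i f), Finset.mul_sum]
    congr 1
    refine Finset.sum_congr rfl fun j _ => ?_
    rw [pderiv_pderiv_comm j i, mul_assoc]
  have hsymm : ∑ i, ∑ j, W i * V j * pderiv ℂ i (pderiv ℂ j f)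
      = ∑ i, ∑ j, V i * W j * pderiv ℂ i (pderiv ℂ j f) := by
    rw [Finset.sum_comm]
    refine Finset.sum_congr rfl fun i _ => Finset.sum_congr rfl fun j _ => ?_
    rw [pderiv_pderiv_comm j i, mul_comm (W j)]
  rw [key V W, key W V, hsymm, add_sub_add_right_eq_sub, ← Finset.sum_sub_distrib,
    derivAlong_apply]
  refine Finset.sum_congr rfl fun i _ => ?_
  rw [formalBracket, sub_mul]

theorem formalBracket_smul_right (a : MvPowerSeries (Fin n) ℂ)
    (V W : Fin n → MvPowerSeries (Fin n) ℂ) :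
    formalBracket V (a • W) = derivAlong V a • W + a • formalBracket V W := by
  ext1 i
  simp only [formalBracket, Pi.smul_apply, Pi.add_apply, smul_eq_mul, Derivation.leibniz,
    derivAlong_smul_left]
  ring

theorem formalBracket_swap (V W : Fin n → MvPowerSeries (Fin n) ℂ) :
    formalBracket V W = -formalBracket W V := by
  ext1 i
  simp [formalBracket]

theorem formalBracket_add_right (V W W' : Fin n → MvPowerSeries (Fin n) ℂ) :
    formalBracket V (W + W') = formalBracket V W + formalBracket V W' := by
  ext1 i
  simp only [formalBracket, Pi.add_apply, map_add, derivAlong_add_left]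
  ring

theorem formalBracket_zero_right (V : Fin n → MvPowerSeries (Fin n) ℂ) :
    formalBracket V 0 = 0 := by
  ext1 i
  simp [formalBracket, derivAlong_apply]

theorem formalBracket_sum_right {ι : Type*} (s : Finset ι)
    (V : Fin n → MvPowerSeries (Fin n) ℂ) (W : ι → Fin n → MvPowerSeries (Fin n) ℂ) :
    formalBracket V (∑ i ∈ s, W i) = ∑ i ∈ s, formalBracket V (W i) := by
  classical
  induction s using Finset.induction_on with
  | empty => simp [formalBracket_zero_right]
  | insert i s hi ih => rw [Finset.sum_insert hi, formalBracket_add_right, ih, Finset.sum_insert hi]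

/-- The kernel `{V | i_V ω = 0}` of an alternating form over a commutative ring. -/
def alternatingKer {A M : Type*} [CommRing A] [AddCommGroup M] [Module A M]
    (ω : M [⋀^Fin q]→ₗ[A] A) : Submodule A M where
  carrier := {v | ∀ (w : Fin q → M) (i : Fin q), ω (Function.update w i v) = 0}
  add_mem' := by
    intro a b ha hb w i
    rw [ω.map_update_add, ha, hb, add_zero]
  zero_mem' := by
    intro w i
    exact ω.map_coord_zero i (by simp)
  smul_mem' := by
    intro c a ha w i
    rw [ω.map_update_smul, ha, smul_zero]

/-- The kernel is saturated. This allows arguments over the fraction field without introducing it: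
nonzero factors are carried along and cancelled at the end. -/
theorem mem_alternatingKer_of_smul_mem {A M : Type*} [CommRing A] [NoZeroDivisors A] [AddCommGroup M]
    [Module A M] {ω : M [⋀^Fin q]→ₗ[A] A} {v : M} {a : A} (ha : a ≠ 0)
    (h : a • v ∈ alternatingKer ω) : v ∈ alternatingKer ω := by
  intro w i
  have := h w i
  rw [ω.map_update_smul, smul_eq_mul] at this
  exact (mul_eq_zero.1 this).resolve_left ha

/-- An alternating form depends only on the classes of its arguments modulo its kernel. -/
theorem alternatingMap_congr_ker {A M : Type*} [CommRing A] [AddCommGroup M] [Module A M]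
    (ω : M [⋀^Fin q]→ₗ[A] A) {w w' : Fin q → M} (h : ∀ i, w i - w' i ∈ alternatingKer ω) :
    ω w = ω w' := by
  classical
  have key : ∀ s : Finset (Fin q), ω (s.piecewise w w') = ω w' := by
    intro s
    induction s using Finset.induction_on with
    | empty => simp
    | insert i s hi ih =>
      rw [Finset.piecewise_insert]
      have e1 : w i = (w i - w' i) + w' i := by abel
      rw [e1, ω.map_update_add, h i, zero_add]
      rw [← ih]
      congr 1
      ext1 j
      by_cases hj : j = i
      · subst hj; simp [hi]
      · simp [hj]
  simpa using key Finset.univ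

/-- The vector `ω(w) v - ∑ₖ ω(w with v in place k) wₖ`, which lies in the kernel of `ω` if `ω` is
decomposable. -/
def contractionField {A M : Type*} [CommRing A] [AddCommGroup M] [Module A M]
    (ω : M [⋀^Fin q]→ₗ[A] A) (w : Fin q → M) (v : M) : M :=
  ω w • v - ∑ k, ω (Function.update w k v) • w k

theorem contractionField_sum {A M ι : Type*} [CommRing A] [AddCommGroup M] [Module A M]
    (ω : M [⋀^Fin q]→ₗ[A] A) (w : Fin q → M) (s : Finset ι) (c : ι → A) (v : ι → M) :
    contractionField ω w (∑ i ∈ s, c i • v i) = ∑ i ∈ s, c i • contractionField ω w (v i) := by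
  simp only [contractionField]
  have : ∀ k, ω (Function.update w k (∑ i ∈ s, c i • v i))
      = ∑ i ∈ s, c i * ω (Function.update w k (v i)) := by
    intro k
    have := map_sum (ω.toMultilinearMap.toLinearMap w k) (fun i => c i • v i) s
    exact this.trans (Finset.sum_congr rfl fun i _ => by rw [map_smul]; rfl)
  simp only [this, smul_sub, Finset.sum_sub_distrib, Finset.smul_sum, Finset.sum_smul]
  congr 1
  · refine Finset.sum_congr rfl fun i _ => ?_
    rw [smul_comm]
  · rw [Finset.sum_comm]
    refine Finset.sum_congr rfl fun i _ => Finset.sum_congr rfl fun k _ => ?_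
    rw [mul_smul]

theorem smul_eq_contractionField {A M : Type*} [CommRing A] [AddCommGroup M] [Module A M]
    {ω : M [⋀^Fin q]→ₗ[A] A} {v : M} (hv : v ∈ alternatingKer ω) (w : Fin q → M) :
    ω w • v = contractionField ω w v := by
  have : ∀ k, ω (Function.update w k v) = 0 := fun k => hv w k
  simp [contractionField, this]

/-- `contractionField` as a multilinear map in its tuple of vectors. -/
def contractionMultilinear {A M : Type*} [CommRing A] [AddCommGroup M] [Module A M]
    (ω : M [⋀^Fin q]→ₗ[A] A) (v : M) : MultilinearMap A (fun _ : Fin q => M) M where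
  toFun w := contractionField ω w v
  map_update_add' := by
    intro inst w i a b
    have hinst : inst = instDecidableEqFin q := Subsingleton.elim _ _
    subst hinst
    have key : ∀ k, ω (Function.update (Function.update w i (a + b)) k v)
        • Function.update w i (a + b) k
        = ω (Function.update (Function.update w i a) k v) • Function.update w i a k
        + ω (Function.update (Function.update w i b) k v) • Function.update w i b k := by
      intro k
      by_cases h : k = i
      · subst h; simp
      · simp only [Function.update_comm (Ne.symm h), Function.update_of_ne h, ω.map_update_add,
          add_smul]
    simp only [contractionField, key, Finset.sum_add_distrib, ω.map_update_add, add_smul]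
    abel
  map_update_smul' := by
    intro inst w i c a
    have hinst : inst = instDecidableEqFin q := Subsingleton.elim _ _
    subst hinst
    have key : ∀ k, ω (Function.update (Function.update w i (c • a)) k v)
        • Function.update w i (c • a) k
        = c • (ω (Function.update (Function.update w i a) k v) • Function.update w i a k) := by
      intro k
      by_cases h : k = i
      · subst h
        simp only [Function.update_idem, Function.update_self]
        rw [smul_comm]
      · simp only [Function.update_comm (Ne.symm h), Function.update_of_ne h, ω.map_update_smul,
          smul_assoc]
    simp only [contractionField, key, ← Finset.smul_sum, ω.map_update_smul, smul_assoc, smul_sub]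

/-- Membership is a multilinear condition in w and v once it is read in the quotient by the kernel,
so basis vectors suffice. -/
theorem contractionField_mem_of_basis {A : Type*} [CommRing A]
    {ω : (Fin n → A) [⋀^Fin q]→ₗ[A] A}
    (h : ∀ (K : Fin q → Fin n) (j : Fin n),
      contractionField ω (fun a => Pi.single (K a) 1) (Pi.single j 1) ∈ alternatingKer ω)
    (w : Fin q → Fin n → A) (v : Fin n → A) : contractionField ω w v ∈ alternatingKer ω := by
  have h1 : ∀ K : Fin q → Fin n,
      contractionField ω (fun a => Pi.single (K a) 1) v ∈ alternatingKer ω := by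
    intro K
    have hv : v = ∑ j, v j • (Pi.single j 1 : Fin n → A) := by
      exact pi_eq_sum_univ' v
    rw [hv, contractionField_sum]
    exact Submodule.sum_mem _ fun j _ => Submodule.smul_mem _ _ (h K j)
  have h2 : (alternatingKer ω).mkQ.compMultilinearMap (contractionMultilinear ω v) = 0 := by
    refine Module.Basis.ext_multilinear (fun _ => Pi.basisFun A (Fin n)) fun K => ?_
    simp only [LinearMap.compMultilinearMap_apply, zero_apply,
      Submodule.mkQ_apply, Submodule.Quotient.mk_eq_zero, Pi.basisFun_apply]
    exact h1 K
  have h3 := congrArg (fun f => f w) h2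
  exact (Submodule.Quotient.mk_eq_zero _).1 h3

end FormalFields

/-! ### Logarithmic frames and the formal structure of the distribution. -/

section FormalStructure

open MvPowerSeries

variable {n q : ℕ}

/-- The Jacobian matrix of a family of formal power series. -/
noncomputable def formalJacobian (y : Fin n → MvPowerSeries (Fin n) ℂ) :
    Matrix (Fin n) (Fin n) (MvPowerSeries (Fin n) ℂ) :=
  Matrix.of fun j k => pderiv ℂ k (y j)

theorem constantCoeff_pderiv_coordinate {y : Fin n → MvPowerSeries (Fin n) ℂ}
    (hy : ∀ i, (2 : ℕ∞) ≤ (y i - X i).order) (j k : Fin n) :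
    constantCoeff (pderiv ℂ k (y j)) = if j = k then 1 else 0 := by
  classical
  rw [← coeff_zero_eq_constantCoeff_apply, coeff_pderiv,
    vanishesBelow_coordinate (hy j) _ (by simp), coeff_X]
  simp [Finsupp.single_left_inj, eq_comm]

theorem isUnit_det_formalJacobian {y : Fin n → MvPowerSeries (Fin n) ℂ}
    (hy : ∀ i, (2 : ℕ∞) ≤ (y i - X i).order) : IsUnit (formalJacobian y).det := by
  classical
  rw [MvPowerSeries.isUnit_iff_constantCoeff, RingHom.map_det]
  have : (constantCoeff (σ := Fin n) (R := ℂ)).mapMatrix (formalJacobian y) = 1 := by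
    ext j k
    simp [formalJacobian, constantCoeff_pderiv_coordinate hy, Matrix.one_apply]
  rw [this, Matrix.det_one]
  exact isUnit_one

/-- The frame of formal vector fields `∂/∂yᵢ` for a system `y` of formal coordinates. -/
noncomputable def dualFrame (y : Fin n → MvPowerSeries (Fin n) ℂ) (i : Fin n) :
    Fin n → MvPowerSeries (Fin n) ℂ :=
  fun k => (formalJacobian y)⁻¹ k i

/-- The commuting vector fields `yᵢ ∂/∂yᵢ`. -/
noncomputable def logFrame (y : Fin n → MvPowerSeries (Fin n) ℂ) (i : Fin n) :
    Fin n → MvPowerSeries (Fin n) ℂ :=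
  y i • dualFrame y i

theorem derivAlong_eq_mulVec (y V : Fin n → MvPowerSeries (Fin n) ℂ) :
    (fun j => derivAlong V (y j)) = (formalJacobian y).mulVec V := by
  ext1 j
  rw [derivAlong_apply]
  simp [Matrix.mulVec, dotProduct, formalJacobian, mul_comm]

theorem formalField_ext {y : Fin n → MvPowerSeries (Fin n) ℂ}
    (hy : ∀ i, (2 : ℕ∞) ≤ (y i - X i).order) {V W : Fin n → MvPowerSeries (Fin n) ℂ}
    (h : ∀ j, derivAlong V (y j) = derivAlong W (y j)) : V = W := by
  have h1 : (formalJacobian y).mulVec V = (formalJacobian y).mulVec W := by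
    rw [← derivAlong_eq_mulVec, ← derivAlong_eq_mulVec]
    exact funext h
  have h2 := congrArg (formalJacobian y)⁻¹.mulVec h1
  simpa [Matrix.mulVec_mulVec, Matrix.nonsing_inv_mul _ (isUnit_det_formalJacobian hy)] using h2

theorem derivAlong_dualFrame {y : Fin n → MvPowerSeries (Fin n) ℂ}
    (hy : ∀ i, (2 : ℕ∞) ≤ (y i - X i).order) (i j : Fin n) :
    derivAlong (dualFrame y i) (y j) = if j = i then 1 else 0 := by
  have h := congrFun (derivAlong_eq_mulVec y (dualFrame y i)) j
  have h2 := congrFun (congrFun (Matrix.mul_nonsing_inv _ (isUnit_det_formalJacobian hy)) j) i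
  rw [h]
  rw [Matrix.one_apply] at h2
  rw [← h2]
  rfl

theorem derivAlong_logFrame {y : Fin n → MvPowerSeries (Fin n) ℂ}
    (hy : ∀ i, (2 : ℕ∞) ≤ (y i - X i).order) (i j : Fin n) :
    derivAlong (logFrame y i) (y j) = if j = i then y i else 0 := by
  rw [logFrame, derivAlong_smul_left, derivAlong_dualFrame hy]
  simp

theorem eq_sum_dualFrame {y : Fin n → MvPowerSeries (Fin n) ℂ}
    (hy : ∀ i, (2 : ℕ∞) ≤ (y i - X i).order) (V : Fin n → MvPowerSeries (Fin n) ℂ) :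
    V = ∑ j, derivAlong V (y j) • dualFrame y j := by
  refine formalField_ext hy fun k => ?_
  rw [derivAlong_sum_left]
  simp [derivAlong_smul_left, derivAlong_dualFrame hy]

/-- The fields yᵢ ∂/∂yᵢ are a frame only off the coordinate hyperplanes; the product of the yᵢ
clears the denominators. -/
theorem exists_prod_smul_eq_sum_logFrame {y : Fin n → MvPowerSeries (Fin n) ℂ}
    (hy : ∀ i, (2 : ℕ∞) ≤ (y i - X i).order) (V : Fin n → MvPowerSeries (Fin n) ℂ) :
    ∃ b : Fin n → MvPowerSeries (Fin n) ℂ, (∏ i, y i) • V = ∑ j, b j • logFrame y j := by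
  classical
  refine ⟨fun j => derivAlong V (y j) * ∏ i ∈ Finset.univ.erase j, y i, ?_⟩
  conv_lhs => rw [eq_sum_dualFrame hy V]
  rw [Finset.smul_sum]
  refine Finset.sum_congr rfl fun j _ => ?_
  rw [logFrame, smul_smul, smul_smul, mul_assoc, Finset.prod_erase_mul _ _ (Finset.mem_univ j),
    mul_comm]

theorem formalBracket_logFrame {y : Fin n → MvPowerSeries (Fin n) ℂ}
    (hy : ∀ i, (2 : ℕ∞) ≤ (y i - X i).order) (i j : Fin n) :
    formalBracket (logFrame y i) (logFrame y j) = 0 := by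
  refine formalField_ext hy fun k => ?_
  rw [derivAlong_formalBracket]
  simp only [derivAlong_logFrame hy]
  by_cases h1 : k = i <;> by_cases h2 : k = j <;>
    simp_all [derivAlong_logFrame hy, derivAlong_apply]

theorem eq_sum_smul_logFrame {y ξ : Fin n → MvPowerSeries (Fin n) ℂ} {lam : Fin n → ℂ}
    (hy : ∀ i, (2 : ℕ∞) ≤ (y i - X i).order) (hξy : ∀ i, derivAlong ξ (y i) = lam i • y i) :
    ξ = ∑ i, lam i • logFrame y i := by
  refine formalField_ext hy fun k => ?_
  have : ∀ i, lam i • logFrame y i = (C (lam i) : MvPowerSeries (Fin n) ℂ) • logFrame y i := by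
    intro i
    ext1 k
    simp [smul_eq_C_mul]
  simp only [this]
  rw [derivAlong_sum_left, hξy]
  simp [derivAlong_smul_left, derivAlong_logFrame hy, smul_eq_C_mul]

theorem formalBracket_constSmul_sum {y : Fin n → MvPowerSeries (Fin n) ℂ}
    (hy : ∀ i, (2 : ℕ∞) ≤ (y i - X i).order) (a b : Fin n → ℂ) :
    formalBracket (∑ i, a i • logFrame y i) (∑ i, b i • logFrame y i) = 0 := by
  have hC : ∀ (c : ℂ) (W : Fin n → MvPowerSeries (Fin n) ℂ), c • W
      = (C c : MvPowerSeries (Fin n) ℂ) • W := by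
    intro c W
    ext1 k
    simp [smul_eq_C_mul]
  have hconst : ∀ (V : Fin n → MvPowerSeries (Fin n) ℂ) (c : ℂ), derivAlong V (C c) = 0 := by
    intro V c
    simp [derivAlong_apply]
  simp only [hC]
  rw [formalBracket_sum_right]
  refine Finset.sum_eq_zero fun j _ => ?_
  rw [formalBracket_smul_right, hconst, zero_smul, zero_add, formalBracket_swap,
    formalBracket_sum_right, Finset.sum_eq_zero, neg_zero, smul_zero]
  intro i _
  rw [formalBracket_smul_right, hconst, zero_smul, zero_add, formalBracket_logFrame hy, smul_zero]

theorem constSmul_mem_alternatingKer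
    {ω : (Fin n → MvPowerSeries (Fin n) ℂ) [⋀^Fin q]→ₗ[MvPowerSeries (Fin n) ℂ]
      MvPowerSeries (Fin n) ℂ} {V : Fin n → MvPowerSeries (Fin n) ℂ} (c : ℂ)
    (h : V ∈ alternatingKer ω) : c • V ∈ alternatingKer ω := by
  have : c • V = (C c : MvPowerSeries (Fin n) ℂ) • V := by
    ext1 k
    simp [smul_eq_C_mul]
  rw [this]
  exact Submodule.smul_mem _ _ h

/-- The kernel of `ω` is stable under the bracket with `ξ` if this holds for the fields
`contractionField ω` of constant vectors. -/
theorem formalBracket_mem_of_basis {ξ : Fin n → MvPowerSeries (Fin n) ℂ}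
    {ω : (Fin n → MvPowerSeries (Fin n) ℂ) [⋀^Fin q]→ₗ[MvPowerSeries (Fin n) ℂ]
      MvPowerSeries (Fin n) ℂ} (hω : ω ≠ 0)
    (hker : ∀ (K : Fin q → Fin n) (j : Fin n),
      contractionField ω (fun a => Pi.single (K a) 1) (Pi.single j 1) ∈ alternatingKer ω)
    (hbr : ∀ (K : Fin q → Fin n) (j : Fin n),
      formalBracket ξ (contractionField ω (fun a => Pi.single (K a) 1) (Pi.single j 1))
        ∈ alternatingKer ω)
    {V : Fin n → MvPowerSeries (Fin n) ℂ} (hV : V ∈ alternatingKer ω) :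
    formalBracket ξ V ∈ alternatingKer ω := by
  obtain ⟨K, hK⟩ : ∃ K : Fin q → Fin n, ω (fun a => Pi.single (K a) 1) ≠ 0 := by
    by_contra hcon
    push Not at hcon
    refine hω (AlternatingMap.coe_multilinearMap_injective ?_)
    refine Module.Basis.ext_multilinear (fun _ => Pi.basisFun _ (Fin n)) fun K => ?_
    simpa using hcon K
  have h1 := smul_eq_contractionField hV (fun a => Pi.single (K a) 1)
  have hVs : V = ∑ j, V j • (Pi.single j 1 : Fin n → MvPowerSeries (Fin n) ℂ) :=
    pi_eq_sum_univ' V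
  have h2 : contractionField ω (fun a => Pi.single (K a) 1) V = ∑ j, V j •
      contractionField ω (fun a => Pi.single (K a) 1) (Pi.single j 1) := by
    conv_lhs => rw [hVs]
    exact contractionField_sum _ _ _ _ _
  -- A nonzero multiple of V is a combination of the tested fields. By the Leibniz rule its bracket
  -- is in the kernel, and the coefficient is cancelled afterwards.
  have h3 : formalBracket ξ (ω (fun a => Pi.single (K a) 1) • V) ∈ alternatingKer ω := by
    rw [h1, h2, formalBracket_sum_right]
    refine Submodule.sum_mem _ fun j _ => ?_
    rw [formalBracket_smul_right]
    exact Submodule.add_mem _ (Submodule.smul_mem _ _ (hker K j))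
      (Submodule.smul_mem _ _ (hbr K j))
  rw [formalBracket_smul_right] at h3
  exact mem_alternatingKer_of_smul_mem hK
    ((Submodule.add_mem_iff_right _ (Submodule.smul_mem _ _ hV)).1 h3)

/-- The logarithmic frame is a basis over the fraction field, so a nonzero form is nonzero on some
tuple from it. -/
theorem exists_logFrame_ne_zero {y : Fin n → MvPowerSeries (Fin n) ℂ}
    (hy : ∀ i, (2 : ℕ∞) ≤ (y i - X i).order)
    {ω : (Fin n → MvPowerSeries (Fin n) ℂ) [⋀^Fin q]→ₗ[MvPowerSeries (Fin n) ℂ]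
      MvPowerSeries (Fin n) ℂ} (hω : ω ≠ 0) :
    ∃ I : Fin q → Fin n, ω (fun a => logFrame y (I a)) ≠ 0 := by
  by_contra hcon
  push Not at hcon
  have hY : (∏ i, y i) ≠ 0 := Finset.prod_ne_zero_iff.2 fun i _ => (prime_coordinate (hy i)).ne_zero
  refine hω (AlternatingMap.ext fun w => ?_)
  choose b hb using fun a => exists_prod_smul_eq_sum_logFrame hy (w a)
  have h1 : ω (fun a => (∏ i, y i) • w a) = 0 := by
    simp only [hb]
    rw [← AlternatingMap.coe_multilinearMap, MultilinearMap.map_sum]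
    refine Finset.sum_eq_zero fun I _ => ?_
    rw [MultilinearMap.map_smul_univ, AlternatingMap.coe_multilinearMap, hcon I, smul_zero]
  rw [← AlternatingMap.coe_multilinearMap, MultilinearMap.map_smul_univ, smul_eq_mul] at h1
  refine (mul_eq_zero.1 h1).resolve_left ?_
  exact Finset.prod_ne_zero_iff.2 fun _ _ => hY

/-- Used to read off coefficients: if ω v ≠ 0, a combination of the vectors v in the kernel of ω has
all coefficients zero. -/
theorem map_update_sum_smul {A M : Type*} [CommRing A] [AddCommGroup M] [Module A M]
    (ω : M [⋀^Fin q]→ₗ[A] A) (v : Fin q → M) (k : Fin q) (d : Fin q → A) :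
    ω (Function.update v k (∑ l, d l • v l)) = d k * ω v := by
  have := map_sum (ω.toMultilinearMap.toLinearMap v k) (fun l => d l • v l) Finset.univ
  refine this.trans ?_
  rw [Finset.sum_eq_single k]
  · rw [map_smul]
    change d k • ω (Function.update v k (v k)) = _
    rw [Function.update_eq_self_iff.2 rfl, smul_eq_mul]
  · intro l _ hl
    rw [map_smul]
    change d l • ω (Function.update v k (v l)) = _
    rw [ω.map_eq_zero_of_eq _ (i := k) (j := l) (by simp [hl]) hl.symm, smul_zero]
  · simp

/-- The structure of a formal distribution with a nonresonant infinitesimal symmetry: it is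
spanned by constant combinations of the fields `yᵢ ∂/∂yᵢ`. -/
theorem exists_logarithmic_structure {y ξ : Fin n → MvPowerSeries (Fin n) ℂ} {lam : Fin n → ℂ}
    (hlam : LinearIndependent ℤ lam) (hξ : HasDiagLinearPart ξ lam)
    (hy : ∀ i, (2 : ℕ∞) ≤ (y i - X i).order) (hξy : ∀ i, derivAlong ξ (y i) = lam i • y i)
    {ω : (Fin n → MvPowerSeries (Fin n) ℂ) [⋀^Fin q]→ₗ[MvPowerSeries (Fin n) ℂ]
      MvPowerSeries (Fin n) ℂ} (hω : ω ≠ 0)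
    (hker : ∀ (K : Fin q → Fin n) (j : Fin n),
      contractionField ω (fun a => Pi.single (K a) 1) (Pi.single j 1) ∈ alternatingKer ω)
    (hbr : ∀ (K : Fin q → Fin n) (j : Fin n),
      formalBracket ξ (contractionField ω (fun a => Pi.single (K a) 1) (Pi.single j 1))
        ∈ alternatingKer ω) :
    ∃ (I : Fin q → Fin n) (c : Fin q → Fin n → ℂ),
      ω (fun a => logFrame y (I a)) ≠ 0 ∧ (∀ k l, c k (I l) = if k = l then 1 else 0) ∧
      ∀ j, logFrame y j - ∑ k, c k j • logFrame y (I k) ∈ alternatingKer ω := by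
  obtain ⟨I, hI⟩ := exists_logFrame_ne_zero hy hω
  set v := logFrame y with hv
  set F := ω (fun a => v (I a)) with hF
  have hξv : ∀ i, formalBracket ξ (v i) = 0 := by
    intro i
    have h1 := eq_sum_smul_logFrame hy hξy
    have h2 := formalBracket_constSmul_sum hy lam (Pi.single i 1)
    rw [← h1] at h2
    rw [← h2]
    congr 1
    simp [Pi.single_apply, hv]
  -- The quotient of this value by F is a first integral of ξ, hence constant.
  have hc : ∀ (k : Fin q) (j : Fin n), ∃ c : ℂ,
      ω (Function.update (fun a => v (I a)) k (v j)) = c • F := by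
    intro k j
    refine exists_eq_smul_of_mul_derivAlong_eq hlam hξ hI ?_
    have hmem := contractionField_mem_of_basis hker (fun a => v (I a)) (v j)
    have hbrk := formalBracket_mem_of_basis hω hker hbr hmem
    have e : formalBracket ξ (contractionField ω (fun a => v (I a)) (v j))
        = derivAlong ξ F • v j
          - ∑ k, derivAlong ξ (ω (Function.update (fun a => v (I a)) k (v j))) • v (I k) := by
      rw [contractionField, sub_eq_add_neg, ← Finset.sum_neg_distrib, formalBracket_add_right,
        formalBracket_smul_right, hξv, smul_zero, add_zero, formalBracket_sum_right,
        sub_eq_add_neg, ← Finset.sum_neg_distrib]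
      congr 1
      refine Finset.sum_congr rfl fun k _ => ?_
      rw [← neg_smul, formalBracket_smul_right, hξv, smul_zero, add_zero, map_neg, neg_smul]
    rw [e] at hbrk
    -- This combination eliminates vⱼ. What remains is a combination of the v_{Iₖ}, whose
    -- coefficients must vanish because F ≠ 0; they are the numerators of the derivatives ξ(G/F), up
    -- to sign.
    have h3 := Submodule.sub_mem _ (Submodule.smul_mem _ F hbrk)
      (Submodule.smul_mem _ (derivAlong ξ F) hmem)
    have h4 : F • (derivAlong ξ F • v j
          - ∑ k, derivAlong ξ (ω (Function.update (fun a => v (I a)) k (v j))) • v (I k))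
        - derivAlong ξ F • contractionField ω (fun a => v (I a)) (v j)
        = ∑ k, (derivAlong ξ F * ω (Function.update (fun a => v (I a)) k (v j))
          - F * derivAlong ξ (ω (Function.update (fun a => v (I a)) k (v j)))) • v (I k) := by
      simp only [contractionField, smul_sub, Finset.smul_sum, smul_smul, sub_smul,
        Finset.sum_sub_distrib, ← hF]
      rw [mul_comm F (derivAlong ξ F)]
      abel
    rw [h4] at h3
    have h5 := h3 (fun a => v (I a)) k
    rw [map_update_sum_smul] at h5
    have := (mul_eq_zero.1 h5).resolve_right hI
    linear_combination -this
  choose c hc using hc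
  refine ⟨I, c, hI, fun k l => ?_, fun j => ?_⟩
  · have h1 := hc k (I l)
    split_ifs with h
    · subst h
      rw [Function.update_eq_self_iff.2 rfl] at h1
      have h2 : (c k (I k) - 1) • F = 0 := by rw [sub_smul, one_smul, ← h1, sub_self]
      rcases smul_eq_zero.1 h2 with h3 | h3
      · exact sub_eq_zero.1 h3
      · exact absurd h3 hI
    · rw [ω.map_eq_zero_of_eq _ (i := k) (j := l) (by simp [Ne.symm h]) h] at h1
      exact (smul_eq_zero.1 h1.symm).resolve_right hI
  · refine mem_alternatingKer_of_smul_mem hI ?_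
    have hmem := contractionField_mem_of_basis hker (fun a => v (I a)) (v j)
    convert hmem using 1
    simp only [contractionField, hc, smul_sub, Finset.smul_sum]
    congr 1
    refine Finset.sum_congr rfl fun k _ => ?_
    rw [smul_assoc, smul_comm]

/-- A formal distribution with a nonresonant infinitesimal symmetry is involutive. -/
theorem formalBracket_mem_alternatingKer {y : Fin n → MvPowerSeries (Fin n) ℂ}
    (hy : ∀ i, (2 : ℕ∞) ≤ (y i - X i).order)
    {ω : (Fin n → MvPowerSeries (Fin n) ℂ) [⋀^Fin q]→ₗ[MvPowerSeries (Fin n) ℂ]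
      MvPowerSeries (Fin n) ℂ} {I : Fin q → Fin n} {c : Fin q → Fin n → ℂ}
    (hI : ω (fun a => logFrame y (I a)) ≠ 0)
    (hc : ∀ j, logFrame y j - ∑ k, c k j • logFrame y (I k) ∈ alternatingKer ω)
    {V W : Fin n → MvPowerSeries (Fin n) ℂ} (hV : V ∈ alternatingKer ω)
    (hW : W ∈ alternatingKer ω) : formalBracket V W ∈ alternatingKer ω := by
  have hC : ∀ (c : ℂ) (W : Fin n → MvPowerSeries (Fin n) ℂ), c • W
      = (C c : MvPowerSeries (Fin n) ℂ) • W := by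
    intro c W
    ext1 k
    simp [smul_eq_C_mul]
  set v := logFrame y with hv
  set T : Fin n → Fin n → MvPowerSeries (Fin n) ℂ := fun j => v j - ∑ k, c k j • v (I k) with hT
  have hY : (∏ i, y i) ≠ 0 := Finset.prod_ne_zero_iff.2 fun i _ => (prime_coordinate (hy i)).ne_zero
  -- Modulo the `T j`, a multiple of V is a combination of the v_{Iₖ} that lies in the kernel, so it
  -- is zero.
  have hspan : ∀ V ∈ alternatingKer ω, ∃ b : Fin n → MvPowerSeries (Fin n) ℂ,
      (∏ i, y i) • V = ∑ j, b j • T j := by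
    intro V hV
    obtain ⟨b, hb⟩ := exists_prod_smul_eq_sum_logFrame hy V
    refine ⟨b, ?_⟩
    have h1 : (∏ i, y i) • V - ∑ j, b j • T j
        = ∑ k, (∑ j, b j * C (c k j)) • v (I k) := by
      rw [hb]
      simp only [hT, hC, smul_sub, Finset.sum_sub_distrib, Finset.smul_sum, smul_smul,
        Finset.sum_smul]
      rw [sub_sub_cancel, Finset.sum_comm]
    have h2 : (∏ i, y i) • V - ∑ j, b j • T j ∈ alternatingKer ω :=
      Submodule.sub_mem _ (Submodule.smul_mem _ _ hV)
        (Submodule.sum_mem _ fun j _ => Submodule.smul_mem _ _ (hc j))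
    rw [h1] at h2
    have h3 : ∀ k, (∑ j, b j * C (c k j)) = 0 := by
      intro k
      have h4 := h2 (fun a => v (I a)) k
      rw [map_update_sum_smul ω (fun a => v (I a))] at h4
      exact (mul_eq_zero.1 h4).resolve_right hI
    rw [← sub_eq_zero, h1]
    simp [h3]
  have hTT : ∀ i j, formalBracket (T i) (T j) = 0 := by
    have hrep : ∀ j, T j = ∑ i, ((Pi.single j 1 : Fin n → ℂ) i
        - ∑ k, c k j * (Pi.single (I k) 1 : Fin n → ℂ) i) • v i := by
      intro j
      simp only [hT, sub_smul, Finset.sum_sub_distrib, Finset.sum_smul]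
      congr 1
      · simp [Pi.single_apply]
      · rw [Finset.sum_comm]
        refine Finset.sum_congr rfl fun k _ => ?_
        simp [Pi.single_apply]
    intro i j
    rw [hrep i, hrep j]
    exact formalBracket_constSmul_sum hy _ _
  obtain ⟨b, hb⟩ := hspan V hV
  obtain ⟨b', hb'⟩ := hspan W hW
  have h1 : formalBracket (∑ j, b j • T j) (∑ l, b' l • T l) ∈ alternatingKer ω := by
    rw [formalBracket_sum_right]
    refine Submodule.sum_mem _ fun l _ => ?_
    rw [formalBracket_smul_right]
    refine Submodule.add_mem _ (Submodule.smul_mem _ _ (hc l)) (Submodule.smul_mem _ _ ?_)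
    rw [formalBracket_swap, formalBracket_sum_right]
    refine Submodule.neg_mem _ (Submodule.sum_mem _ fun j _ => ?_)
    rw [formalBracket_smul_right, hTT, smul_zero, add_zero]
    exact Submodule.smul_mem _ _ (hc j)
  rw [← hb, ← hb', formalBracket_smul_right] at h1
  -- The factor ∏ yᵢ is removed from W and then from V; by the Leibniz rule it only adds multiples
  -- of W and V, which are in the kernel.
  have h2 := mem_alternatingKer_of_smul_mem hY
    ((Submodule.add_mem_iff_right _ (Submodule.smul_mem _ _ hW)).1 h1)
  rw [formalBracket_swap, Submodule.neg_mem_iff, formalBracket_smul_right] at h2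
  have h3 := mem_alternatingKer_of_smul_mem hY
    ((Submodule.add_mem_iff_right _ (Submodule.smul_mem _ _ hV)).1 h2)
  rw [formalBracket_swap]
  exact Submodule.neg_mem _ h3

end FormalStructure

/-! ### Taylor expansions of analytic functions -/

section Taylor

open MvPowerSeries Asymptotics

variable {n : ℕ}

/-- `f` is analytic at the origin, with Taylor series `φ`. -/
def HasTaylor (f : (Fin n → ℂ) → ℂ) (φ : MvPowerSeries (Fin n) ℂ) : Prop :=
  AnalyticAt ℂ f 0 ∧ ∀ N : ℕ, ∃ P : MvPolynomial (Fin n) ℂ, (N : ℕ∞) ≤ (φ - P).order ∧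
    (fun x => f x - MvPolynomial.eval x P) =O[𝓝 0] fun x => ‖x‖ ^ N

theorem isBigO_norm_pow_of_le {M N : ℕ} (h : N ≤ M) :
    (fun x : Fin n → ℂ => ‖x‖ ^ M) =O[𝓝 0] fun x => ‖x‖ ^ N := by
  refine IsBigO.of_bound 1 ?_
  filter_upwards [Metric.ball_mem_nhds (0 : Fin n → ℂ) one_pos] with x hx
  rw [mem_ball_zero_iff] at hx
  simpa using pow_le_pow_of_le_one (norm_nonneg x) hx.le h

theorem eval_isBigO_of_le_order {P : MvPolynomial (Fin n) ℂ} {N : ℕ}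
    (h : (N : ℕ∞) ≤ (P : MvPowerSeries (Fin n) ℂ).order) :
    (fun x => MvPolynomial.eval x P) =O[𝓝 0] fun x => ‖x‖ ^ N := by
  simp only [MvPolynomial.eval_eq]
  refine IsBigO.fun_sum fun m hm => ?_
  have hdeg : N ≤ m.degree := by
    by_contra hcon
    have : coeff m (P : MvPowerSeries (Fin n) ℂ) = 0 :=
      coeff_of_lt_order (lt_of_lt_of_le (by exact_mod_cast not_le.1 hcon) h)
    rw [MvPolynomial.coeff_coe] at this
    exact (MvPolynomial.mem_support_iff.1 hm) this
  refine IsBigO.trans (IsBigO.of_bound ‖P.coeff m‖ (Eventually.of_forall fun x => ?_))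
    (isBigO_norm_pow_of_le hdeg)
  rw [norm_mul]
  refine mul_le_mul_of_nonneg_left ?_ (norm_nonneg _)
  rw [norm_prod, norm_pow, norm_norm]
  have : ‖x‖ ^ m.degree = ∏ i ∈ m.support, ‖x‖ ^ m i := by
    rw [Finset.prod_pow_eq_pow_sum]; rfl
  rw [this]
  refine Finset.prod_le_prod (fun i _ => norm_nonneg _) fun i _ => ?_
  rw [norm_pow]
  exact pow_le_pow_left₀ (norm_nonneg _) (norm_le_pi_norm x i) _

theorem analyticAt_eval (P : MvPolynomial (Fin n) ℂ) (x : Fin n → ℂ) :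
    AnalyticAt ℂ (fun x => MvPolynomial.eval x P) x := by
  simp only [MvPolynomial.eval_eq]
  refine Finset.analyticAt_fun_sum _ fun m _ => ?_
  refine analyticAt_const.mul (Finset.analyticAt_fun_prod _ fun i _ => ?_)
  exact (ContinuousLinearMap.analyticAt (ContinuousLinearMap.proj (R := ℂ) i) x).pow _

theorem hasTaylor_eval (P : MvPolynomial (Fin n) ℂ) :
    HasTaylor (fun x => MvPolynomial.eval x P) P :=
  ⟨analyticAt_eval P 0, fun N => ⟨P, by simp, by simpa using isBigO_zero _ _⟩⟩

theorem hasTaylor_const (c : ℂ) : HasTaylor (fun _ : Fin n → ℂ => c) (C c) := by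
  simpa using hasTaylor_eval (n := n) (MvPolynomial.C c)

namespace HasTaylor

variable {f g : (Fin n → ℂ) → ℂ} {φ ψ : MvPowerSeries (Fin n) ℂ}

theorem add (hf : HasTaylor f φ) (hg : HasTaylor g ψ) :
    HasTaylor (fun x => f x + g x) (φ + ψ) := by
  refine ⟨hf.1.add hg.1, fun N => ?_⟩
  obtain ⟨P, hP, hP'⟩ := hf.2 N
  obtain ⟨Q, hQ, hQ'⟩ := hg.2 N
  refine ⟨P + Q, ?_, ?_⟩
  · have : φ + ψ - ((P + Q : MvPolynomial (Fin n) ℂ) : MvPowerSeries (Fin n) ℂ)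
        = (φ - P) + (ψ - Q) := by push_cast; ring
    rw [this]
    exact le_order_add hP hQ
  · refine (hP'.add hQ').congr_left fun x => ?_
    simp only [map_add]; ring

theorem mul (hf : HasTaylor f φ) (hg : HasTaylor g ψ) :
    HasTaylor (fun x => f x * g x) (φ * ψ) := by
  refine ⟨hf.1.mul hg.1, fun N => ?_⟩
  obtain ⟨P, hP, hP'⟩ := hf.2 N
  obtain ⟨Q, hQ, hQ'⟩ := hg.2 N
  refine ⟨P * Q, ?_, ?_⟩
  · have : φ * ψ - ((P * Q : MvPolynomial (Fin n) ℂ) : MvPowerSeries (Fin n) ℂ)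
        = (φ - P) * ψ + P * (ψ - Q) := by push_cast; ring
    rw [this]
    exact le_order_add (le_order_mul_right hP) (le_order_mul_left hQ)
  · have hgb : g =O[𝓝 0] fun _ => (1 : ℝ) := hg.1.continuousAt.isBigO_one ℝ
    have hPb : (fun x => MvPolynomial.eval x P) =O[𝓝 0] fun _ => (1 : ℝ) :=
      (analyticAt_eval P 0).continuousAt.isBigO_one ℝ
    have h1 := hP'.mul hgb
    have h2 := hPb.mul hQ'
    simp only [mul_one, one_mul] at h1 h2
    refine (h1.add h2).congr_left fun x => ?_
    simp only [map_mul]; ring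

theorem neg (hf : HasTaylor f φ) : HasTaylor (fun x => -f x) (-φ) := by
  have := (hasTaylor_const (n := n) (-1)).mul hf
  simpa using this

theorem sub (hf : HasTaylor f φ) (hg : HasTaylor g ψ) :
    HasTaylor (fun x => f x - g x) (φ - ψ) := by
  simpa [sub_eq_add_neg] using hf.add hg.neg

theorem sum {ι : Type*} {s : Finset ι} {f : ι → (Fin n → ℂ) → ℂ}
    {φ : ι → MvPowerSeries (Fin n) ℂ} (h : ∀ i ∈ s, HasTaylor (f i) (φ i)) :
    HasTaylor (fun x => ∑ i ∈ s, f i x) (∑ i ∈ s, φ i) := by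
  classical
  induction s using Finset.induction_on with
  | empty => simpa using hasTaylor_const (n := n) 0
  | insert i s hi ih =>
    simp only [Finset.sum_insert hi]
    exact (h i (by simp)).add (ih fun j hj => h j (by simp [hj]))

theorem prod {ι : Type*} {s : Finset ι} {f : ι → (Fin n → ℂ) → ℂ}
    {φ : ι → MvPowerSeries (Fin n) ℂ} (h : ∀ i ∈ s, HasTaylor (f i) (φ i)) :
    HasTaylor (fun x => ∏ i ∈ s, f i x) (∏ i ∈ s, φ i) := by
  classical
  induction s using Finset.induction_on with
  | empty => simpa using hasTaylor_const (n := n) 1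
  | insert i s hi ih =>
    simp only [Finset.prod_insert hi]
    exact (h i (by simp)).mul (ih fun j hj => h j (by simp [hj]))

theorem congr (hf : HasTaylor f φ) (h : f =ᶠ[𝓝 0] g) : HasTaylor g φ := by
  refine ⟨hf.1.congr h, fun N => ?_⟩
  obtain ⟨P, hP, hP'⟩ := hf.2 N
  refine ⟨P, hP, hP'.congr' ?_ EventuallyEq.rfl⟩
  filter_upwards [h] with x hx
  rw [hx]

theorem isBigO_of_le_order (hf : HasTaylor f φ) {N : ℕ} (h : (N : ℕ∞) ≤ φ.order) :
    f =O[𝓝 0] fun x => ‖x‖ ^ N := by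
  obtain ⟨P, hP, hP'⟩ := hf.2 N
  have h1 : (N : ℕ∞) ≤ (P : MvPowerSeries (Fin n) ℂ).order := by
    have : (P : MvPowerSeries (Fin n) ℂ) = φ - (φ - P) := by ring
    rw [this]
    exact le_order_sub h hP
  refine (hP'.add (eval_isBigO_of_le_order h1)).congr_left fun x => ?_
  ring

end HasTaylor

/-- If the homogeneous terms below degree k vanish, the term of degree k is O(‖y‖ᵏ⁺¹), hence zero;
induction kills the whole Taylor expansion. -/
theorem eventually_eq_zero_of_forall_isBigO {E F : Type*} [NormedAddCommGroup E]
    [NormedSpace ℂ E] [NormedAddCommGroup F] [NormedSpace ℂ F] {f : E → F}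
    (hf : AnalyticAt ℂ f 0) (h : ∀ N : ℕ, f =O[𝓝 0] fun x => ‖x‖ ^ N) : ∀ᶠ x in 𝓝 0, f x = 0 := by
  obtain ⟨p, hp⟩ := hf
  have hzero : ∀ k y, (p k fun _ => y) = 0 := by
    intro k
    induction k using Nat.strong_induction_on with
    | _ k ih =>
      have h1 := (hp.isBigO_sub_partialSum_pow (k + 1))
      simp only [zero_add] at h1
      have h2 : (fun y => p k fun _ => y) =O[𝓝 0] fun y => ‖y‖ ^ (k + 1) := by
        have h3 := (h (k + 1)).sub h1
        refine h3.congr_left fun y => ?_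
        rw [FormalMultilinearSeries.partialSum, Finset.sum_range_succ, Finset.sum_eq_zero]
        · simp
        · intro j hj
          exact ih j (Finset.mem_range.1 hj) y
      exact h2.continuousMultilinearMap_apply_eq_zero
  filter_upwards [hp.eventually_hasSum] with y hy
  simp only [hzero, zero_add] at hy
  exact hy.unique hasSum_zero

theorem HasTaylor.eventually_eq_zero {f : (Fin n → ℂ) → ℂ} (hf : HasTaylor f 0) :
    ∀ᶠ x in 𝓝 0, f x = 0 :=
  eventually_eq_zero_of_forall_isBigO hf.1 fun N => hf.isBigO_of_le_order (by simp)

theorem exists_hasTaylor {f : (Fin n → ℂ) → ℂ} (hf : AnalyticAt ℂ f 0) :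
    ∃ φ, HasTaylor f φ := by
  classical
  obtain ⟨p, hp⟩ := id hf
  let Q : ℕ → MvPolynomial (Fin n) ℂ := fun k =>
    ∑ r : Fin k → Fin n, MvPolynomial.C (p k fun a => Pi.single (r a) 1)
      * ∏ a, MvPolynomial.X (r a)
  have hQhom : ∀ k, (Q k).IsHomogeneous k := by
    intro k
    refine MvPolynomial.IsHomogeneous.sum _ _ _ fun r _ => ?_
    have h1 := (MvPolynomial.IsHomogeneous.prod (R := ℂ) Finset.univ
      (fun a => MvPolynomial.X (r a)) (fun _ => 1) (fun a _ => MvPolynomial.isHomogeneous_X ℂ (r a)))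
    have h2 := (MvPolynomial.isHomogeneous_C (Fin n) (p k fun a => Pi.single (r a) 1)).mul h1
    simpa using h2
  have hQeval : ∀ k x, MvPolynomial.eval x (Q k) = p k fun _ => x := by
    intro k x
    have hx : x = ∑ j, x j • (Pi.single j 1 : Fin n → ℂ) := pi_eq_sum_univ' x
    conv_rhs => rw [hx]
    rw [ContinuousMultilinearMap.map_sum]
    simp only [Q, map_sum, map_mul, MvPolynomial.eval_C, map_prod, MvPolynomial.eval_X]
    refine Finset.sum_congr rfl fun r _ => ?_
    rw [ContinuousMultilinearMap.map_smul_univ, smul_eq_mul, mul_comm]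
  -- `Q k` is homogeneous of degree k, so a coefficient is found in the single polynomial of its
  -- degree.
  let φ : MvPowerSeries (Fin n) ℂ := fun m => MvPolynomial.coeff m (Q m.degree)
  refine ⟨φ, hf, fun N => ⟨∑ k ∈ Finset.range N, Q k, ?_, ?_⟩⟩
  · refine nat_le_order fun d hd => ?_
    have h1 : coeff d φ = MvPolynomial.coeff d (Q d.degree) := rfl
    have h2 : MvPolynomial.coeff d (∑ k ∈ Finset.range N, Q k)
        = MvPolynomial.coeff d (Q d.degree) := by
      rw [MvPolynomial.coeff_sum]
      refine Finset.sum_eq_single (f := fun k => MvPolynomial.coeff d (Q k)) d.degree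
        (fun k _ hk => (hQhom k).coeff_eq_zero hk.symm) fun h => ?_
      exact absurd (Finset.mem_range.2 hd) h
    rw [map_sub, h1, MvPolynomial.coeff_coe, h2, sub_self]
  · have h1 := hp.isBigO_sub_partialSum_pow N
    simp only [zero_add] at h1
    refine h1.congr_left fun x => ?_
    simp only [FormalMultilinearSeries.partialSum, map_sum, hQeval]

/-- Cauchy's estimate on a disc around x whose radius is comparable to ‖x‖. It makes partial
derivatives compatible with Taylor series. -/
theorem isBigO_fderiv_of_isBigO {f : (Fin n → ℂ) → ℂ} (hf : AnalyticAt ℂ f 0) {N : ℕ}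
    (h : f =O[𝓝 0] fun x => ‖x‖ ^ (N + 1)) (i : Fin n) :
    (fun x => fderiv ℂ f x (Pi.single i 1)) =O[𝓝 0] fun x => ‖x‖ ^ N := by
  obtain ⟨B, hB0, hB⟩ := h.exists_pos
  rw [IsBigOWith] at hB
  have hd : ∀ᶠ x in 𝓝 (0 : Fin n → ℂ), DifferentiableAt ℂ f x :=
    hf.eventually_analyticAt.mono fun x hx => hx.differentiableAt
  obtain ⟨R, hR, hball⟩ := Metric.eventually_nhds_iff_ball.1 (hB.and hd)
  refine IsBigO.of_bound (B * 2 ^ (N + 1)) ?_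
  filter_upwards [Metric.ball_mem_nhds (0 : Fin n → ℂ) (half_pos hR)] with x hx
  rw [mem_ball_zero_iff] at hx
  have key : ∀ r : ℝ, ‖x‖ < r → r < R / 2 →
      ‖fderiv ℂ f x (Pi.single i 1)‖ ≤ B * 2 ^ (N + 1) * r ^ N := by
    intro r hr1 hr2
    have hr0 : 0 < r := (norm_nonneg x).trans_lt hr1
    let L : ℂ → Fin n → ℂ := fun s => x + s • Pi.single i 1
    have hLd : ∀ s, HasDerivAt L (Pi.single i 1) s := by
      intro s
      have := ((hasDerivAt_id s).smul_const (Pi.single i 1 : Fin n → ℂ)).const_add x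
      rw [one_smul] at this
      exact this
    have hLn : ∀ s : ℂ, ‖s‖ ≤ r → ‖L s‖ ≤ 2 * r := by
      intro s hs
      have h1 : ‖s • (Pi.single i 1 : Fin n → ℂ)‖ ≤ r := by
        rw [norm_smul]
        have : ‖(Pi.single i 1 : Fin n → ℂ)‖ = 1 := by
          rw [Pi.norm_single, norm_one]
        rw [this, mul_one]
        exact hs
      calc ‖L s‖ ≤ ‖x‖ + ‖s • (Pi.single i 1 : Fin n → ℂ)‖ := norm_add_le _ _
        _ ≤ 2 * r := by linarith
    have hmem : ∀ s : ℂ, ‖s‖ ≤ r → L s ∈ Metric.ball (0 : Fin n → ℂ) R := by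
      intro s hs
      rw [mem_ball_zero_iff]
      linarith [hLn s hs]
    have hdiff : ∀ s : ℂ, ‖s‖ ≤ r → HasDerivAt (fun s => f (L s))
        (fderiv ℂ f (L s) (Pi.single i 1)) s := by
      intro s hs
      exact ((hball _ (hmem s hs)).2.hasFDerivAt.comp_hasDerivAt s (hLd s))
    have hcl : DiffContOnCl ℂ (fun s => f (L s)) (Metric.ball 0 r) := by
      refine DifferentiableOn.diffContOnCl_ball (U := Metric.closedBall 0 r) ?_ subset_rfl
      intro s hs
      exact (hdiff s (mem_closedBall_zero_iff.1 hs)).differentiableAt.differentiableWithinAt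
    have hest := Complex.norm_deriv_le_of_forall_mem_sphere_norm_le (C := B * (2 * r) ^ (N + 1))
      hr0 hcl (by
        intro s hs
        have hs' : ‖s‖ = r := by simpa using hs
        refine ((hball _ (hmem s hs'.le)).1).trans ?_
        rw [norm_pow, norm_norm]
        exact mul_le_mul_of_nonneg_left (pow_le_pow_left₀ (norm_nonneg _) (hLn s hs'.le) _) hB0.le)
    rw [(hdiff 0 (by simpa using hr0.le)).deriv] at hest
    have hL0 : L 0 = x := by simp [L]
    rw [hL0] at hest
    refine hest.trans (le_of_eq ?_)
    field_simp
    ring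
  rw [norm_pow, norm_norm]
  -- The radius r = ‖x‖ is not allowed at x = 0, so the bound is obtained for r > ‖x‖ and r tends to
  -- ‖x‖.
  have hlim : Tendsto (fun r : ℝ => B * 2 ^ (N + 1) * r ^ N) (𝓝[>] ‖x‖)
      (𝓝 (B * 2 ^ (N + 1) * ‖x‖ ^ N)) := by
    refine Tendsto.mono_left ?_ nhdsWithin_le_nhds
    exact (Continuous.tendsto (by fun_prop) _)
  refine ge_of_tendsto hlim ?_
  filter_upwards [Ioo_mem_nhdsGT hx] with r hr
  exact key r hr.1 hr.2

theorem fderiv_eval (P : MvPolynomial (Fin n) ℂ) (i : Fin n) (x : Fin n → ℂ) :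
    fderiv ℂ (fun x => MvPolynomial.eval x P) x (Pi.single i 1)
      = MvPolynomial.eval x (MvPolynomial.pderiv i P) := by
  classical
  induction P using MvPolynomial.induction_on with
  | C a => simp
  | add p q hp hq =>
    simp only [map_add]
    rw [fderiv_fun_add (analyticAt_eval p x).differentiableAt (analyticAt_eval q x).differentiableAt]
    simp [hp, hq]
  | mul_X p j hp =>
    simp only [map_mul, MvPolynomial.eval_X]
    have h1 : HasFDerivAt (fun x : Fin n → ℂ => x j)
        (ContinuousLinearMap.proj (R := ℂ) (φ := fun _ : Fin n => ℂ) j) x :=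
      (ContinuousLinearMap.proj (R := ℂ) (φ := fun _ : Fin n => ℂ) j).hasFDerivAt
    rw [((analyticAt_eval p x).differentiableAt.hasFDerivAt.fun_mul h1).fderiv]
    simp [hp, MvPolynomial.pderiv_X, Pi.single_apply]
    by_cases hij : j = i
    · subst hij; simp
    · simp [hij]

theorem HasTaylor.pderiv {f : (Fin n → ℂ) → ℂ} {φ : MvPowerSeries (Fin n) ℂ}
    (hf : HasTaylor f φ) (i : Fin n) :
    HasTaylor (fun x => fderiv ℂ f x (Pi.single i 1)) (MvPowerSeries.pderiv ℂ i φ) := by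
  refine ⟨?_, fun N => ?_⟩
  · exact ((ContinuousLinearMap.apply ℂ ℂ (Pi.single i 1 : Fin n → ℂ)).analyticAt _).comp
      hf.1.fderiv
  obtain ⟨P, hP, hP'⟩ := hf.2 (N + 1)
  refine ⟨MvPolynomial.pderiv i P, ?_, ?_⟩
  · have := le_order_pderiv i hP
    rw [map_sub, MvPowerSeries.pderiv_coe] at this
    simpa using this
  · have h1 := isBigO_fderiv_of_isBigO (hf.1.sub (analyticAt_eval P 0)) hP' i
    refine h1.congr' ?_ EventuallyEq.rfl
    filter_upwards [hf.1.eventually_analyticAt] with x hx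
    have h2 := fderiv_sub hx.differentiableAt (analyticAt_eval P x).differentiableAt
    rw [h2, sub_apply, fderiv_eval]

end Taylor

/-! ### Initial forms, and uniqueness of the Taylor series. -/

section InitialForms

open MvPowerSeries Asymptotics

variable {n : ℕ}

/-- `φ` has order at least `D`, and `L` is its homogeneous part of degree `D`. -/
def HasInit (φ : MvPowerSeries (Fin n) ℂ) (D : ℕ) (L : MvPolynomial (Fin n) ℂ) : Prop :=
  L.IsHomogeneous D ∧ ((D + 1 : ℕ) : ℕ∞) ≤ (φ - L).order

theorem le_order_of_isHomogeneous {L : MvPolynomial (Fin n) ℂ} {D : ℕ} (h : L.IsHomogeneous D) :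
    (D : ℕ∞) ≤ (L : MvPowerSeries (Fin n) ℂ).order := by
  refine nat_le_order fun d hd => ?_
  rw [MvPolynomial.coeff_coe]
  exact h.coeff_eq_zero hd.ne

namespace HasInit

variable {φ ψ : MvPowerSeries (Fin n) ℂ} {D E : ℕ} {L M : MvPolynomial (Fin n) ℂ}

theorem le_order (h : HasInit φ D L) : (D : ℕ∞) ≤ φ.order := by
  have : φ = (φ - L) + L := by ring
  rw [this]
  exact le_order_add (le_trans (by exact_mod_cast Nat.le_succ D) h.2)
    (le_order_of_isHomogeneous h.1)

theorem mul (h : HasInit φ D L) (h' : HasInit ψ E M) : HasInit (φ * ψ) (D + E) (L * M) := by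
  refine ⟨h.1.mul h'.1, ?_⟩
  have e : φ * ψ - ((L * M : MvPolynomial (Fin n) ℂ) : MvPowerSeries (Fin n) ℂ)
      = (φ - L) * ψ + L * (ψ - M) := by push_cast; ring
  rw [e]
  refine le_order_add (le_trans ?_ (add_le_order_mul h.2 h'.le_order))
    (le_trans ?_ (add_le_order_mul (le_order_of_isHomogeneous h.1) h'.2))
  · exact_mod_cast (by omega)
  · exact_mod_cast (by omega)

theorem add (h : HasInit φ D L) (h' : HasInit ψ D M) : HasInit (φ + ψ) D (L + M) := by
  refine ⟨h.1.add h'.1, ?_⟩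
  have e : φ + ψ - ((L + M : MvPolynomial (Fin n) ℂ) : MvPowerSeries (Fin n) ℂ)
      = (φ - L) + (ψ - M) := by push_cast; ring
  rw [e]
  exact le_order_add h.2 h'.2

theorem const (c : ℂ) : HasInit (C c : MvPowerSeries (Fin n) ℂ) 0 (MvPolynomial.C c) :=
  ⟨MvPolynomial.isHomogeneous_C _ _, by simp⟩

theorem zero (D : ℕ) : HasInit (0 : MvPowerSeries (Fin n) ℂ) D 0 :=
  ⟨MvPolynomial.isHomogeneous_zero _ _ _, by simp⟩

theorem sum {ι : Type*} {s : Finset ι} {φ : ι → MvPowerSeries (Fin n) ℂ}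
    {L : ι → MvPolynomial (Fin n) ℂ} (h : ∀ i ∈ s, HasInit (φ i) D (L i)) :
    HasInit (∑ i ∈ s, φ i) D (∑ i ∈ s, L i) := by
  classical
  induction s using Finset.induction_on with
  | empty => simpa using zero D
  | insert i s hi ih =>
    simp only [Finset.sum_insert hi]
    exact (h i (by simp)).add (ih fun j hj => h j (by simp [hj]))

theorem prod {ι : Type*} {s : Finset ι} {φ : ι → MvPowerSeries (Fin n) ℂ} {D : ι → ℕ}
    {L : ι → MvPolynomial (Fin n) ℂ} (h : ∀ i ∈ s, HasInit (φ i) (D i) (L i)) :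
    HasInit (∏ i ∈ s, φ i) (∑ i ∈ s, D i) (∏ i ∈ s, L i) := by
  classical
  induction s using Finset.induction_on with
  | empty => simpa using const (n := n) 1
  | insert i s hi ih =>
    simp only [Finset.prod_insert hi, Finset.sum_insert hi]
    exact (h i (by simp)).mul (ih fun j hj => h j (by simp [hj]))

theorem isBigO (h : HasInit φ D L) {f : (Fin n → ℂ) → ℂ} (hf : HasTaylor f φ) :
    (fun x => f x - MvPolynomial.eval x L) =O[𝓝 0] fun x => ‖x‖ ^ (D + 1) :=
  (hf.sub (hasTaylor_eval L)).isBigO_of_le_order h.2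

end HasInit

theorem hasInit_coordinate {y : MvPowerSeries (Fin n) ℂ} {i : Fin n}
    (hy : (2 : ℕ∞) ≤ (y - X i).order) : HasInit y 1 (MvPolynomial.X i) :=
  ⟨MvPolynomial.isHomogeneous_X _ _, by simpa using hy⟩

theorem hasInit_constantCoeff (φ : MvPowerSeries (Fin n) ℂ) :
    HasInit φ 0 (MvPolynomial.C (constantCoeff φ)) := by
  refine ⟨MvPolynomial.isHomogeneous_C _ _, nat_le_order fun d hd => ?_⟩
  have : d = 0 := (Finsupp.degree_eq_zero_iff d).1 (by omega)
  subst this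
  simp

theorem exists_hasInit {φ : MvPowerSeries (Fin n) ℂ} (hφ : φ ≠ 0) :
    ∃ D L, L ≠ 0 ∧ HasInit φ D L := by
  classical
  have hD := ne_zero_iff_order_finite.1 hφ
  set D := φ.order.toNat with hDdef
  let L : MvPolynomial (Fin n) ℂ := ∑ m ∈ Finset.finsuppAntidiag Finset.univ D,
    MvPolynomial.monomial m (coeff m φ)
  have hL : ∀ m : Fin n →₀ ℕ, m.degree = D → L.coeff m = coeff m φ := by
    intro m hm
    simp only [L, MvPolynomial.coeff_sum, MvPolynomial.coeff_monomial]
    rw [Finset.sum_eq_single m]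
    · simp
    · intro k _ hk
      rw [if_neg hk]
    · intro h
      refine absurd ?_ h
      rw [Finset.mem_finsuppAntidiag]
      exact ⟨by rw [← hm, Finsupp.degree_eq_sum], Finset.subset_univ _⟩
  have hhom : L.IsHomogeneous D := by
    refine MvPolynomial.IsHomogeneous.sum _ _ _ fun m hm => ?_
    refine MvPolynomial.isHomogeneous_monomial _ ?_
    rw [Finset.mem_finsuppAntidiag] at hm
    rw [Finsupp.degree_eq_sum, hm.1]
  obtain ⟨d, hd, hd'⟩ := exists_coeff_ne_zero_and_order hD
  refine ⟨D, L, ?_, hhom, nat_le_order fun d hd => ?_⟩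
  · intro h
    have hdd : d.degree = D := by
      have := hd'.trans hD.symm
      exact_mod_cast this
    have := hL d hdd
    rw [h, MvPolynomial.coeff_zero] at this
    exact hd this.symm
  · rw [map_sub, MvPolynomial.coeff_coe]
    rcases (Nat.lt_succ_iff.1 hd).lt_or_eq with h | h
    · rw [hhom.coeff_eq_zero h.ne, sub_zero]
      exact coeff_of_lt_order (by rw [← hD]; exact_mod_cast h)
    · rw [hL d h, sub_self]

theorem eval_smul_of_isHomogeneous {L : MvPolynomial (Fin n) ℂ} {D : ℕ} (h : L.IsHomogeneous D)
    (t : ℂ) (x : Fin n → ℂ) :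
    MvPolynomial.eval (t • x) L = t ^ D * MvPolynomial.eval x L := by
  classical
  simp only [MvPolynomial.eval_eq, Finset.mul_sum]
  refine Finset.sum_congr rfl fun m hm => ?_
  have hdeg : m.degree = D := by
    by_contra hne
    exact MvPolynomial.mem_support_iff.1 hm (h.coeff_eq_zero hne)
  simp only [Pi.smul_apply, smul_eq_mul, mul_pow, Finset.prod_mul_distrib]
  rw [Finset.prod_pow_eq_pow_sum, ← hdeg]
  simp only [Finsupp.degree_apply]
  ring

/-- Otherwise there is a nonzero initial form L of degree D with L(tx) = tᴰ L(x) = O(tᴰ⁺¹) on every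
line through 0, which forces L(x) = 0. -/
theorem HasTaylor.eq_zero_of_eventually_eq_zero {f : (Fin n → ℂ) → ℂ}
    {φ : MvPowerSeries (Fin n) ℂ} (hf : HasTaylor f φ) (h : ∀ᶠ x in 𝓝 0, f x = 0) : φ = 0 := by
  by_contra hne
  obtain ⟨D, L, hL, hinit⟩ := exists_hasInit hne
  refine hL (MvPolynomial.funext fun x => ?_)
  rw [map_zero]
  have h1 : (fun x => MvPolynomial.eval x L) =O[𝓝 0] fun x => ‖x‖ ^ (D + 1) := by
    refine (hinit.isBigO hf).neg_left.congr' ?_ EventuallyEq.rfl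
    filter_upwards [h] with x hx
    simp [hx]
  have hline : Tendsto (fun t : ℂ => t • x) (𝓝[≠] 0) (𝓝 0) := by
    have : Continuous fun t : ℂ => t • x := by fun_prop
    simpa using (this.tendsto 0).mono_left (nhdsWithin_le_nhds (s := {0}ᶜ))
  obtain ⟨B, hB⟩ := (h1.comp_tendsto hline).bound
  have h2 : ∀ᶠ t in 𝓝[≠] (0 : ℂ), ‖MvPolynomial.eval x L‖ ≤ B * ‖x‖ ^ (D + 1) * ‖t‖ := by
    filter_upwards [hB, self_mem_nhdsWithin] with t ht ht0
    have ht0' : 0 < ‖t‖ ^ D := pow_pos (norm_pos_iff.2 ht0) _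
    simp only [Function.comp, eval_smul_of_isHomogeneous hinit.1, norm_mul, norm_pow, norm_norm,
      norm_smul] at ht
    refine le_of_mul_le_mul_left (ht.trans (le_of_eq ?_)) ht0'
    ring
  have h3 : Tendsto (fun t : ℂ => B * ‖x‖ ^ (D + 1) * ‖t‖) (𝓝[≠] 0) (𝓝 0) := by
    have : Continuous fun t : ℂ => B * ‖x‖ ^ (D + 1) * ‖t‖ := by fun_prop
    simpa using (this.tendsto 0).mono_left (nhdsWithin_le_nhds (s := {0}ᶜ))
  exact norm_le_zero_iff.1 (ge_of_tendsto h3 h2)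

end InitialForms

/-! ### Taylor series of vector fields and of differential forms. -/

section FieldsAndForms

open MvPowerSeries

variable {n q : ℕ}

/-- The components of `V` have the Taylor series `W`. -/
def HasTaylorField (V : (Fin n → ℂ) → Fin n → ℂ) (W : Fin n → MvPowerSeries (Fin n) ℂ) : Prop :=
  ∀ i, HasTaylor (fun x => V x i) (W i)

theorem HasTaylorField.analyticAt {V : (Fin n → ℂ) → Fin n → ℂ}
    {W : Fin n → MvPowerSeries (Fin n) ℂ} (h : HasTaylorField V W) : AnalyticAt ℂ V 0 :=
  analyticAt_pi_iff.2 fun i => (h i).1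

theorem exists_hasTaylorField {V : (Fin n → ℂ) → Fin n → ℂ} (h : AnalyticAt ℂ V 0) :
    ∃ W, HasTaylorField V W := by
  choose W hW using fun i => exists_hasTaylor (analyticAt_pi_iff.1 h i)
  exact ⟨W, hW⟩

theorem hasTaylorField_single (j : Fin n) :
    HasTaylorField (fun _ => Pi.single j 1) (Pi.single j 1) := by
  classical
  intro i
  by_cases h : i = j
  · subst h
    simpa using hasTaylor_const (n := n) 1
  · simpa [h] using hasTaylor_const (n := n) 0

theorem HasTaylorField.lieBracket {V W : (Fin n → ℂ) → Fin n → ℂ}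
    {V' W' : Fin n → MvPowerSeries (Fin n) ℂ} (hV : HasTaylorField V V')
    (hW : HasTaylorField W W') :
    HasTaylorField (VectorField.lieBracket ℂ V W) (formalBracket V' W') := by
  have key : ∀ {V W : (Fin n → ℂ) → Fin n → ℂ} {V' W' : Fin n → MvPowerSeries (Fin n) ℂ},
      HasTaylorField V V' → HasTaylorField W W' → ∀ i,
      HasTaylor (fun x => fderiv ℂ W x (V x) i) (derivAlong V' (W' i)) := by
    intro V W V' W' hV hW i
    rw [derivAlong_apply]
    refine (HasTaylor.sum (s := Finset.univ) fun j _ => (hV j).mul ((hW i).pderiv j)).congr ?_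
    filter_upwards [hW.analyticAt.eventually_analyticAt] with x hx
    have h1 : ∀ v, fderiv ℂ (fun x => W x i) x v = fderiv ℂ W x v i := by
      intro v
      have h2 := hasFDerivAt_pi'.1 hx.differentiableAt.hasFDerivAt i
      rw [h2.fderiv]
      rfl
    simp only [h1]
    conv_rhs => rw [pi_eq_sum_univ' (V x)]
    simp [map_sum, Finset.sum_apply]
  intro i
  exact (key hV hW i).sub (key hW hV i)

theorem alternatingMap_apply_eq_sum {A : Type*} [CommRing A] (ω : (Fin n → A) [⋀^Fin q]→ₗ[A] A)
    (w : Fin q → Fin n → A) :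
    ω w = ∑ K : Fin q → Fin n, (∏ a, w a (K a)) * ω fun a => Pi.single (K a) 1 := by
  have hw : w = fun a => ∑ j, w a j • (Pi.single j 1 : Fin n → A) := by
    ext1 a
    exact pi_eq_sum_univ' (w a)
  conv_lhs => rw [hw]
  rw [← AlternatingMap.coe_multilinearMap, MultilinearMap.map_sum]
  refine Finset.sum_congr rfl fun K _ => ?_
  rw [MultilinearMap.map_smul_univ, smul_eq_mul]

theorem form_eq_zero_of_basis {α : (Fin n → ℂ) [⋀^Fin q]→L[ℂ] ℂ}
    (h : ∀ K : Fin q → Fin n, (α fun a => Pi.single (K a) 1) = 0) : α = 0 := by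
  ext w
  have := alternatingMap_apply_eq_sum α.toAlternatingMap w
  rw [Finset.sum_eq_zero fun K _ => ?_] at this
  · exact this
  · rw [mul_eq_zero]
    exact Or.inr (h K)

/-- The alternating form with given (antisymmetric) coefficients. -/
noncomputable def formOfCoeff {A : Type*} [CommRing A] [Algebra ℂ A]
    (Ω : (Fin q → Fin n) → A) (hΩ : ∀ K a b, a ≠ b → Ω (K ∘ Equiv.swap a b) = -Ω K) :
    (Fin n → A) [⋀^Fin q]→ₗ[A] A :=
  { toMultilinearMap := ∑ K : Fin q → Fin n, Ω K • (MultilinearMap.mkPiAlgebra A (Fin q) A).compLinearMap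
      fun a => LinearMap.proj (K a)
    map_eq_zero_of_eq' := by
      intro w a b hab hne
      simp only [MultilinearMap.toFun_eq_coe, sum_apply, smul_apply,
        MultilinearMap.compLinearMap_apply, MultilinearMap.mkPiAlgebra_apply, LinearMap.proj_apply,
        smul_eq_mul]
      set S := ∑ K : Fin q → Fin n, Ω K * ∏ c, w c (K c) with hS
      -- Reindexing by the transposition of a and b preserves the products, since w a = w b, and
      -- changes the sign of the coefficients.
      have h1 : S = -S := by
        rw [hS, ← Finset.sum_neg_distrib]
        refine Fintype.sum_equiv ((Equiv.swap a b).arrowCongr (Equiv.refl _)) _ _ fun K => ?_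
        have e : (Equiv.swap a b).arrowCongr (Equiv.refl (Fin n)) K = K ∘ Equiv.swap a b := by
          ext1 c
          simp [Equiv.arrowCongr]
        rw [e, hΩ K a b hne, neg_mul, neg_neg]
        congr 1
        refine Fintype.prod_equiv (Equiv.swap a b) _ _ fun c => ?_
        simp only [Function.comp, Equiv.swap_apply_self]
        have hw : w (Equiv.swap a b c) = w c := by
          by_cases h1 : c = a
          · subst h1; simp [hab]
          · by_cases h2 : c = b
            · subst h2; simp [hab]
            · rw [Equiv.swap_apply_of_ne_of_ne h1 h2]
        rw [hw]
      have h2 : (2 : ℂ) • S = 0 := by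
        rw [two_smul]
        nth_rewrite 1 [h1]
        simp
      exact (smul_eq_zero_iff_right (two_ne_zero)).1 h2 }

theorem formOfCoeff_apply {A : Type*} [CommRing A] [Algebra ℂ A]
    (Ω : (Fin q → Fin n) → A) (hΩ : ∀ K a b, a ≠ b → Ω (K ∘ Equiv.swap a b) = -Ω K)
    (w : Fin q → Fin n → A) : formOfCoeff Ω hΩ w = ∑ K, (∏ a, w a (K a)) * Ω K := by
  change (∑ K : Fin q → Fin n, Ω K • (MultilinearMap.mkPiAlgebra A (Fin q) A).compLinearMap
      fun a => LinearMap.proj (K a)) w = _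
  simp [mul_comm]

/-- The components of `ω` have the Taylor series of the components of the formal form `Ω`. -/
def HasTaylorForm (ω : (Fin n → ℂ) → (Fin n → ℂ) [⋀^Fin q]→L[ℂ] ℂ)
    (Ω : (Fin n → MvPowerSeries (Fin n) ℂ) [⋀^Fin q]→ₗ[MvPowerSeries (Fin n) ℂ]
      MvPowerSeries (Fin n) ℂ) : Prop :=
  ∀ K : Fin q → Fin n, HasTaylor (fun x => ω x fun a => Pi.single (K a) 1)
    (Ω fun a => Pi.single (K a) 1)

end FieldsAndForms

/-! ### Decomposability of forms with a kernel of codimension q. -/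

section Decomposable

variable {q : ℕ}

/-- Cramer's rule for the rows of a square matrix. -/
theorem det_smul_eq_sum_det_update {k : Type*} [CommRing k] (w : Fin q → Fin q → k)
    (v : Fin q → k) :
    Matrix.det (Matrix.of w) • v
      = ∑ a, Matrix.det (Matrix.of (Function.update w a v)) • w a := by
  have h := Matrix.mulVec_cramer (Matrix.of w).transpose v
  rw [Matrix.det_transpose] at h
  rw [← h]
  ext i
  simp only [Matrix.mulVec, dotProduct, Matrix.transpose_apply, Matrix.of_apply,
    Matrix.cramer_transpose_apply, Finset.sum_apply, Pi.smul_apply, smul_eq_mul]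
  refine Finset.sum_congr rfl fun a _ => ?_
  rw [mul_comm]
  rfl

/-- A form of degree `q` whose kernel has codimension `q` is decomposable. -/
theorem contractionField_mem_of_codim {k M : Type*} [Field k] [AddCommGroup M] [Module k M]
    [FiniteDimensional k M] {ω : M [⋀^Fin q]→ₗ[k] k}
    (h : Module.finrank k (alternatingKer ω) + q = Module.finrank k M) (w : Fin q → M) (v : M) :
    contractionField ω w v ∈ alternatingKer ω := by
  have h1 : Module.finrank k (M ⧸ alternatingKer ω) = Module.finrank k (Fin q → k) := by
    have := Submodule.finrank_quotient_add_finrank (alternatingKer ω)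
    rw [Module.finrank_fin_fun]
    omega
  let e := LinearEquiv.ofFinrankEq _ _ h1
  let π : M →ₗ[k] (Fin q → k) := e.toLinearMap ∘ₗ (alternatingKer ω).mkQ
  have hπ : ∀ x, π x = 0 ↔ x ∈ alternatingKer ω := by
    intro x
    simp [π]
  have hsurj : Function.Surjective π := e.surjective.comp (Submodule.mkQ_surjective _)
  obtain ⟨s, hs⟩ := LinearMap.exists_rightInverse_of_surjective π (LinearMap.range_eq_top.2 hsurj)
  have hs' : ∀ x, π (s x) = x := fun x => LinearMap.congr_fun hs x
  -- The form descends to the q-dimensional quotient by its kernel, where it is a multiple of the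
  -- determinant. The claim becomes Cramer's rule.
  have hω : ∀ w : Fin q → M, ω w
      = ω (fun a => s (Pi.basisFun k (Fin q) a)) * Matrix.det (Matrix.of fun a => π (w a)) := by
    intro w
    have h2 : ω w = ω (fun a => s (π (w a))) := by
      refine alternatingMap_congr_ker ω fun a => ?_
      rw [← hπ, map_sub, hs', sub_self]
    have h3 := AlternatingMap.eq_smul_basis_det (Pi.basisFun k (Fin q)) (ω.compLinearMap s)
    have h4 := congrArg (fun f => f (fun a => π (w a))) h3
    rw [h2]
    simp only [AlternatingMap.compLinearMap_apply, AlternatingMap.smul_apply,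
      Pi.basisFun_det_apply, smul_eq_mul] at h4
    exact h4
  rw [← hπ]
  have hupd : ∀ a, (fun b => π (Function.update w a v b))
      = Function.update (fun b => π (w b)) a (π v) := by
    intro a
    ext1 b
    by_cases hb : b = a
    · subst hb; simp
    · simp [hb]
  simp only [contractionField, map_sub, map_smul, map_sum, hω w, hω (Function.update w _ v), hupd,
    mul_smul]
  rw [det_smul_eq_sum_det_update, Finset.smul_sum, sub_self]

end Decomposable

/-! ### Tangency of analytic fields, read off from Taylor series. -/

section AnalyticForms

open MvPowerSeries

variable {n q : ℕ}

theorem mem_formKer_iff {α : (Fin n → ℂ) [⋀^Fin q]→L[ℂ] ℂ} {v : Fin n → ℂ} :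
    v ∈ formKer α ↔ v ∈ alternatingKer α.toAlternatingMap :=
  Iff.rfl

theorem mem_alternatingKer_of_basis {A : Type*} [CommRing A] {ω : (Fin n → A) [⋀^Fin q]→ₗ[A] A}
    {v : Fin n → A} (h : ∀ (K : Fin q → Fin n) (i : Fin q),
      ω (Function.update (fun a => Pi.single (K a) 1) i v) = 0) : v ∈ alternatingKer ω := by
  intro w i
  rcases isEmpty_or_nonempty (Fin n) with hn | hn
  · have : v = 0 := Subsingleton.elim _ _
    rw [this]
    exact ω.map_coord_zero i (by simp)
  -- `s` contains the slots whose vectors need not be basis vectors; each induction step expands one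
  -- of them. Slot i is exempt, because v overwrites it.
  have key : ∀ (s : Finset (Fin q)) (w : Fin q → Fin n → A),
      (∀ a ∉ s, a ≠ i → ∃ j, w a = Pi.single j 1) → ω (Function.update w i v) = 0 := by
    intro s
    induction s using Finset.induction_on with
    | empty =>
      intro w hw
      have hw' : ∀ a, ∃ j, a ≠ i → w a = Pi.single j 1 := by
        intro a
        by_cases ha : a = i
        · exact ⟨Classical.arbitrary _, fun h => absurd ha h⟩
        · obtain ⟨j, hj⟩ := hw a (by simp) ha
          exact ⟨j, fun _ => hj⟩
      choose K hK using hw'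
      have e : Function.update w i v = Function.update (fun a => Pi.single (K a) 1) i v := by
        ext1 a
        by_cases ha : a = i
        · subst ha; simp
        · simp [ha, hK a ha]
      rw [e, h]
    | insert b s hb ih =>
      intro w hw
      by_cases hbi : b = i
      · refine ih w fun a ha hai => hw a ?_ hai
        simp only [Finset.mem_insert, not_or]
        exact ⟨fun h => hai (h.trans hbi), ha⟩
      · have e : Function.update w i v = Function.update (Function.update w i v) b
            (∑ l, w b l • (Pi.single l 1 : Fin n → A)) := by
          rw [← pi_eq_sum_univ' (w b)]
          symm
          rw [Function.update_eq_self_iff]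
          simp [hbi]
        rw [e]
        have h1 := map_sum (ω.toMultilinearMap.toLinearMap (Function.update w i v) b)
          (fun l => w b l • (Pi.single l 1 : Fin n → A)) Finset.univ
        refine h1.trans (Finset.sum_eq_zero fun l _ => ?_)
        rw [map_smul]
        change _ • ω (Function.update (Function.update w i v) b (Pi.single l 1)) = 0
        rw [Function.update_comm (Ne.symm hbi), ih, smul_zero]
        intro a ha hai
        by_cases hab : a = b
        · exact ⟨l, by rw [hab]; simp⟩
        · obtain ⟨j, hj⟩ := hw a (by simp [hab, ha]) hai
          exact ⟨j, by simp [hab, hj]⟩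
  exact key Finset.univ w (by simp)

theorem HasTaylorForm.apply {ω : (Fin n → ℂ) → (Fin n → ℂ) [⋀^Fin q]→L[ℂ] ℂ}
    {Ω : (Fin n → MvPowerSeries (Fin n) ℂ) [⋀^Fin q]→ₗ[MvPowerSeries (Fin n) ℂ]
      MvPowerSeries (Fin n) ℂ} (h : HasTaylorForm ω Ω) {w : Fin q → (Fin n → ℂ) → Fin n → ℂ}
    {W : Fin q → Fin n → MvPowerSeries (Fin n) ℂ} (hw : ∀ a, HasTaylorField (w a) (W a)) :
    HasTaylor (fun x => ω x fun a => w a x) (Ω W) := by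
  rw [alternatingMap_apply_eq_sum]
  refine (HasTaylor.sum (s := Finset.univ) fun K _ =>
    (HasTaylor.prod (s := Finset.univ) fun a _ => hw a (K a)).mul (h K)).congr
      (Eventually.of_forall fun x => ?_)
  exact (alternatingMap_apply_eq_sum (ω x).toAlternatingMap fun a => w a x).symm

theorem HasTaylorForm.apply_update {ω : (Fin n → ℂ) → (Fin n → ℂ) [⋀^Fin q]→L[ℂ] ℂ}
    {Ω : (Fin n → MvPowerSeries (Fin n) ℂ) [⋀^Fin q]→ₗ[MvPowerSeries (Fin n) ℂ]
      MvPowerSeries (Fin n) ℂ} (h : HasTaylorForm ω Ω) {V : (Fin n → ℂ) → Fin n → ℂ}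
    {V' : Fin n → MvPowerSeries (Fin n) ℂ} (hV : HasTaylorField V V') (K : Fin q → Fin n)
    (i : Fin q) :
    HasTaylor (fun x => ω x (Function.update (fun a => Pi.single (K a) 1) i (V x)))
      (Ω (Function.update (fun a => Pi.single (K a) 1) i V')) := by
  have h1 := h.apply (w := Function.update (fun a _ => Pi.single (K a) 1) i V)
    (W := Function.update (fun a => Pi.single (K a) 1) i V') (by
      intro a
      by_cases ha : a = i
      · subst ha; simpa using hV
      · simpa [ha] using hasTaylorField_single (K a))
  refine h1.congr (Eventually.of_forall fun x => ?_)
  simp only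
  congr 1
  ext1 a
  by_cases ha : a = i
  · subst ha; simp
  · simp [ha]

/-- The bridge between germs and formal series: a germ vanishes if and only if its Taylor series
does. Hypotheses are transported forward by it and involutivity back. -/
theorem HasTaylorForm.mem_ker_iff {ω : (Fin n → ℂ) → (Fin n → ℂ) [⋀^Fin q]→L[ℂ] ℂ}
    {Ω : (Fin n → MvPowerSeries (Fin n) ℂ) [⋀^Fin q]→ₗ[MvPowerSeries (Fin n) ℂ]
      MvPowerSeries (Fin n) ℂ} (h : HasTaylorForm ω Ω) {V : (Fin n → ℂ) → Fin n → ℂ}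
    {V' : Fin n → MvPowerSeries (Fin n) ℂ} (hV : HasTaylorField V V') :
    (∀ᶠ x in 𝓝 0, V x ∈ formKer (ω x)) ↔ V' ∈ alternatingKer Ω := by
  constructor
  · intro hker
    refine mem_alternatingKer_of_basis fun K i => ?_
    refine (h.apply_update hV K i).eq_zero_of_eventually_eq_zero ?_
    filter_upwards [hker] with x hx
    exact hx _ i
  · intro hker
    have h1 : ∀ (K : Fin q → Fin n) (i : Fin q), ∀ᶠ x in 𝓝 0,
        ω x (Function.update (fun a => Pi.single (K a) 1) i (V x)) = 0 := by
      intro K i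
      refine HasTaylor.eventually_eq_zero ?_
      have := h.apply_update hV K i
      rwa [hker] at this
    filter_upwards [eventually_all.2 fun K => eventually_all.2 (h1 K)] with x hx
    rw [mem_formKer_iff]
    exact mem_alternatingKer_of_basis hx

theorem analyticAt_form_apply {ω : (Fin n → ℂ) → (Fin n → ℂ) [⋀^Fin q]→L[ℂ] ℂ} {x : Fin n → ℂ}
    (hω : AnalyticAt ℂ ω x) (w : Fin q → Fin n → ℂ) : AnalyticAt ℂ (fun x => ω x w) x :=
  ((ContinuousAlternatingMap.apply ℂ (Fin n → ℂ) ℂ w).analyticAt _).comp hω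

theorem exists_hasTaylorForm {ω : (Fin n → ℂ) → (Fin n → ℂ) [⋀^Fin q]→L[ℂ] ℂ}
    (hω : AnalyticAt ℂ ω 0) : ∃ Ω, HasTaylorForm ω Ω := by
  have han : ∀ K : Fin q → Fin n, AnalyticAt ℂ (fun x => ω x fun a => Pi.single (K a) 1) 0 := by
    intro K
    exact analyticAt_form_apply hω _
  choose Φ hΦ using fun K => exists_hasTaylor (han K)
  -- The chosen Taylor series inherit antisymmetry from ω because a Taylor series is unique.
  have hanti : ∀ K a b, a ≠ b → Φ (K ∘ Equiv.swap a b) = -Φ K := by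
    intro K a b hab
    rw [← sub_eq_zero]
    refine ((hΦ (K ∘ Equiv.swap a b)).sub (hΦ K).neg).eq_zero_of_eventually_eq_zero
      (Eventually.of_forall fun x => ?_)
    have := (ω x).toAlternatingMap.map_swap (fun a => Pi.single (K a) 1) hab
    rw [sub_eq_zero]
    exact this
  refine ⟨formOfCoeff Φ hanti, fun K => ?_⟩
  have e : formOfCoeff Φ hanti (fun a => Pi.single (K a) 1) = Φ K := by
    rw [formOfCoeff_apply, Finset.sum_eq_single K]
    · simp
    · intro K' _ hK'
      obtain ⟨a, ha⟩ := Function.ne_iff.1 hK'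
      rw [Finset.prod_eq_zero (Finset.mem_univ a), zero_mul]
      simp [ha]
    · simp
  rw [e]
  exact hΦ K

theorem HasTaylorForm.contractionField {ω : (Fin n → ℂ) → (Fin n → ℂ) [⋀^Fin q]→L[ℂ] ℂ}
    {Ω : (Fin n → MvPowerSeries (Fin n) ℂ) [⋀^Fin q]→ₗ[MvPowerSeries (Fin n) ℂ]
      MvPowerSeries (Fin n) ℂ} (h : HasTaylorForm ω Ω) (K : Fin q → Fin n) (j : Fin n) :
    HasTaylorField
      (fun x => contractionField (ω x).toAlternatingMap (fun a => Pi.single (K a) 1)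
        (Pi.single j 1))
      (contractionField Ω (fun a => Pi.single (K a) 1) (Pi.single j 1)) := by
  intro i
  simp only [_root_.contractionField, Pi.sub_apply, Pi.smul_apply, Finset.sum_apply, smul_eq_mul]
  refine ((h K).mul (hasTaylorField_single j i)).sub (HasTaylor.sum fun k _ => ?_)
  exact (h.apply_update (hasTaylorField_single j) K k).mul (hasTaylorField_single (K k) i)

end AnalyticForms

/-! ### Linear parts of Taylor series, and involutivity tested on generators. -/

section Involutive

open VectorField MvPowerSeries

variable {n q : ℕ}

theorem lieBracket_sum_smul_right_mem {E ι : Type*} [NormedAddCommGroup E] [NormedSpace ℂ E]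
    {K : Submodule ℂ E} {x : E} {U : E → E} {T : ι → E → E} {b : ι → E → ℂ} (s : Finset ι)
    (hT : ∀ j, DifferentiableAt ℂ (T j) x) (hb : ∀ j, DifferentiableAt ℂ (b j) x)
    (hTx : ∀ j, T j x ∈ K) (hUT : ∀ j, lieBracket ℂ U (T j) x ∈ K) :
    lieBracket ℂ U (fun y => ∑ j ∈ s, b j y • T j y) x ∈ K := by
  classical
  induction s using Finset.induction_on with
  | empty =>
    have : (fun y : E => ∑ j ∈ (∅ : Finset ι), b j y • T j y) = 0 := by ext1 y; simp
    rw [this, lieBracket_zero_right]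
    exact K.zero_mem
  | insert i s hi ih =>
    have e : (fun y => ∑ j ∈ insert i s, b j y • T j y)
        = (fun y => b i y • T i y) + fun y => ∑ j ∈ s, b j y • T j y := by
      ext1 y
      simp [Finset.sum_insert hi]
    have hd : DifferentiableAt ℂ (fun y => ∑ j ∈ s, b j y • T j y) x :=
      DifferentiableAt.fun_sum fun j _ => (hb j).fun_smul (hT j)
    rw [e, lieBracket_add_right ((hb i).fun_smul (hT i)) hd]
    refine K.add_mem ?_ ih
    have := lieBracket_smul_right (V := U) (hb i) (hT i)
    change lieBracket ℂ U (fun y => b i y • T i y) x = _ at this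
    rw [this]
    exact K.add_mem (K.smul_mem _ (hTx i)) (K.smul_mem _ (hUT i))

/-- Modulo K the bracket is bilinear over functions at x, as the Leibniz terms are multiples of the
values `T j x ∈ K`. -/
theorem lieBracket_sum_smul_mem {E ι : Type*} [NormedAddCommGroup E] [NormedSpace ℂ E]
    {K : Submodule ℂ E} {x : E} {T : ι → E → E} {a b : ι → E → ℂ} (s : Finset ι)
    (hT : ∀ j, DifferentiableAt ℂ (T j) x) (ha : ∀ j, DifferentiableAt ℂ (a j) x)
    (hb : ∀ j, DifferentiableAt ℂ (b j) x) (hTx : ∀ j, T j x ∈ K)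
    (hTT : ∀ i j, lieBracket ℂ (T i) (T j) x ∈ K) :
    lieBracket ℂ (fun y => ∑ j ∈ s, a j y • T j y) (fun y => ∑ j ∈ s, b j y • T j y) x ∈ K := by
  refine lieBracket_sum_smul_right_mem s hT hb hTx fun j => ?_
  rw [lieBracket_swap]
  exact K.neg_mem (lieBracket_sum_smul_right_mem s hT ha hTx fun i => hTT j i)

theorem HasTaylor.constantCoeff_eq {f : (Fin n → ℂ) → ℂ} {φ : MvPowerSeries (Fin n) ℂ}
    (hf : HasTaylor f φ) : constantCoeff φ = f 0 := by
  obtain ⟨B, hB⟩ := ((hasInit_constantCoeff φ).isBigO hf).bound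
  have := hB.self_of_nhds
  simp only [MvPolynomial.eval_C, zero_add, pow_one, norm_zero, mul_zero, norm_le_zero_iff] at this
  exact (sub_eq_zero.1 this).symm

theorem hasDiagLinearPart_of_fderiv {ξ : (Fin n → ℂ) → Fin n → ℂ} {lam : Fin n → ℂ}
    {Ξ : Fin n → MvPowerSeries (Fin n) ℂ} (hΞ : HasTaylorField ξ Ξ) (h0 : ξ 0 = 0)
    (hd : ∀ j, fderiv ℂ ξ 0 (Pi.single j 1) = lam j • Pi.single j 1) :
    HasDiagLinearPart Ξ lam := by
  classical
  intro i
  refine nat_le_order (n := 2) fun d hdeg => ?_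
  by_cases hd0 : d = 0
  · subst hd0
    rw [coeff_zero_eq_constantCoeff_apply, map_sub, (hΞ i).constantCoeff_eq, h0]
    simp [smul_eq_C_mul]
  · obtain ⟨j, hj⟩ : ∃ j, d j ≠ 0 := by
      by_contra hcon
      push Not at hcon
      exact hd0 (Finsupp.ext hcon)
    have hle : Finsupp.single j 1 ≤ d := Finsupp.single_le_iff.2 (Nat.one_le_iff_ne_zero.2 hj)
    have hdj : d = Finsupp.single j 1 := by
      have h1 : d = Finsupp.single j 1 + (d - Finsupp.single j 1) := (add_tsub_cancel_of_le hle).symm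
      have h2 : (d - Finsupp.single j 1).degree = 0 := by
        have := congrArg Finsupp.degree h1
        rw [map_add, Finsupp.degree_single] at this
        omega
      rw [h1, (Finsupp.degree_eq_zero_iff _).1 h2, add_zero]
    have h1 := ((hΞ i).pderiv j).constantCoeff_eq
    rw [← coeff_zero_eq_constantCoeff_apply, coeff_pderiv] at h1
    have h2 : fderiv ℂ (fun x => ξ x i) 0 (Pi.single j 1) = lam j * (Pi.single j 1 : Fin n → ℂ) i := by
      have h3 := hasFDerivAt_pi'.1 hΞ.analyticAt.differentiableAt.hasFDerivAt i
      rw [h3.fderiv, ← smul_eq_mul, ← Pi.smul_apply, ← hd j]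
      rfl
    rw [h2] at h1
    subst hdj
    simp only [zero_add, Finsupp.coe_zero, Pi.zero_apply, Nat.cast_zero, mul_one] at h1
    rw [map_sub, h1, coeff_smul, coeff_X]
    by_cases hij : i = j
    · subst hij; simp
    · have : Finsupp.single j 1 ≠ Finsupp.single i 1 := by
        simp [Finsupp.single_left_inj, Ne.symm hij]
      simp [hij, this]

/-- The analytic vector field `contractionField` of two constant multivectors. -/
theorem analyticAt_contractionField {ω : (Fin n → ℂ) → (Fin n → ℂ) [⋀^Fin q]→L[ℂ] ℂ}
    {x : Fin n → ℂ} (hω : AnalyticAt ℂ ω x) (w : Fin q → Fin n → ℂ) (v : Fin n → ℂ) :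
    AnalyticAt ℂ (fun x => contractionField (ω x).toAlternatingMap w v) x := by
  simp only [contractionField]
  refine ((analyticAt_form_apply hω w).smul analyticAt_const).sub ?_
  refine Finset.analyticAt_fun_sum _ fun k _ => ?_
  exact (analyticAt_form_apply hω _).smul analyticAt_const

theorem contractionField_mem_formKer {α : (Fin n → ℂ) [⋀^Fin q]→L[ℂ] ℂ}
    (h : α ≠ 0 → Module.finrank ℂ (formKer α) + q = n) (w : Fin q → Fin n → ℂ) (v : Fin n → ℂ) :
    contractionField α.toAlternatingMap w v ∈ formKer α := by
  by_cases hα : α = 0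
  · subst hα
    intro w i
    rfl
  · rw [mem_formKer_iff]
    refine contractionField_mem_of_codim ?_ w v
    rw [Module.finrank_fin_fun]
    exact h hα

theorem isTangentAt_contractionField {ω : (Fin n → ℂ) → (Fin n → ℂ) [⋀^Fin q]→L[ℂ] ℂ}
    (hω : AnalyticAt ℂ ω 0)
    (hcodim : ∀ᶠ x in 𝓝 0, ω x ≠ 0 → Module.finrank ℂ (formKer (ω x)) + q = n) :
    ∀ᶠ x in 𝓝 0, ∀ w v,
      IsTangentAt (fun x => contractionField (ω x).toAlternatingMap w v) ω x := by
  filter_upwards [hω.eventually_analyticAt, hcodim.eventually_nhds] with x hx hx' w v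
  refine ⟨analyticAt_contractionField hx w v, ?_⟩
  filter_upwards [hx'] with y hy
  exact contractionField_mem_formKer hy w v

/-- Involutivity may be tested on the fields `contractionField`. -/
theorem isIntegrable_of_contractionField {ω : (Fin n → ℂ) → (Fin n → ℂ) [⋀^Fin q]→L[ℂ] ℂ}
    (hω : AnalyticAt ℂ ω 0)
    (hcodim : ∀ᶠ x in 𝓝 0, ω x ≠ 0 → Module.finrank ℂ (formKer (ω x)) + q = n)
    (h : ∀ (K : Fin q → Fin n) (i j : Fin n), ∀ᶠ x in 𝓝 0, lieBracket ℂ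
      (fun x => contractionField (ω x).toAlternatingMap (fun a => Pi.single (K a) 1)
        (Pi.single i 1))
      (fun x => contractionField (ω x).toAlternatingMap (fun a => Pi.single (K a) 1)
        (Pi.single j 1)) x ∈ formKer (ω x)) :
    IsIntegrableDistribution ω := by
  filter_upwards [hω.eventually_analyticAt, isTangentAt_contractionField hω hcodim,
    eventually_all.2 fun K => eventually_all.2 fun i => eventually_all.2 (h K i)]
    with x hx htan hbr V W hV hW
  by_cases h0 : ω x = 0
  · rw [h0]
    intro w i
    rfl
  obtain ⟨K, hK⟩ : ∃ K : Fin q → Fin n, ω x (fun a => Pi.single (K a) 1) ≠ 0 := by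
    by_contra hcon
    push Not at hcon
    refine h0 (ContinuousAlternatingMap.ext fun w => ?_)
    have := alternatingMap_apply_eq_sum (ω x).toAlternatingMap w
    refine this.trans (Finset.sum_eq_zero fun K _ => ?_)
    have h1 := hcon K
    change (∏ a, w a (K a)) * ω x (fun a => Pi.single (K a) 1) = 0
    rw [h1, mul_zero]
  have hfK := analyticAt_form_apply hx (fun a => Pi.single (K a) 1)
  -- Where one component of ω is nonzero, division by it writes every tangent field as an analytic
  -- combination of the test fields.
  have hrep : ∀ V : (Fin n → ℂ) → Fin n → ℂ, IsTangentAt V ω x → V =ᶠ[𝓝 x] fun y => ∑ j,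
      (V y j / ω y (fun a => Pi.single (K a) 1)) • contractionField (ω y).toAlternatingMap
        (fun a => Pi.single (K a) 1) (Pi.single j 1) := by
    intro V hV
    filter_upwards [hV.2, hfK.continuousAt.eventually_ne hK] with y hy hyK
    have h1 := smul_eq_contractionField (mem_formKer_iff.1 hy) (fun a => Pi.single (K a) 1)
    have h2 : contractionField (ω y).toAlternatingMap (fun a => Pi.single (K a) 1) (V y)
        = ∑ j, V y j • contractionField (ω y).toAlternatingMap
          (fun a => Pi.single (K a) 1) (Pi.single j 1) := by
      conv_lhs => rw [pi_eq_sum_univ' (V y)]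
      exact contractionField_sum _ _ _ _ _
    rw [h2] at h1
    have h3 : V y = (ω y (fun a => Pi.single (K a) 1))⁻¹ •
        (ω y (fun a => Pi.single (K a) 1) • V y) := by
      rw [smul_smul, inv_mul_cancel₀ hyK, one_smul]
    rw [h3]
    refine (congrArg _ h1).trans ?_
    rw [Finset.smul_sum]
    refine Finset.sum_congr rfl fun j _ => ?_
    rw [← h3, smul_smul, div_eq_inv_mul]
  rw [Filter.EventuallyEq.lieBracket_vectorField_eq (hrep V hV) (hrep W hW)]
  have hcoef : ∀ V : (Fin n → ℂ) → Fin n → ℂ, IsTangentAt V ω x → ∀ j, DifferentiableAt ℂ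
      (fun y => V y j / ω y (fun a => Pi.single (K a) 1)) x := by
    intro V hV j
    exact ((analyticAt_pi_iff.1 hV.1 j).div hfK hK).differentiableAt
  exact lieBracket_sum_smul_mem _
    (fun j => (analyticAt_contractionField hx _ _).differentiableAt) (hcoef V hV) (hcoef W hW)
    (fun j => (htan _ _).2.self_of_nhds) (hbr K)

end Involutive

/-! ### The formal model and the logarithmic normal form of ω. -/

section FormalModel

open VectorField MvPowerSeries

variable {n q : ℕ}

/-- The formal model of a distribution with a nonresonant infinitesimal automorphism: formal
linearizing coordinates `y`, in which the distribution is spanned by the fields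
`vⱼ - ∑ₖ cₖⱼ v_{Iₖ}` with constant coefficients, where `vⱼ = yⱼ ∂/∂yⱼ`. -/
structure IsFormalModel (lam : Fin n → ℂ)
    (Ω : (Fin n → MvPowerSeries (Fin n) ℂ) [⋀^Fin q]→ₗ[MvPowerSeries (Fin n) ℂ]
      MvPowerSeries (Fin n) ℂ)
    (Ξ y : Fin n → MvPowerSeries (Fin n) ℂ) (I : Fin q → Fin n) (c : Fin q → Fin n → ℂ) :
    Prop where
  coord : ∀ i, (2 : ℕ∞) ≤ (y i - X i).order
  field_eq : Ξ = ∑ i, lam i • logFrame y i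
  ne_zero : Ω (fun a => logFrame y (I a)) ≠ 0
  coeff_base : ∀ k l, c k (I l) = if k = l then 1 else 0
  mem_ker : ∀ j, logFrame y j - ∑ k, c k j • logFrame y (I k) ∈ alternatingKer Ω

/-- Elements of the formal kernel need not converge, so the symmetry of the distribution is used
only for the analytic fields `contractionField` of constant vectors, which generate the kernel over
the fraction field. -/
theorem exists_isFormalModel {ξ : (Fin n → ℂ) → Fin n → ℂ} {lam : Fin n → ℂ}
    {ω : (Fin n → ℂ) → (Fin n → ℂ) [⋀^Fin q]→L[ℂ] ℂ} (hlam : LinearIndependent ℤ lam)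
    (hξ : AnalyticAt ℂ ξ 0) (h0 : ξ 0 = 0)
    (hd : ∀ j, fderiv ℂ ξ 0 (Pi.single j 1) = lam j • Pi.single j 1)
    (hω : AnalyticAt ℂ ω 0) (hne : ∃ᶠ x in 𝓝 0, ω x ≠ 0)
    (hcodim : ∀ᶠ x in 𝓝 0, ω x ≠ 0 → Module.finrank ℂ (formKer (ω x)) + q = n)
    (haut : IsInfinitesimalAutomorphism ξ ω) :
    ∃ Ω Ξ y I c, HasTaylorForm ω Ω ∧ HasTaylorField ξ Ξ ∧
      IsFormalModel (n := n) (q := q) lam Ω Ξ y I c := by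
  obtain ⟨Ξ, hΞ⟩ := exists_hasTaylorField hξ
  obtain ⟨Ω, hΩ⟩ := exists_hasTaylorForm hω
  have hdiag := hasDiagLinearPart_of_fderiv hΞ h0 hd
  choose y hy using fun i => exists_linearizing_coordinate hlam hdiag i
  have hΩ0 : Ω ≠ 0 := by
    rintro rfl
    refine hne ?_
    have h1 : ∀ K : Fin q → Fin n, ∀ᶠ x in 𝓝 0, ω x (fun a => Pi.single (K a) 1) = 0 :=
      fun K => (hΩ K).eventually_eq_zero
    filter_upwards [eventually_all.2 h1] with x hx
    rw [not_not]
    exact form_eq_zero_of_basis hx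
  have htan := isTangentAt_contractionField hω hcodim
  have hker : ∀ (K : Fin q → Fin n) (j : Fin n),
      contractionField Ω (fun a => Pi.single (K a) 1) (Pi.single j 1) ∈ alternatingKer Ω := by
    intro K j
    refine (hΩ.mem_ker_iff (hΩ.contractionField K j)).1 ?_
    filter_upwards [htan] with x hx
    exact (hx _ _).2.self_of_nhds
  have hbr : ∀ (K : Fin q → Fin n) (j : Fin n), formalBracket Ξ
      (contractionField Ω (fun a => Pi.single (K a) 1) (Pi.single j 1)) ∈ alternatingKer Ω := by
    intro K j
    refine (hΩ.mem_ker_iff (hΞ.lieBracket (hΩ.contractionField K j))).1 ?_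
    filter_upwards [htan, haut] with x hx hx'
    exact hx' _ (hx _ _)
  obtain ⟨I, c, h1, h2, h3⟩ := exists_logarithmic_structure hlam hdiag (fun i => (hy i).2)
    (fun i => (hy i).1) hΩ0 hker hbr
  exact ⟨Ω, Ξ, y, I, c, hΩ, hΞ, fun i => (hy i).2,
    eq_sum_smul_logFrame (fun i => (hy i).2) fun i => (hy i).1, h1, h2, h3⟩

theorem IsFormalModel.isIntegrable {lam : Fin n → ℂ}
    {ω : (Fin n → ℂ) → (Fin n → ℂ) [⋀^Fin q]→L[ℂ] ℂ}
    {Ω : (Fin n → MvPowerSeries (Fin n) ℂ) [⋀^Fin q]→ₗ[MvPowerSeries (Fin n) ℂ]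
      MvPowerSeries (Fin n) ℂ}
    {Ξ y : Fin n → MvPowerSeries (Fin n) ℂ} {I : Fin q → Fin n} {c : Fin q → Fin n → ℂ}
    (h : IsFormalModel lam Ω Ξ y I c) (hω : AnalyticAt ℂ ω 0) (hΩ : HasTaylorForm ω Ω)
    (hcodim : ∀ᶠ x in 𝓝 0, ω x ≠ 0 → Module.finrank ℂ (formKer (ω x)) + q = n) :
    IsIntegrableDistribution ω := by
  refine isIntegrable_of_contractionField hω hcodim fun K i j => ?_
  have htan := isTangentAt_contractionField hω hcodim
  have hker : ∀ j : Fin n,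
      contractionField Ω (fun a => Pi.single (K a) 1) (Pi.single j 1) ∈ alternatingKer Ω := by
    intro j
    refine (hΩ.mem_ker_iff (hΩ.contractionField K j)).1 ?_
    filter_upwards [htan] with x hx
    exact (hx _ _).2.self_of_nhds
  refine (hΩ.mem_ker_iff ((hΩ.contractionField K i).lieBracket (hΩ.contractionField K j))).2 ?_
  exact formalBracket_mem_alternatingKer h.coord h.ne_zero h.mem_ker (hker i) (hker j)

/-- If `ξ` is tangent to the distribution, the vector of its eigenvalues is in the kernel of the
constant matrix `c`. -/
theorem IsFormalModel.sum_lam_mul_eq_zero {lam : Fin n → ℂ}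
    {Ω : (Fin n → MvPowerSeries (Fin n) ℂ) [⋀^Fin q]→ₗ[MvPowerSeries (Fin n) ℂ]
      MvPowerSeries (Fin n) ℂ}
    {Ξ y : Fin n → MvPowerSeries (Fin n) ℂ} {I : Fin q → Fin n} {c : Fin q → Fin n → ℂ}
    (h : IsFormalModel lam Ω Ξ y I c) (hΞ : Ξ ∈ alternatingKer Ω) (k : Fin q) :
    ∑ i, lam i * c k i = 0 := by
  have hC : ∀ (c : ℂ) (W : Fin n → MvPowerSeries (Fin n) ℂ), c • W
      = (C c : MvPowerSeries (Fin n) ℂ) • W := by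
    intro c W
    ext1 k
    simp [smul_eq_C_mul]
  have h1 : Ξ - ∑ i, lam i • (logFrame y i - ∑ k, c k i • logFrame y (I k))
      = ∑ k, (C (∑ i, lam i * c k i) : MvPowerSeries (Fin n) ℂ) • logFrame y (I k) := by
    rw [h.field_eq]
    simp only [smul_sub, Finset.sum_sub_distrib, Finset.smul_sum, smul_smul, ← hC, Finset.sum_smul]
    rw [sub_sub_cancel, Finset.sum_comm]
  have h2 : Ξ - ∑ i, lam i • (logFrame y i - ∑ k, c k i • logFrame y (I k)) ∈ alternatingKer Ω :=
    Submodule.sub_mem _ hΞ (Submodule.sum_mem _ fun i _ =>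
      constSmul_mem_alternatingKer _ (h.mem_ker i))
  rw [h1] at h2
  have h3 := h2 (fun a => logFrame y (I a)) k
  rw [map_update_sum_smul Ω (fun a => logFrame y (I a))] at h3
  have h4 := (mul_eq_zero.1 h3).resolve_right h.ne_zero
  simpa using congrArg constantCoeff h4

/-- The maximal minors of the matrix `c`. -/
noncomputable def coeffDet (c : Fin q → Fin n → ℂ) (K : Fin q → Fin n) : ℂ :=
  Matrix.det (Matrix.of fun a k => c k (K a))

theorem injective_of_coeffDet_ne_zero {c : Fin q → Fin n → ℂ} {K : Fin q → Fin n}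
    (h : coeffDet c K ≠ 0) : Function.Injective K := by
  intro a b hab
  by_contra hne
  refine h (Matrix.det_zero_of_row_eq hne ?_)
  ext k
  simp [hab]

/-- The set of the indices that occur in a nonzero maximal minor of `c`. -/
noncomputable def coeffSupport (c : Fin q → Fin n → ℂ) : Finset (Fin n) :=
  letI := Classical.decPred fun i : Fin n => ∃ K, coeffDet c K ≠ 0 ∧ ∃ a, K a = i
  Finset.univ.filter fun i => ∃ K, coeffDet c K ≠ 0 ∧ ∃ a, K a = i

theorem mem_coeffSupport {c : Fin q → Fin n → ℂ} {i : Fin n} :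
    i ∈ coeffSupport c ↔ ∃ K, coeffDet c K ≠ 0 ∧ ∃ a, K a = i := by
  simp [coeffSupport]

theorem image_subset_coeffSupport {c : Fin q → Fin n → ℂ} {K : Fin q → Fin n}
    (h : coeffDet c K ≠ 0) : Finset.univ.image K ⊆ coeffSupport c := by
  intro i hi
  obtain ⟨a, _, rfl⟩ := Finset.mem_image.1 hi
  exact mem_coeffSupport.2 ⟨K, h, a, rfl⟩

theorem card_sdiff_image {c : Fin q → Fin n → ℂ} {K : Fin q → Fin n} (h : coeffDet c K ≠ 0) :
    (coeffSupport c \ Finset.univ.image K).card = (coeffSupport c).card - q := by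
  rw [Finset.card_sdiff_of_subset (image_subset_coeffSupport h),
    Finset.card_image_of_injective _ (injective_of_coeffDet_ne_zero h), Finset.card_univ,
    Fintype.card_fin]

/-- Modulo the kernel each vⱼ is the combination ∑ₖ cₖⱼ v_{Iₖ}, and on combinations of q fixed
vectors an alternating q-form scales by the determinant of coefficients. -/
theorem IsFormalModel.apply_logFrame {lam : Fin n → ℂ}
    {Ω : (Fin n → MvPowerSeries (Fin n) ℂ) [⋀^Fin q]→ₗ[MvPowerSeries (Fin n) ℂ]
      MvPowerSeries (Fin n) ℂ}
    {Ξ y : Fin n → MvPowerSeries (Fin n) ℂ} {I : Fin q → Fin n} {c : Fin q → Fin n → ℂ}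
    (h : IsFormalModel lam Ω Ξ y I c) (K : Fin q → Fin n) :
    Ω (fun a => logFrame y (K a)) = C (coeffDet c K) * Ω (fun a => logFrame y (I a)) := by
  have hC : ∀ (c : ℂ) (W : Fin n → MvPowerSeries (Fin n) ℂ), c • W
      = (C c : MvPowerSeries (Fin n) ℂ) • W := by
    intro c W
    ext1 k
    simp [smul_eq_C_mul]
  rw [alternatingMap_congr_ker Ω (fun a => h.mem_ker (K a))]
  let L : (Fin q → MvPowerSeries (Fin n) ℂ) →ₗ[MvPowerSeries (Fin n) ℂ]
      (Fin n → MvPowerSeries (Fin n) ℂ) :=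
    (Pi.basisFun _ (Fin q)).constr (MvPowerSeries (Fin n) ℂ) fun k => logFrame y (I k)
  have hL : ∀ k, L (Pi.basisFun _ (Fin q) k) = logFrame y (I k) := fun k =>
    Module.Basis.constr_basis _ _ _ _
  have hLa : ∀ w : Fin q → MvPowerSeries (Fin n) ℂ, L w = ∑ k, w k • logFrame y (I k) := by
    intro w
    rw [Module.Basis.constr_apply_fintype]
    simp
  have h3 := AlternatingMap.eq_smul_basis_det (Pi.basisFun _ (Fin q)) (Ω.compLinearMap L)
  have h4 := congrArg (fun f => f (fun a k => C (c k (K a)))) h3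
  simp only [AlternatingMap.compLinearMap_apply, AlternatingMap.smul_apply,
      Pi.basisFun_det_apply, smul_eq_mul, hL, hLa] at h4
  simp only [hC]
  refine h4.trans ?_
  rw [mul_comm]
  congr 1
  rw [coeffDet, RingHom.map_det]
  rfl

/-- The coefficients, in the coordinates `y`, of the logarithmic normal form of the distribution. -/
noncomputable def normalCoeff (y : Fin n → MvPowerSeries (Fin n) ℂ) (c : Fin q → Fin n → ℂ)
    (K : Fin q → Fin n) : MvPowerSeries (Fin n) ℂ :=
  ∑ I : Fin q → Fin n, C (coeffDet c I) * ((∏ a, pderiv ℂ (K a) (y (I a))) *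
    ∏ i ∈ coeffSupport c \ Finset.univ.image I, y i)

/-- The factor f is F divided by all yᵢ with i in the support of the minors. The values of Ω on the
frame ∂/∂yᵢ then have the logarithmic form, and the chain rule carries it over to the frame ∂/∂xᵢ.
-/
theorem IsFormalModel.exists_factorization {lam : Fin n → ℂ}
    {Ω : (Fin n → MvPowerSeries (Fin n) ℂ) [⋀^Fin q]→ₗ[MvPowerSeries (Fin n) ℂ]
      MvPowerSeries (Fin n) ℂ}
    {Ξ y : Fin n → MvPowerSeries (Fin n) ℂ} {I : Fin q → Fin n} {c : Fin q → Fin n → ℂ}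
    (h : IsFormalModel lam Ω Ξ y I c) :
    ∃ f : MvPowerSeries (Fin n) ℂ, f ≠ 0 ∧
      ∀ K : Fin q → Fin n, Ω (fun a => Pi.single (K a) 1) = f * normalCoeff y c K := by
  set F := Ω (fun a => logFrame y (I a)) with hF
  have hprod : ∀ K : Fin q → Fin n, (∏ a, y (K a)) * Ω (fun a => dualFrame y (K a))
      = C (coeffDet c K) * F := by
    intro K
    rw [hF, ← h.apply_logFrame K]
    have := Ω.toMultilinearMap.map_smul_univ (fun a => y (K a)) (fun a => dualFrame y (K a))
    exact this.symm
  -- An index in the support occurs in a K with nonzero minor; then F is a unit times a value of Ω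
  -- on fields vₖ = yₖ ∂/∂yₖ that include vᵢ.
  have hdvd : ∀ i ∈ coeffSupport c, y i ∣ F := by
    intro i hi
    obtain ⟨K, hK, a, rfl⟩ := mem_coeffSupport.1 hi
    have h1 : y (K a) ∣ C (coeffDet c K) * F := by
      rw [← hprod K]
      exact Dvd.dvd.mul_right (Finset.dvd_prod_of_mem _ (Finset.mem_univ a)) _
    have h2 : F = C (coeffDet c K)⁻¹ * (C (coeffDet c K) * F) := by
      rw [← mul_assoc, ← map_mul, inv_mul_cancel₀ hK, map_one, one_mul]
    rw [h2]
    exact Dvd.dvd.mul_left h1 _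
  obtain ⟨f, hf⟩ := prod_coordinate_dvd h.coord (coeffSupport c) hdvd
  have hg : ∀ K : Fin q → Fin n, Ω (fun a => dualFrame y (K a))
      = f * (C (coeffDet c K) * ∏ i ∈ coeffSupport c \ Finset.univ.image K, y i) := by
    intro K
    have hne : (∏ a, y (K a)) ≠ 0 :=
      Finset.prod_ne_zero_iff.2 fun a _ => (prime_coordinate (h.coord _)).ne_zero
    refine mul_left_cancel₀ hne ?_
    rw [hprod K]
    by_cases hK : coeffDet c K = 0
    · simp [hK]
    · have h1 : ∏ a, y (K a) = ∏ i ∈ Finset.univ.image K, y i := by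
        rw [Finset.prod_image fun a _ b _ hab => injective_of_coeffDet_ne_zero hK hab]
      rw [hf, ← Finset.prod_sdiff (image_subset_coeffSupport hK), h1]
      ring
  refine ⟨f, ?_, fun K => ?_⟩
  · rintro rfl
    exact h.ne_zero (by rw [← hF, hf, mul_zero])
  · have h1 : (fun a => (Pi.single (K a) 1 : Fin n → MvPowerSeries (Fin n) ℂ))
        = fun a => ∑ j, pderiv ℂ (K a) (y j) • dualFrame y j := by
      ext1 a
      have h2 := eq_sum_dualFrame h.coord (Pi.single (K a) 1)
      refine h2.trans (Finset.sum_congr rfl fun j _ => ?_)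
      rw [derivAlong_apply]
      congr 1
      simp [Pi.single_apply]
    rw [h1, ← AlternatingMap.coe_multilinearMap, MultilinearMap.map_sum, normalCoeff,
      Finset.mul_sum]
    refine Finset.sum_congr rfl fun J _ => ?_
    rw [MultilinearMap.map_smul_univ, AlternatingMap.coe_multilinearMap, hg J, smul_eq_mul]
    ring

theorem hasInit_pderiv_coordinate {y : Fin n → MvPowerSeries (Fin n) ℂ}
    (hy : ∀ i, (2 : ℕ∞) ≤ (y i - X i).order) (j k : Fin n) :
    HasInit (pderiv ℂ k (y j)) 0 (MvPolynomial.C (if j = k then 1 else 0)) := by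
  rw [← constantCoeff_pderiv_coordinate hy j k]
  exact hasInit_constantCoeff _

/-- The Jacobian matrix of y is the identity at 0, so in lowest degree only the diagonal term I = K
survives. -/
theorem hasInit_normalCoeff_term {y : Fin n → MvPowerSeries (Fin n) ℂ}
    (hy : ∀ i, (2 : ℕ∞) ≤ (y i - X i).order) (K I : Fin q → Fin n) (s : Finset (Fin n)) (b : ℂ) :
    HasInit (C b * ((∏ a, pderiv ℂ (K a) (y (I a))) * ∏ i ∈ s, y i)) s.card
      (if I = K then MvPolynomial.C b * ∏ i ∈ s, MvPolynomial.X i else 0) := by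
  classical
  have h1 := (HasInit.prod (s := Finset.univ) fun a _ =>
    hasInit_pderiv_coordinate hy (I a) (K a))
  have h2 := (HasInit.prod (s := s) fun i _ => hasInit_coordinate (hy i))
  have h3 := (HasInit.const (n := n) b).mul (h1.mul h2)
  simp only [Finset.sum_const, mul_zero, zero_add, smul_eq_mul, mul_one] at h3
  convert h3 using 1
  split_ifs with h
  · subst h
    simp
  · obtain ⟨a, ha⟩ := Function.ne_iff.1 h
    have : ∏ a, (MvPolynomial.C (if I a = K a then (1 : ℂ) else 0) : MvPolynomial (Fin n) ℂ)
        = 0 := by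
      rw [Finset.prod_eq_zero (Finset.mem_univ a)]
      simp [ha]
    rw [this]
    simp

theorem hasInit_normalCoeff {y : Fin n → MvPowerSeries (Fin n) ℂ}
    (hy : ∀ i, (2 : ℕ∞) ≤ (y i - X i).order) (c : Fin q → Fin n → ℂ) (K : Fin q → Fin n) :
    HasInit (normalCoeff y c K) ((coeffSupport c).card - q) (MvPolynomial.C (coeffDet c K) *
      ∏ i ∈ coeffSupport c \ Finset.univ.image K, MvPolynomial.X i) := by
  classical
  have h1 : HasInit (normalCoeff y c K) ((coeffSupport c).card - q)
      (∑ I : Fin q → Fin n, if I = K then MvPolynomial.C (coeffDet c I) *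
        ∏ i ∈ coeffSupport c \ Finset.univ.image I, MvPolynomial.X i else 0) := by
    refine HasInit.sum fun I _ => ?_
    by_cases hI : coeffDet c I = 0
    · simpa [hI] using HasInit.zero _
    · rw [← card_sdiff_image hI]
      exact hasInit_normalCoeff_term hy K I _ _
  simpa using h1

end FormalModel

/-! ### Uniform estimates on small multiples of a bounded set. -/

section Scaling

open MvPowerSeries Asymptotics

variable {n : ℕ}

theorem exists_polynomial_approx (φ : MvPowerSeries (Fin n) ℂ) (N : ℕ) :
    ∃ P : MvPolynomial (Fin n) ℂ, (N : ℕ∞) ≤ (φ - P).order := by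
  classical
  refine ⟨∑ k ∈ Finset.range N, ∑ m ∈ Finset.finsuppAntidiag Finset.univ k,
    MvPolynomial.monomial m (coeff m φ), nat_le_order fun d hd => ?_⟩
  rw [map_sub, MvPolynomial.coeff_coe, sub_eq_zero]
  simp only [MvPolynomial.coeff_sum, MvPolynomial.coeff_monomial]
  rw [Finset.sum_eq_single d.degree, Finset.sum_eq_single d]
  · simp
  · intro k _ hk
    rw [if_neg hk]
  · intro h
    refine absurd ?_ h
    rw [Finset.mem_finsuppAntidiag]
    exact ⟨by rw [Finsupp.degree_eq_sum], Finset.subset_univ _⟩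
  · intro k _ hk
    refine Finset.sum_eq_zero fun m hm => ?_
    rw [if_neg]
    rintro rfl
    rw [Finset.mem_finsuppAntidiag, ← Finsupp.degree_eq_sum] at hm
    exact hk hm.1.symm
  · intro h
    exact absurd (Finset.mem_range.2 hd) h

theorem exists_bound_smul {F : (Fin n → ℂ) → ℂ} {N : ℕ} (hF : F =O[𝓝 0] fun x => ‖x‖ ^ N)
    {S : Set (Fin n → ℂ)} (hS : Bornology.IsBounded S) :
    ∃ B, 0 ≤ B ∧ ∀ᶠ t in 𝓝 (0 : ℂ), ∀ x ∈ S, ‖F (t • x)‖ ≤ B * ‖t‖ ^ N := by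
  obtain ⟨A, hA0, hA⟩ := hF.exists_pos
  rw [IsBigOWith] at hA
  obtain ⟨r, hr, hball⟩ := Metric.eventually_nhds_iff_ball.1 hA
  obtain ⟨b, hb0, hb⟩ := hS.exists_pos_norm_le
  refine ⟨A * b ^ N, by positivity, ?_⟩
  filter_upwards [Metric.ball_mem_nhds (0 : ℂ) (div_pos hr hb0)] with t ht x hx
  rw [mem_ball_zero_iff, lt_div_iff₀ hb0] at ht
  have h1 : ‖t • x‖ ≤ ‖t‖ * b := by
    rw [norm_smul]
    exact mul_le_mul_of_nonneg_left (hb x hx) (norm_nonneg _)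
  have h2 := hball (t • x) (by rw [mem_ball_zero_iff]; exact h1.trans_lt ht)
  refine h2.trans ?_
  rw [norm_pow, norm_norm, mul_assoc, ← mul_pow, mul_comm b]
  exact mul_le_mul_of_nonneg_left (pow_le_pow_left₀ (norm_nonneg _) h1 _) hA0.le

/-- On S the initial form is bounded away from zero and dominates the remainder, which is smaller by
a factor t. -/
theorem exists_lower_bound_smul {g : (Fin n → ℂ) → ℂ} {φ : MvPowerSeries (Fin n) ℂ} {D : ℕ}
    {L : MvPolynomial (Fin n) ℂ} (hg : HasTaylor g φ) (hφ : HasInit φ D L)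
    {S : Set (Fin n → ℂ)} (hS : IsCompact S) (hL : ∀ x ∈ S, MvPolynomial.eval x L ≠ 0) :
    ∃ m > 0, ∀ᶠ t in 𝓝 (0 : ℂ), ∀ x ∈ S, m * ‖t‖ ^ D ≤ ‖g (t • x)‖ := by
  obtain ⟨m, hm0, hm⟩ : ∃ m > 0, ∀ x ∈ S, m ≤ ‖MvPolynomial.eval x L‖ := by
    rcases S.eq_empty_or_nonempty with rfl | hne
    · exact ⟨1, one_pos, by simp⟩
    · have hc : ContinuousOn (fun x => ‖MvPolynomial.eval x L‖) S := fun x _ =>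
        ((analyticAt_eval L x).continuousAt.norm).continuousWithinAt
      obtain ⟨x, hx, hmin⟩ := hS.exists_isMinOn hne hc
      exact ⟨_, norm_pos_iff.2 (hL x hx), fun y hy => hmin hy⟩
  obtain ⟨B, hB0, hB⟩ := exists_bound_smul (hφ.isBigO hg) hS.isBounded
  have hsmall : ∀ᶠ t in 𝓝 (0 : ℂ), B * ‖t‖ < m / 2 := by
    have : Tendsto (fun t : ℂ => B * ‖t‖) (𝓝 0) (𝓝 0) := by
      have h : Continuous fun t : ℂ => B * ‖t‖ := by fun_prop
      simpa using h.tendsto 0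
    exact this.eventually_lt_const (half_pos hm0)
  refine ⟨m / 2, half_pos hm0, ?_⟩
  filter_upwards [hB, hsmall] with t ht hts x hx
  have h1 := ht x hx
  rw [eval_smul_of_isHomogeneous hφ.1] at h1
  have h2 : ‖t ^ D * MvPolynomial.eval x L‖ ≤ ‖g (t • x)‖
      + ‖g (t • x) - t ^ D * MvPolynomial.eval x L‖ := by
    have := norm_sub_le (g (t • x)) (g (t • x) - t ^ D * MvPolynomial.eval x L)
    simpa using this
  rw [norm_mul, norm_pow] at h2
  have h3 : ‖t‖ ^ D * m ≤ ‖t‖ ^ D * ‖MvPolynomial.eval x L‖ :=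
    mul_le_mul_of_nonneg_left (hm x hx) (by positivity)
  have h4 : B * ‖t‖ ^ (D + 1) ≤ ‖t‖ ^ D * (m / 2) := by
    rw [pow_succ]
    have := mul_le_mul_of_nonneg_left hts.le (show 0 ≤ ‖t‖ ^ D by positivity)
    linarith
  linarith

end Scaling

/-! ### Integrals with a parameter and flat holomorphic functions. -/

section ResidueArgument

open MvPowerSeries Asymptotics MeasureTheory

theorem differentiableOn_intervalIntegral_of_continuousOn {U : Set ℂ} (hU : IsOpen U)
    {F F' : ℂ → ℝ → ℂ} {a b : ℝ}
    (hF : ContinuousOn (Function.uncurry F) (U ×ˢ Set.univ))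
    (hF' : ContinuousOn (Function.uncurry F') (U ×ˢ Set.univ))
    (hd : ∀ t ∈ U, ∀ θ, HasDerivAt (fun t => F t θ) (F' t θ) t) :
    DifferentiableOn ℂ (fun t => ∫ θ in a..b, F t θ) U := by
  intro t₀ ht₀
  obtain ⟨ε, hε, hεU⟩ := Metric.nhds_basis_closedBall.mem_iff.1 (hU.mem_nhds ht₀)
  have hcont : ∀ G : ℂ → ℝ → ℂ, ContinuousOn (Function.uncurry G) (U ×ˢ Set.univ) →
      ∀ t ∈ U, Continuous (G t) := by
    intro G hG t ht
    have h1 : Continuous fun θ : ℝ => (t, θ) := by fun_prop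
    exact hG.comp_continuous h1 fun θ => ⟨ht, Set.mem_univ _⟩
  have hK : IsCompact (Metric.closedBall t₀ ε ×ˢ Set.uIcc a b) :=
    (isCompact_closedBall _ _).prod isCompact_uIcc
  obtain ⟨B, hB⟩ := hK.exists_bound_of_continuousOn
    (hF'.mono (Set.prod_mono hεU (Set.subset_univ _)))
  have h := intervalIntegral.hasDerivAt_integral_of_dominated_loc_of_deriv_le (μ := volume)
    (F := F) (F' := F') (x₀ := t₀) (a := a) (b := b) (bound := fun _ => B)
    (s := Metric.ball t₀ ε) (Metric.ball_mem_nhds _ hε)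
    (by
      filter_upwards [hU.mem_nhds ht₀] with t ht
      exact (hcont F hF t ht).aestronglyMeasurable)
    ((hcont F hF t₀ ht₀).intervalIntegrable _ _)
    (hcont F' hF' t₀ ht₀).aestronglyMeasurable
    (Eventually.of_forall fun θ hθ t ht =>
      hB (t, θ) ⟨Metric.ball_subset_closedBall ht, Set.uIoc_subset_uIcc hθ⟩)
    (continuous_const.intervalIntegrable _ _)
    (Eventually.of_forall fun θ _ t ht => hd t (hεU (Metric.ball_subset_closedBall ht)) θ)
  exact h.2.differentiableAt.differentiableWithinAt

/-- With the value 0 at 0 the singularity is removable, all Taylor coefficients vanish, and the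
identity theorem applies on the disc. -/
theorem eq_zero_of_differentiableOn_punctured {M : ℂ → ℂ} {τ : ℝ}
    (hM : DifferentiableOn ℂ M (Metric.ball 0 τ \ {0}))
    (hN : ∀ N : ℕ, M =O[𝓝[≠] 0] fun t => ‖t‖ ^ N) : ∀ t ∈ Metric.ball 0 τ \ {0}, M t = 0 := by
  intro t ht
  have hτ : 0 < τ := (norm_nonneg t).trans_lt (mem_ball_zero_iff.1 ht.1)
  let M' := Function.update M 0 0
  have hM'eq : ∀ s, s ≠ 0 → M' s = M s := fun s hs => Function.update_of_ne hs _ _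
  have hMeq : ∀ᶠ s in 𝓝[≠] (0 : ℂ), M' s = M s := by
    filter_upwards [self_mem_nhdsWithin] with s hs using hM'eq s hs
  have hO : ∀ N : ℕ, M' =O[𝓝 0] fun t => ‖t‖ ^ N := by
    intro N
    obtain ⟨B, hB⟩ := (hN N).bound
    rw [eventually_nhdsWithin_iff] at hB
    refine IsBigO.of_bound (max B 0) ?_
    filter_upwards [hB] with s hs
    by_cases h : s = 0
    · subst h
      simp only [M', Function.update_self, norm_zero]
      positivity
    · rw [hM'eq s h]
      refine (hs h).trans ?_
      gcongr
      exact le_max_left _ _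
  have hcont : ContinuousAt M' 0 := by
    have h1 := (hO 1).trans_tendsto (by
      have : Continuous fun t : ℂ => ‖t‖ ^ 1 := by fun_prop
      simpa using this.tendsto (0 : ℂ))
    rw [ContinuousAt]
    simpa [M'] using h1
  have hdiff : DifferentiableOn ℂ M' (Metric.ball 0 τ) := by
    refine (Complex.differentiableOn_compl_singleton_and_continuousAt_iff
      (Metric.ball_mem_nhds 0 hτ)).1 ⟨?_, hcont⟩
    exact hM.congr fun s hs => hM'eq s hs.2
  have han : AnalyticOnNhd ℂ M' (Metric.ball 0 τ) := hdiff.analyticOnNhd Metric.isOpen_ball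
  have h0 := eventually_eq_zero_of_forall_isBigO (han 0 (Metric.mem_ball_self hτ)) hO
  have h1 := han.eqOn_zero_of_preconnected_of_eventuallyEq_zero
    (convex_ball 0 τ).isPreconnected (Metric.mem_ball_self hτ) h0
  rw [← hM'eq t ht.2]
  exact h1 ht.1

end ResidueArgument

/-! ### Common zeros of germs with a common formal factor. -/

section CommonZeros

open MvPowerSeries Asymptotics MeasureTheory

variable {n : ℕ}

theorem differentiableOn_integral_quotient {g₀ g₁ : (Fin n → ℂ) → ℂ} {V : Set (Fin n → ℂ)}
    (h₀ : AnalyticOnNhd ℂ g₀ V) (h₁ : AnalyticOnNhd ℂ g₁ V) {U : Set ℂ} (hU : IsOpen U)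
    {u : ℝ → Fin n → ℂ} (hu : Continuous u) {k : ℝ → ℂ} (hk : Continuous k)
    (hUV : ∀ t ∈ U, ∀ θ, t • u θ ∈ V) (hne : ∀ t ∈ U, ∀ θ, g₀ (t • u θ) ≠ 0) (a b : ℝ) :
    DifferentiableOn ℂ (fun t => ∫ θ in a..b, k θ * (g₁ (t • u θ) / g₀ (t • u θ))) U := by
  have hmap : ContinuousOn (fun x : ℂ × ℝ => x.1 • u x.2) (U ×ˢ Set.univ) := by fun_prop
  have hmaps : Set.MapsTo (fun x : ℂ × ℝ => x.1 • u x.2) (U ×ˢ Set.univ) V :=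
    fun x hx => hUV x.1 hx.1 x.2
  have hu' : ContinuousOn (fun x : ℂ × ℝ => u x.2) (U ×ˢ Set.univ) := by fun_prop
  have hk' : ContinuousOn (fun x : ℂ × ℝ => k x.2) (U ×ˢ Set.univ) := by fun_prop
  have c₀ := h₀.continuousOn.comp hmap hmaps
  have c₁ := h₁.continuousOn.comp hmap hmaps
  have d₀ := (h₀.fderiv.continuousOn.comp hmap hmaps).clm_apply hu'
  have d₁ := (h₁.fderiv.continuousOn.comp hmap hmaps).clm_apply hu'
  have hne' : ∀ x ∈ U ×ˢ (Set.univ : Set ℝ), g₀ (x.1 • u x.2) ≠ 0 :=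
    fun x hx => hne x.1 hx.1 x.2
  refine differentiableOn_intervalIntegral_of_continuousOn hU
    (F' := fun t θ => k θ * ((fderiv ℂ g₁ (t • u θ) (u θ) * g₀ (t • u θ)
      - g₁ (t • u θ) * fderiv ℂ g₀ (t • u θ) (u θ)) / g₀ (t • u θ) ^ 2)) ?_ ?_ ?_
  · exact hk'.mul (c₁.div c₀ hne')
  · exact hk'.mul (((d₁.mul c₀).sub (c₁.mul d₀)).div (c₀.pow 2)
      fun x hx => pow_ne_zero 2 (hne' x hx))
  · intro t ht θ
    have hlin : HasDerivAt (fun t : ℂ => t • u θ) (u θ) t := by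
      simpa using (hasDerivAt_id t).smul_const (u θ)
    have e₀ := (h₀ _ (hUV t ht θ)).differentiableAt.hasFDerivAt.comp_hasDerivAt t hlin
    have e₁ := (h₁ _ (hUV t ht θ)).differentiableAt.hasFDerivAt.comp_hasDerivAt t hlin
    exact (e₁.div e₀ (hne t ht θ)).const_mul (k θ)

theorem exists_analyticOnNhd_ball {g : (Fin n → ℂ) → ℂ} (hg : AnalyticAt ℂ g 0) :
    ∃ r > 0, AnalyticOnNhd ℂ g (Metric.ball 0 r) := by
  obtain ⟨r, hr, h⟩ := Metric.eventually_nhds_iff_ball.1 hg.eventually_analyticAt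
  exact ⟨r, hr, h⟩

theorem eventually_smul_mem_ball {S : Set (Fin n → ℂ)} (hS : Bornology.IsBounded S) {r : ℝ}
    (hr : 0 < r) : ∀ᶠ t in 𝓝 (0 : ℂ), ∀ x ∈ S, t • x ∈ Metric.ball (0 : Fin n → ℂ) r := by
  obtain ⟨b, hb0, hb⟩ := hS.exists_pos_norm_le
  filter_upwards [Metric.ball_mem_nhds (0 : ℂ) (div_pos hr hb0)] with t ht x hx
  rw [mem_ball_zero_iff, lt_div_iff₀ hb0] at ht
  rw [mem_ball_zero_iff, norm_smul]
  exact (mul_le_mul_of_nonneg_left (hb x hx) (norm_nonneg _)).trans_lt ht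

theorem HasInit.of_le_order_sub {θ : MvPowerSeries (Fin n) ℂ} {d N : ℕ}
    {τ : MvPolynomial (Fin n) ℂ} (h : HasInit θ d τ) {b : MvPowerSeries (Fin n) ℂ}
    (hb : (N : ℕ∞) ≤ (θ - b).order) (hN : d + 1 ≤ N) : HasInit b d τ := by
  refine ⟨h.1, ?_⟩
  have : b - τ = (θ - τ) - (θ - b) := by ring
  rw [this]
  refine le_order_sub h.2 (le_trans ?_ hb)
  exact_mod_cast hN

/-- Formally g₁/g₀ = θ₁/θ₀. The series f cancels, and θ₁/θ₀ is approximated to any order by a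
quotient of polynomials without poles on the disc. For this quotient the integral is a Cauchy
integral of a function that vanishes at z. -/
theorem isBigO_circleIntegral_quotient {f θ₀ θ₁ : MvPowerSeries (Fin n) ℂ}
    {g₀ g₁ : (Fin n → ℂ) → ℂ} (h₀ : HasTaylor g₀ (f * θ₀)) (h₁ : HasTaylor g₁ (f * θ₁))
    {D d : ℕ} {Λ τ : MvPolynomial (Fin n) ℂ} (hΛ : HasInit (f * θ₀) D Λ) (hτ : HasInit θ₀ d τ)
    {w : ℂ → Fin n → ℂ} (hw : Differentiable ℂ w) {ρ : ℝ} (hρ : 0 < ρ)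
    (hΛne : ∀ s ∈ Metric.sphere (0 : ℂ) ρ, MvPolynomial.eval (w s) Λ ≠ 0)
    (hτne : ∀ s ∈ Metric.closedBall (0 : ℂ) ρ, MvPolynomial.eval (w s) τ ≠ 0)
    {G : ℂ → ℂ} (hG : DifferentiableOn ℂ G (Metric.closedBall 0 ρ)) {z : ℂ}
    (hz : z ∈ Metric.ball (0 : ℂ) ρ) (hGz : G z = 0) (N : ℕ) :
    (fun t : ℂ => ∮ s in C(0, ρ), (s - z)⁻¹ * (g₁ (t • w s) / g₀ (t • w s) * G s))
      =O[𝓝[≠] 0] fun t => ‖t‖ ^ N := by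
  have hSc : IsCompact (w '' Metric.sphere 0 ρ) := (isCompact_sphere _ _).image hw.continuous
  have hSd : IsCompact (w '' Metric.closedBall 0 ρ) :=
    (isCompact_closedBall _ _).image hw.continuous
  -- The order exceeds d, so b keeps the initial form of θ₀, and it is at least N + d + D, so tᴺ
  -- remains after division by g₀ b, which is at least of size tᴰ⁺ᵈ.
  obtain ⟨b, hb⟩ := exists_polynomial_approx θ₀ (N + 2 * d + D + 1)
  obtain ⟨a, ha⟩ := exists_polynomial_approx θ₁ (N + 2 * d + D + 1)
  have hbT := hasTaylor_eval (n := n) b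
  have haT := hasTaylor_eval (n := n) a
  have hnum : HasTaylor (fun x => MvPolynomial.eval x b * g₁ x - MvPolynomial.eval x a * g₀ x)
      (b * (f * θ₁) - a * (f * θ₀)) := (hbT.mul h₁).sub (haT.mul h₀)
  have hord : ((N + d + D : ℕ) : ℕ∞) ≤ ((b : MvPowerSeries (Fin n) ℂ) * (f * θ₁)
      - a * (f * θ₀)).order := by
    have e : (b : MvPowerSeries (Fin n) ℂ) * (f * θ₁) - a * (f * θ₀)
        = f * θ₀ * (θ₁ - a) - f * θ₁ * (θ₀ - b) := by ring
    rw [e]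
    have hle : ((N + d + D : ℕ) : ℕ∞) ≤ ((N + 2 * d + D + 1 : ℕ) : ℕ∞) := by
      exact_mod_cast (by omega)
    exact le_order_sub (le_order_mul_left (hle.trans ha)) (le_order_mul_left (hle.trans hb))
  obtain ⟨B, hB0, hB⟩ := exists_bound_smul (hnum.isBigO_of_le_order hord) hSc.isBounded
  obtain ⟨m, hm0, hm⟩ := exists_lower_bound_smul h₀ hΛ hSc
    (by rintro _ ⟨s, hs, rfl⟩; exact hΛne s hs)
  obtain ⟨m', hm'0, hm'⟩ := exists_lower_bound_smul hbT
    (hτ.of_le_order_sub hb (by omega)) hSd (by rintro _ ⟨s, hs, rfl⟩; exact hτne s hs)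
  obtain ⟨r, hr, hg₀⟩ := exists_analyticOnNhd_ball h₀.1
  obtain ⟨r', hr', hg₁⟩ := exists_analyticOnNhd_ball h₁.1
  have hkc : ContinuousOn (fun s => (s - z)⁻¹ * G s) (Metric.sphere (0 : ℂ) ρ) := by
    refine ContinuousOn.mul (ContinuousOn.inv₀ (by fun_prop) ?_)
      (hG.continuousOn.mono Metric.sphere_subset_closedBall)
    intro s hs h
    rw [sub_eq_zero.1 h] at hs
    exact (Metric.mem_ball.1 hz).ne (Metric.mem_sphere.1 hs)
  obtain ⟨A, hA⟩ := (isCompact_sphere (0 : ℂ) ρ).exists_bound_of_continuousOn hkc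
  refine IsBigO.of_bound (2 * Real.pi * ρ * (A * (B / (m * m')))) ?_
  filter_upwards [self_mem_nhdsWithin, nhdsWithin_le_nhds hB, nhdsWithin_le_nhds hm,
    nhdsWithin_le_nhds hm', nhdsWithin_le_nhds (eventually_smul_mem_ball hSc.isBounded hr),
    nhdsWithin_le_nhds (eventually_smul_mem_ball hSc.isBounded hr')] with t ht hBt hmt hmt' htr htr'
  have ht0 : 0 < ‖t‖ := norm_pos_iff.2 ht
  have hbne : ∀ s ∈ Metric.closedBall (0 : ℂ) ρ, MvPolynomial.eval (t • w s) b ≠ 0 := by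
    intro s hs h
    have := hmt' _ ⟨s, hs, rfl⟩
    rw [h, norm_zero] at this
    exact absurd this (not_le.2 (by positivity))
  have hgne : ∀ s ∈ Metric.sphere (0 : ℂ) ρ, g₀ (t • w s) ≠ 0 := by
    intro s hs h
    have := hmt _ ⟨s, hs, rfl⟩
    rw [h, norm_zero] at this
    exact absurd this (not_le.2 (by positivity))
  have hev : ∀ P : MvPolynomial (Fin n) ℂ, Differentiable ℂ fun s => MvPolynomial.eval (t • w s) P :=
    fun P s => DifferentiableAt.comp (g := fun x => MvPolynomial.eval x P) s
      (analyticAt_eval P (t • w s)).differentiableAt ((hw s).const_smul t)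
  have hcauchy : (∮ s in C(0, ρ), (s - z)⁻¹ * (MvPolynomial.eval (t • w s) a
      / MvPolynomial.eval (t • w s) b * G s)) = 0 := by
    have := (DifferentiableOn.circleIntegral_sub_inv_smul (c := 0) (R := ρ) (w := z)
      (f := fun s => MvPolynomial.eval (t • w s) a / MvPolynomial.eval (t • w s) b * G s)
      (((hev a).differentiableOn.div (hev b).differentiableOn hbne).mul hG) hz)
    simpa [hGz] using this
  have hcw : ContinuousOn (fun s => t • w s) (Metric.sphere (0 : ℂ) ρ) :=
    (hw.continuous.const_smul t).continuousOn
  have hc0 : ContinuousOn (fun s => g₀ (t • w s)) (Metric.sphere (0 : ℂ) ρ) :=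
    hg₀.continuousOn.comp hcw fun s hs => htr _ ⟨s, hs, rfl⟩
  have hc1 : ContinuousOn (fun s => g₁ (t • w s)) (Metric.sphere (0 : ℂ) ρ) :=
    hg₁.continuousOn.comp hcw fun s hs => htr' _ ⟨s, hs, rfl⟩
  have hI1 : CircleIntegrable (fun s => (s - z)⁻¹ * (g₁ (t • w s) / g₀ (t • w s) * G s)) 0 ρ := by
    refine ContinuousOn.circleIntegrable hρ.le ?_
    refine (hkc.mul (hc1.div hc0 hgne)).congr fun s _ => ?_
    simp only [Pi.mul_apply, Pi.div_apply]; ring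
  have hI2 : CircleIntegrable (fun s => (s - z)⁻¹ * (MvPolynomial.eval (t • w s) a
      / MvPolynomial.eval (t • w s) b * G s)) 0 ρ := by
    refine ContinuousOn.circleIntegrable hρ.le ?_
    refine (hkc.mul ((hev a).continuous.continuousOn.div (hev b).continuous.continuousOn
      fun s hs => hbne s (Metric.sphere_subset_closedBall hs))).congr fun s _ => ?_
    simp only [Pi.mul_apply, Pi.div_apply]; ring
  have hsub := circleIntegral.integral_sub hI1 hI2
  rw [hcauchy, sub_zero] at hsub
  rw [← hsub]
  rw [norm_pow, norm_norm, mul_assoc]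
  refine circleIntegral.norm_integral_le_of_norm_le_const hρ.le fun s hs => ?_
  have hs' := Metric.sphere_subset_closedBall hs
  have e : (s - z)⁻¹ * (g₁ (t • w s) / g₀ (t • w s) * G s) - (s - z)⁻¹ *
      (MvPolynomial.eval (t • w s) a / MvPolynomial.eval (t • w s) b * G s)
      = ((s - z)⁻¹ * G s) * ((MvPolynomial.eval (t • w s) b * g₁ (t • w s)
        - MvPolynomial.eval (t • w s) a * g₀ (t • w s))
        / (g₀ (t • w s) * MvPolynomial.eval (t • w s) b)) := by
    have h1 := hgne s hs
    have h2 := hbne s hs'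
    rw [div_mul_eq_mul_div, div_mul_eq_mul_div, ← mul_sub, mul_assoc, mul_div_assoc']
    congr 1
    rw [div_sub_div _ _ h1 h2]
    congr 1
    ring
  rw [e, norm_mul ((s - z)⁻¹ * G s), norm_div, norm_mul (g₀ _), mul_assoc A]
  have hA0 : 0 ≤ A := (norm_nonneg _).trans (hA s hs)
  refine mul_le_mul (hA s hs) ?_ (by positivity) hA0
  have h3 : m * ‖t‖ ^ D * (m' * ‖t‖ ^ d) ≤ ‖g₀ (t • w s)‖ * ‖MvPolynomial.eval (t • w s) b‖ :=
    mul_le_mul (hmt _ ⟨s, hs, rfl⟩) (hmt' _ ⟨s, hs', rfl⟩) (by positivity) (norm_nonneg _)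
  have h4 := div_le_div₀ (by positivity) (hBt _ ⟨s, hs, rfl⟩) (by positivity) h3
  refine h4.trans (le_of_eq ?_)
  field_simp
  ring

/-- The germs `g₀` and `g₁` have the common formal factor `f`. If the cofactor of `f` in `g₀` has an
initial form without zeros on a disc, then `g₁` vanishes at the zeros of `g₀` on the small
multiples of this disc. -/
theorem eq_zero_of_common_formal_factor {f θ₀ θ₁ : MvPowerSeries (Fin n) ℂ}
    {g₀ g₁ : (Fin n → ℂ) → ℂ} (h₀ : HasTaylor g₀ (f * θ₀)) (h₁ : HasTaylor g₁ (f * θ₁))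
    {D d : ℕ} {Λ τ : MvPolynomial (Fin n) ℂ} (hΛ : HasInit (f * θ₀) D Λ) (hτ : HasInit θ₀ d τ)
    {w : ℂ → Fin n → ℂ} (hw : Differentiable ℂ w) {ρ : ℝ} (hρ : 0 < ρ)
    (hΛne : ∀ s ∈ Metric.sphere (0 : ℂ) ρ, MvPolynomial.eval (w s) Λ ≠ 0)
    (hτne : ∀ s ∈ Metric.closedBall (0 : ℂ) ρ, MvPolynomial.eval (w s) τ ≠ 0) :
    ∀ᶠ t in 𝓝[≠] (0 : ℂ), ∀ z ∈ Metric.ball (0 : ℂ) ρ, g₀ (t • w z) = 0 → g₁ (t • w z) = 0 := by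
  have hSc : IsCompact (w '' Metric.sphere 0 ρ) := (isCompact_sphere _ _).image hw.continuous
  have hSd : IsCompact (w '' Metric.closedBall 0 ρ) :=
    (isCompact_closedBall _ _).image hw.continuous
  obtain ⟨m, hm0, hm⟩ := exists_lower_bound_smul h₀ hΛ hSc
    (by rintro _ ⟨s, hs, rfl⟩; exact hΛne s hs)
  obtain ⟨r₀, hr₀, hg₀'⟩ := exists_analyticOnNhd_ball h₀.1
  obtain ⟨r₁, hr₁, hg₁'⟩ := exists_analyticOnNhd_ball h₁.1
  obtain ⟨r, hr, hg₀, hg₁⟩ : ∃ r > 0, AnalyticOnNhd ℂ g₀ (Metric.ball 0 r) ∧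
      AnalyticOnNhd ℂ g₁ (Metric.ball 0 r) :=
    ⟨min r₀ r₁, lt_min hr₀ hr₁, hg₀'.mono (Metric.ball_subset_ball (min_le_left _ _)),
      hg₁'.mono (Metric.ball_subset_ball (min_le_right _ _))⟩
  obtain ⟨ε, hε, hball⟩ := Metric.eventually_nhds_iff_ball.1
    (hm.and (eventually_smul_mem_ball hSd.isBounded hr))
  have hgne : ∀ t ∈ Metric.ball (0 : ℂ) ε \ {0}, ∀ s ∈ Metric.sphere (0 : ℂ) ρ,
      g₀ (t • w s) ≠ 0 := by
    intro t ht s hs h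
    have := (hball t ht.1).1 _ ⟨s, hs, rfl⟩
    rw [h, norm_zero] at this
    have ht0 : 0 < ‖t‖ := norm_pos_iff.2 ht.2
    exact absurd this (not_le.2 (by positivity))
  have hdiff : ∀ g : (Fin n → ℂ) → ℂ, AnalyticOnNhd ℂ g (Metric.ball 0 r) →
      ∀ t ∈ Metric.ball (0 : ℂ) ε, DifferentiableOn ℂ (fun s => g (t • w s))
        (Metric.closedBall 0 ρ) := by
    intro g hg t ht s hs
    exact ((hg _ ((hball t ht).2 _ ⟨s, hs, rfl⟩)).differentiableAt.comp s
      ((hw s).const_smul t)).differentiableWithinAt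
  filter_upwards [self_mem_nhdsWithin, nhdsWithin_le_nhds (Metric.ball_mem_nhds 0 hε)]
    with t₀ ht₀ ht₀ε z hz hzero
  have hnz : ∀ s ∈ Metric.sphere (0 : ℂ) ρ, s - z ≠ 0 := by
    intro s hs h
    rw [sub_eq_zero.1 h] at hs
    exact (Metric.mem_ball.1 hz).ne (Metric.mem_sphere.1 hs)
  have hcirc : ∀ θ, circleMap 0 ρ θ ∈ Metric.sphere (0 : ℂ) ρ := circleMap_mem_sphere 0 hρ.le
  -- The weight g₀(t₀ w(s)) is kept fixed while t varies. It vanishes at z, as flatness requires,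
  -- and at t = t₀ it cancels the denominator.
  have hM : DifferentiableOn ℂ (fun t : ℂ => ∮ s in C(0, ρ),
      (s - z)⁻¹ * (g₁ (t • w s) / g₀ (t • w s) * g₀ (t₀ • w s))) (Metric.ball 0 ε \ {0}) := by
    have hU : IsOpen (Metric.ball (0 : ℂ) ε \ {0}) := Metric.isOpen_ball.sdiff isClosed_singleton
    refine (differentiableOn_integral_quotient hg₀ hg₁ hU
      (u := fun θ => w (circleMap 0 ρ θ)) (hw.continuous.comp (continuous_circleMap 0 ρ))
      (k := fun θ => deriv (circleMap 0 ρ) θ * ((circleMap 0 ρ θ - z)⁻¹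
        * g₀ (t₀ • w (circleMap 0 ρ θ)))) ?_
      (fun t ht θ => (hball t ht.1).2 _ ⟨_, Metric.sphere_subset_closedBall (hcirc θ), rfl⟩)
      (fun t ht θ => hgne t ht _ (hcirc θ)) 0 (2 * Real.pi)).congr ?_
    · have hcm := continuous_circleMap 0 ρ
      refine Continuous.mul ?_ (Continuous.mul (Continuous.inv₀ (by fun_prop)
        fun θ => hnz _ (hcirc θ)) ?_)
      · have : deriv (circleMap 0 ρ) = fun θ => circleMap 0 ρ θ * Complex.I := by
          ext θ
          rw [deriv_circleMap]
        rw [this]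
        exact hcm.mul continuous_const
      · exact (hdiff g₀ hg₀ t₀ ht₀ε).continuousOn.comp_continuous hcm
          fun θ => Metric.sphere_subset_closedBall (hcirc θ)
    · intro t _
      rw [circleIntegral]
      congr 1
      ext θ
      rw [smul_eq_mul]
      ring
  -- The integral is flat at t = 0, hence zero also at t = t₀, where it is the Cauchy integral for
  -- g₁(t₀ w(z)). The radius ε does not depend on t₀ or z.
  have h0 := eq_zero_of_differentiableOn_punctured hM (fun N =>
    isBigO_circleIntegral_quotient h₀ h₁ hΛ hτ hw hρ hΛne hτne (hdiff g₀ hg₀ t₀ ht₀ε) hz hzero N)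
    t₀ ⟨ht₀ε, ht₀⟩
  have h1 : (∮ s in C(0, ρ), (s - z)⁻¹ * (g₁ (t₀ • w s) / g₀ (t₀ • w s) * g₀ (t₀ • w s)))
      = ∮ s in C(0, ρ), (s - z)⁻¹ • g₁ (t₀ • w s) := by
    refine circleIntegral.integral_congr hρ.le fun s hs => ?_
    rw [smul_eq_mul, div_mul_cancel₀ _ (hgne t₀ ⟨ht₀ε, ht₀⟩ s hs)]
  rw [h1, (hdiff g₁ hg₁ t₀ ht₀ε).circleIntegral_sub_inv_smul hz, smul_eq_zero] at h0
  refine h0.resolve_left ?_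
  simp [Real.pi_ne_zero]

/-- A germ whose initial form vanishes at the centre of a disc, but not on its boundary, has a zero
on each small multiple of the disc. -/
theorem exists_zero_smul_disc {φ : MvPowerSeries (Fin n) ℂ} {g : (Fin n → ℂ) → ℂ}
    (h : HasTaylor g φ) {D : ℕ} {Λ : MvPolynomial (Fin n) ℂ} (hΛ : HasInit φ D Λ)
    {w : ℂ → Fin n → ℂ} (hw : Differentiable ℂ w) {ρ : ℝ} (hρ : 0 < ρ)
    (hΛ0 : MvPolynomial.eval (w 0) Λ = 0)
    (hΛne : ∀ s ∈ Metric.sphere (0 : ℂ) ρ, MvPolynomial.eval (w s) Λ ≠ 0) :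
    ∀ᶠ t in 𝓝[≠] (0 : ℂ), ∃ z ∈ Metric.ball (0 : ℂ) ρ, g (t • w z) = 0 := by
  have hSc : IsCompact (w '' Metric.sphere 0 ρ) := (isCompact_sphere _ _).image hw.continuous
  have hSd : IsCompact (w '' Metric.closedBall 0 ρ) :=
    (isCompact_closedBall _ _).image hw.continuous
  obtain ⟨m, hm0, hm⟩ := exists_lower_bound_smul h hΛ hSc
    (by rintro _ ⟨s, hs, rfl⟩; exact hΛne s hs)
  obtain ⟨B, hB0, hB⟩ := exists_bound_smul (hΛ.isBigO h) (Bornology.isBounded_singleton (x := w 0))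
  obtain ⟨r, hr, hg⟩ := exists_analyticOnNhd_ball h.1
  have hsmall : ∀ᶠ t in 𝓝 (0 : ℂ), B * ‖t‖ < m := by
    have h : Continuous fun t : ℂ => B * ‖t‖ := by fun_prop
    have : Tendsto (fun t : ℂ => B * ‖t‖) (𝓝 0) (𝓝 0) := by simpa using h.tendsto 0
    exact this.eventually_lt_const hm0
  filter_upwards [self_mem_nhdsWithin, nhdsWithin_le_nhds hB, nhdsWithin_le_nhds hm,
    nhdsWithin_le_nhds hsmall, nhdsWithin_le_nhds (eventually_smul_mem_ball hSd.isBounded hr)]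
    with t ht hBt hmt hst htr
  have ht0 : 0 < ‖t‖ := norm_pos_iff.2 ht
  have hpos : 0 < m * ‖t‖ ^ D := by positivity
  -- Without zeros, the maximum principle for 1/g bounds |g| at the centre below by m|t|ᴰ. But the
  -- initial form vanishes there, so |g| ≤ B|t|ᴰ⁺¹ with B|t| < m.
  by_contra! hcon
  have hne : ∀ s ∈ Metric.closedBall (0 : ℂ) ρ, g (t • w s) ≠ 0 := by
    intro s hs
    rcases (Metric.mem_closedBall.1 hs).lt_or_eq with h1 | h1
    · exact hcon s h1
    · intro h2
      have := hmt _ ⟨s, h1, rfl⟩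
      rw [h2, norm_zero] at this
      exact absurd this (not_le.2 hpos)
  have hd : DifferentiableOn ℂ (fun s => (g (t • w s))⁻¹) (Metric.closedBall 0 ρ) := by
    refine DifferentiableOn.inv (fun s hs => ?_) hne
    exact ((hg _ (htr _ ⟨s, hs, rfl⟩)).differentiableAt.comp s
      ((hw s).const_smul t)).differentiableWithinAt
  have hmax := Complex.norm_le_of_forall_mem_frontier_norm_le (U := Metric.ball (0 : ℂ) ρ)
    (f := fun s => (g (t • w s))⁻¹) (C := (m * ‖t‖ ^ D)⁻¹) (z := 0) Metric.isBounded_ball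
    (hd.diffContOnCl_ball subset_rfl) (by
      intro s hs
      rw [frontier_ball _ hρ.ne'] at hs
      rw [norm_inv]
      exact inv_anti₀ hpos (hmt _ ⟨s, hs, rfl⟩))
    (subset_closure (Metric.mem_ball_self hρ))
  rw [norm_inv] at hmax
  have h5 := (inv_le_inv₀ (norm_pos_iff.2 (hne 0 (Metric.mem_closedBall_self hρ.le))) hpos).1 hmax
  have h6 := hBt (w 0) rfl
  rw [eval_smul_of_isHomogeneous hΛ.1, hΛ0, mul_zero, sub_zero, pow_succ] at h6
  have h7 : B * (‖t‖ ^ D * ‖t‖) < m * ‖t‖ ^ D := by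
    have := mul_lt_mul_of_pos_right hst (show 0 < ‖t‖ ^ D by positivity)
    linarith
  linarith

end CommonZeros

/-! ### The case of a nontrivial formal common factor. -/

section DivisorCase

open MvPowerSeries Asymptotics

variable {n q : ℕ}

/-- The restriction of a polynomial to the line `b + s v`. -/
noncomputable def restrictLine (L : MvPolynomial (Fin n) ℂ) (b v : Fin n → ℂ) : Polynomial ℂ :=
  MvPolynomial.aeval (fun i => Polynomial.C (b i) + Polynomial.X * Polynomial.C (v i)) L

theorem eval_restrictLine (L : MvPolynomial (Fin n) ℂ) (b v : Fin n → ℂ) (s : ℂ) :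
    (restrictLine L b v).eval s = MvPolynomial.eval (b + s • v) L := by
  rw [restrictLine, ← Polynomial.coe_evalRingHom, MvPolynomial.aeval_def, MvPolynomial.hom_eval₂,
    MvPolynomial.eval, MvPolynomial.coe_eval₂Hom]
  congr 1
  · ext x
    simp
  · ext i
    simp
    ring

/-- The coefficient of sᵉ in L(b + s v) is L(v). In the proof this appears as the limit of L(v + r
b) for r → 0, with s = 1/r. -/
theorem restrictLine_ne_C {L : MvPolynomial (Fin n) ℂ} {e : ℕ} (hL : L.IsHomogeneous e)
    (he : e ≠ 0) {v : Fin n → ℂ} (hv : MvPolynomial.eval v L ≠ 0) (b : Fin n → ℂ) (a : ℂ) :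
    restrictLine L b v ≠ Polynomial.C a := by
  intro h
  have h1 : ∀ r : ℂ, r ≠ 0 → MvPolynomial.eval (v + r • b) L = r ^ e * a := by
    intro r hr
    have e1 : v + r • b = r • (b + r⁻¹ • v) := by
      rw [smul_add, smul_smul, mul_inv_cancel₀ hr, one_smul, add_comm]
    rw [e1, eval_smul_of_isHomogeneous hL, ← eval_restrictLine, h, Polynomial.eval_C]
  have hc : Continuous fun r : ℂ => MvPolynomial.eval (v + r • b) L := by
    simp only [← eval_restrictLine]
    exact Polynomial.continuous _
  have h2 : Tendsto (fun r : ℂ => MvPolynomial.eval (v + r • b) L) (𝓝[≠] 0)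
      (𝓝 (MvPolynomial.eval v L)) := by
    have := (hc.tendsto 0).mono_left (nhdsWithin_le_nhds (s := {0}ᶜ))
    simpa using this
  have h3 : Tendsto (fun r : ℂ => MvPolynomial.eval (v + r • b) L) (𝓝[≠] 0) (𝓝 0) := by
    have hc' : Continuous fun r : ℂ => r ^ e * a := by fun_prop
    have := (hc'.tendsto 0).mono_left (nhdsWithin_le_nhds (s := {0}ᶜ))
    rw [zero_pow he, zero_mul] at this
    refine this.congr' ?_
    filter_upwards [self_mem_nhdsWithin] with r hr using (h1 r hr).symm
  exact hv (tendsto_nhds_unique h2 h3)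

theorem eventually_eval_line_ne_zero {L : MvPolynomial (Fin n) ℂ} {e : ℕ} (hL : L.IsHomogeneous e)
    (he : e ≠ 0) {v : Fin n → ℂ} (hv : MvPolynomial.eval v L ≠ 0) (b : Fin n → ℂ) :
    ∀ᶠ s in 𝓝[≠] (0 : ℂ), MvPolynomial.eval (b + s • v) L ≠ 0 := by
  have hne : restrictLine L b v ≠ 0 := by
    simpa using restrictLine_ne_C hL he hv b 0
  have hfin : ((restrictLine L b v).roots.toFinset.erase 0 : Set ℂ).Finite := Finset.finite_toSet _
  have hmem : ((restrictLine L b v).roots.toFinset.erase 0 : Set ℂ)ᶜ ∈ 𝓝 (0 : ℂ) :=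
    hfin.isClosed.isOpen_compl.mem_nhds (by simp)
  filter_upwards [self_mem_nhdsWithin, nhdsWithin_le_nhds hmem] with s hs hs' h
  refine hs' ?_
  rw [← eval_restrictLine] at h
  simpa [hne, Polynomial.IsRoot] using And.intro h hs

/-- A homogeneous polynomial of positive degree vanishes at a point with at most one zero
coordinate. -/
theorem exists_eval_eq_zero_of_isHomogeneous {L : MvPolynomial (Fin n) ℂ} {e : ℕ}
    (hL : L.IsHomogeneous e) (he : e ≠ 0) (hL0 : L ≠ 0) :
    ∃ p v : Fin n → ℂ, MvPolynomial.eval p L = 0 ∧ MvPolynomial.eval v L ≠ 0 ∧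
      ∀ i j, p i = 0 → p j = 0 → i = j := by
  obtain ⟨v, hv⟩ : ∃ v, MvPolynomial.eval v (L * ∏ i, MvPolynomial.X i) ≠ 0 := by
    by_contra! hcon
    have h0 : L * ∏ i, MvPolynomial.X i = 0 := MvPolynomial.funext fun x => by simpa using hcon x
    rcases mul_eq_zero.1 h0 with h | h
    · exact hL0 h
    · obtain ⟨i, _, hi⟩ := Finset.prod_eq_zero_iff.1 h
      exact MvPolynomial.X_ne_zero i hi
  rw [map_mul, map_prod] at hv
  have hv1 := left_ne_zero_of_mul hv
  have hv2 : ∀ i, v i ≠ 0 := by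
    intro i
    simpa using Finset.prod_ne_zero_iff.1 (right_ne_zero_of_mul hv) i (Finset.mem_univ i)
  -- The base point has coordinates i·vᵢ, so the i-th coordinate on the line is (i + s) vᵢ. With all
  -- vᵢ nonzero, at most one coordinate vanishes for a given s.
  obtain ⟨s, hs⟩ := IsAlgClosed.exists_root (restrictLine L (fun i => (i : ℕ) * v i) v) (by
    intro hdeg
    exact restrictLine_ne_C hL he hv1 _ _ (Polynomial.eq_C_of_degree_eq_zero hdeg))
  refine ⟨_, v, (eval_restrictLine L _ v s).symm.trans hs, hv1, ?_⟩
  intro i j hi hj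
  have h1 : ∀ i : Fin n, ((i : ℕ) : ℂ) * v i + s * v i = 0 → ((i : ℕ) : ℂ) = -s := by
    intro i h
    rw [← add_mul] at h
    exact eq_neg_of_add_eq_zero_left ((mul_eq_zero.1 h).resolve_right (hv2 i))
  have := (h1 i hi).trans (h1 j hj).symm
  exact Fin.ext (by exact_mod_cast this)

theorem coeffDet_eq_one {c : Fin q → Fin n → ℂ} {I : Fin q → Fin n}
    (h : ∀ k l, c k (I l) = if k = l then 1 else 0) : coeffDet c I = 1 := by
  rw [coeffDet, ← Matrix.det_one (n := Fin q)]
  congr 1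
  ext a k
  simp [h, Matrix.one_apply, eq_comm]

/-- If p has a zero coordinate with index in the support, a K containing that index removes it from
the monomial; otherwise any nonzero minor serves. -/
theorem exists_normalCoeff_ne_zero {c : Fin q → Fin n → ℂ} {I : Fin q → Fin n}
    (hI : coeffDet c I ≠ 0) {p : Fin n → ℂ} (hp : ∀ i j, p i = 0 → p j = 0 → i = j) :
    ∃ K, MvPolynomial.eval p (MvPolynomial.C (coeffDet c K) *
      ∏ i ∈ coeffSupport c \ Finset.univ.image K, MvPolynomial.X i) ≠ 0 := by
  obtain ⟨K, hK, hKp⟩ : ∃ K, coeffDet c K ≠ 0 ∧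
      ∀ i ∈ coeffSupport c \ Finset.univ.image K, p i ≠ 0 := by
    by_cases h : ∃ j ∈ coeffSupport c, p j = 0
    · obtain ⟨j, hj, hpj⟩ := h
      obtain ⟨K, hK, a, rfl⟩ := mem_coeffSupport.1 hj
      refine ⟨K, hK, fun i hi hpi => ?_⟩
      rw [hp i (K a) hpi hpj] at hi
      exact (Finset.mem_sdiff.1 hi).2 (Finset.mem_image_of_mem _ (Finset.mem_univ a))
    · push Not at h
      exact ⟨I, hI, fun i hi => h i (Finset.mem_sdiff.1 hi).1⟩
  refine ⟨K, ?_⟩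
  rw [map_mul, MvPolynomial.eval_C, map_prod]
  refine mul_ne_zero hK (Finset.prod_ne_zero_iff.2 fun i hi => ?_)
  rw [MvPolynomial.eval_X]
  exact hKp i hi

theorem HasInit.ne_zero_of_constantCoeff_eq_zero {f : MvPowerSeries (Fin n) ℂ} {e : ℕ}
    {L : MvPolynomial (Fin n) ℂ} (h : HasInit f e L) (hL : L ≠ 0) (hf : constantCoeff f = 0) :
    e ≠ 0 := by
  rintro rfl
  have h1 := h.1
  rw [← MvPolynomial.totalDegree_zero_iff_isHomogeneous, MvPolynomial.totalDegree_eq_zero_iff_eq_C]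
    at h1
  have h2 : constantCoeff (f - (L : MvPowerSeries (Fin n) ℂ)) = 0 := by
    rw [← coeff_zero_eq_constantCoeff_apply]
    refine coeff_of_lt_order (lt_of_lt_of_le ?_ h.2)
    simp
  rw [map_sub, hf, zero_sub, neg_eq_zero] at h2
  rw [h1] at h2
  simp at h2
  exact hL (by rw [h1, h2, map_zero])

/-- If the components of `ω` have a formal common factor, then `ω` has zeros that accumulate at the
origin. -/
theorem frequently_eq_zero_of_constantCoeff_eq_zero (hn : 2 ≤ n)
    {ω : (Fin n → ℂ) → (Fin n → ℂ) [⋀^Fin q]→L[ℂ] ℂ}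
    {Ω : (Fin n → MvPowerSeries (Fin n) ℂ) [⋀^Fin q]→ₗ[MvPowerSeries (Fin n) ℂ]
      MvPowerSeries (Fin n) ℂ} (hΩ : HasTaylorForm ω Ω)
    {y : Fin n → MvPowerSeries (Fin n) ℂ} (hy : ∀ i, (2 : ℕ∞) ≤ (y i - X i).order)
    {c : Fin q → Fin n → ℂ} {I : Fin q → Fin n} (hI : coeffDet c I ≠ 0)
    {f : MvPowerSeries (Fin n) ℂ} (hf : f ≠ 0) (hf0 : constantCoeff f = 0)
    (hfac : ∀ K : Fin q → Fin n, Ω (fun a => Pi.single (K a) 1) = f * normalCoeff y c K) :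
    ∃ᶠ x in 𝓝[≠] 0, ω x = 0 := by
  obtain ⟨e, L, hL0, hL⟩ := exists_hasInit hf
  have he := hL.ne_zero_of_constantCoeff_eq_zero hL0 hf0
  obtain ⟨p, v, hp, hv, hpz⟩ := exists_eval_eq_zero_of_isHomogeneous hL.1 he hL0
  obtain ⟨K₀, hK₀⟩ := exists_normalCoeff_ne_zero hI hpz
  have hτ := hasInit_normalCoeff hy c K₀
  set τ := MvPolynomial.C (coeffDet c K₀) *
    ∏ i ∈ coeffSupport c \ Finset.univ.image K₀, MvPolynomial.X i with hτdef
  have hp0 : p ≠ 0 := by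
    rintro rfl
    have := hpz ⟨0, by omega⟩ ⟨1, by omega⟩ rfl rfl
    simp at this
  have hw : Differentiable ℂ fun s : ℂ => p + s • v := by fun_prop
  have hwp : p + (0 : ℂ) • v = p := by simp
  -- At the centre p the initial form L of f vanishes and that of the cofactor does not. On a small
  -- disc in the direction v the centre is the only zero of L, and τ has none.
  have hnear : ∀ᶠ s in 𝓝 (0 : ℂ), MvPolynomial.eval (p + s • v) τ ≠ 0 ∧ p + s • v ≠ 0 ∧
      (s ≠ 0 → MvPolynomial.eval (p + s • v) L ≠ 0) := by
    refine Filter.Eventually.and ?_ (Filter.Eventually.and ?_ ?_)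
    · have hc : Continuous fun s : ℂ => MvPolynomial.eval (p + s • v) τ := by
        simp only [← eval_restrictLine]
        exact Polynomial.continuous _
      exact hc.continuousAt.eventually_ne (by rwa [hwp])
    · exact hw.continuous.continuousAt.eventually_ne (by rwa [hwp])
    · exact eventually_nhdsWithin_iff.1 (eventually_eval_line_ne_zero hL.1 he hv p)
  obtain ⟨ρ, hρ, hball⟩ := Metric.nhds_basis_closedBall.eventually_iff.1 hnear
  have hΛ := hL.mul hτ
  have hΛne : ∀ s ∈ Metric.sphere (0 : ℂ) ρ, MvPolynomial.eval (p + s • v) (L * τ) ≠ 0 := by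
    intro s hs
    have h := hball (Metric.sphere_subset_closedBall hs)
    rw [map_mul]
    refine mul_ne_zero (h.2.2 ?_) h.1
    rintro rfl
    rw [Metric.mem_sphere, dist_self] at hs
    exact hρ.ne hs
  have hT : ∀ K, HasTaylor (fun x => ω x fun a => Pi.single (K a) 1) (f * normalCoeff y c K) :=
    fun K => by rw [← hfac K]; exact hΩ K
  have hzero := exists_zero_smul_disc (hT K₀) hΛ hw hρ
    (by rw [hwp, map_mul, hp, zero_mul]) hΛne
  have hall : ∀ᶠ t in 𝓝[≠] (0 : ℂ), ∀ K : Fin q → Fin n, ∀ z ∈ Metric.ball (0 : ℂ) ρ,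
      (ω (t • (p + z • v)) fun a => Pi.single (K₀ a) 1) = 0 →
      (ω (t • (p + z • v)) fun a => Pi.single (K a) 1) = 0 :=
    eventually_all.2 fun K => eq_zero_of_common_formal_factor (hT K₀) (hT K) hΛ hτ hw hρ hΛne
      fun s hs => (hball hs).1
  have hSd : IsCompact ((fun s : ℂ => p + s • v) '' Metric.closedBall 0 ρ) :=
    (isCompact_closedBall _ _).image hw.continuous
  rw [Filter.Frequently, eventually_nhdsWithin_iff]
  intro hcon
  obtain ⟨r, hr, hrball⟩ := Metric.eventually_nhds_iff_ball.1 hcon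
  have hmem' := (eventually_smul_mem_ball hSd.isBounded hr).filter_mono
    (nhdsWithin_le_nhds (s := {0}ᶜ))
  obtain ⟨t, ⟨z, hz, hgz⟩, hK, hmem, ht⟩ := (hzero.and (hall.and (hmem'.and
    (eventually_mem_nhdsWithin (s := {0}ᶜ))))).exists
  have hz' := Metric.ball_subset_closedBall hz
  exact hrball (t • (p + z • v)) (hmem _ ⟨z, hz', rfl⟩) (smul_ne_zero ht (hball hz').2.1)
    (form_eq_zero_of_basis fun K => hK K z hz hgz)

end DivisorCase

/-! ### Division by powers of the scaling parameter. -/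

section Hadamard

open Asymptotics

variable {E : Type} [NormedAddCommGroup E] [NormedSpace ℂ E]

/-- Splitting one argument off each term of positive degree gives f(x) = h(x) x; the series of h is
the shift of p. -/
theorem HasFPowerSeriesAt.exists_eq_clm_apply {F : Type} [NormedAddCommGroup F] [NormedSpace ℂ F]
    [CompleteSpace F] {f : E → F} {p : FormalMultilinearSeries ℂ E F}
    (hf : HasFPowerSeriesAt f p 0) (hp : p 0 = 0) :
    ∃ h : E → E →L[ℂ] F, HasFPowerSeriesAt h p.shift 0 ∧ ∀ᶠ x in 𝓝 0, f x = h x x := by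
  have hrad : 0 < p.shift.radius := by
    rw [FormalMultilinearSeries.radius_shift]
    exact hf.radius_pos
  have hs := p.shift.hasFPowerSeriesOnBall hrad
  refine ⟨p.shift.sum, hs.hasFPowerSeriesAt, ?_⟩
  obtain ⟨r, hr⟩ := hf
  filter_upwards [Metric.eball_mem_nhds (0 : E) hr.r_pos, Metric.eball_mem_nhds (0 : E) hs.r_pos]
    with x hx hx'
  have h1 := hr.hasSum hx
  have h2 := (hs.hasSum hx').mapL (ContinuousLinearMap.apply ℂ F x)
  rw [zero_add] at h1 h2
  have h3 := (hasSum_nat_add_iff' 1).2 h1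
  simp only [Finset.range_one, Finset.sum_singleton, hp, zero_apply, sub_zero] at h3
  refine h3.unique ?_
  rw [ContinuousLinearMap.apply_apply] at h2
  convert h2 using 2 with m
  simp only [FormalMultilinearSeries.shift, ContinuousLinearMap.apply_apply]
  rw [ContinuousMultilinearMap.curryRight_apply]
  congr 1
  ext i
  refine Fin.lastCases ?_ (fun i => ?_) i <;> simp

/-- Each use of f(x) = h(x) x at x = t w takes out one factor t and replaces the target F by the
space of linear maps into F. The induction therefore runs over all targets. -/
theorem HasFPowerSeriesAt.exists_smul_pow_eq (k : ℕ) :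
    ∀ {F : Type} [NormedAddCommGroup F] [NormedSpace ℂ F] [CompleteSpace F] {f : E → F}
      {p : FormalMultilinearSeries ℂ E F}, HasFPowerSeriesAt f p 0 → (∀ j < k, p j = 0) →
      ∃ G : ℂ × E → F, ∀ w, AnalyticAt ℂ G (0, w) ∧
        ∀ᶠ u in 𝓝 ((0 : ℂ), w), f (u.1 • u.2) = u.1 ^ k • G u := by
  have htend : ∀ w : E, Tendsto (fun u : ℂ × E => u.1 • u.2) (𝓝 (0, w)) (𝓝 0) := by
    intro w
    have : Continuous fun u : ℂ × E => u.1 • u.2 := by fun_prop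
    simpa using this.tendsto (0, w)
  induction k with
  | zero =>
    intro F _ _ _ f p hf _
    refine ⟨fun u => f (u.1 • u.2), fun w => ⟨?_, by simp⟩⟩
    refine AnalyticAt.fun_comp (g := f) ?_ (analyticAt_fst.smul analyticAt_snd)
    simpa using hf.analyticAt
  | succ k ih =>
    intro F _ _ _ f p hf hp
    obtain ⟨h, hh, hfh⟩ := hf.exists_eq_clm_apply (hp 0 k.succ_pos)
    obtain ⟨G, hG⟩ := ih hh (fun j hj => by
      rw [FormalMultilinearSeries.shift, hp _ (Nat.succ_lt_succ hj)]
      ext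
      simp)
    refine ⟨fun u => G u u.2, fun w => ⟨?_, ?_⟩⟩
    · exact AnalyticAt.comp₂ ((ContinuousLinearMap.apply ℂ F).flip.analyticAt_bilinear (G (0, w), w))
        (hG w).1 analyticAt_snd
    filter_upwards [(hG w).2, (htend w).eventually hfh] with u h1 h2
    rw [h2, h1, map_smul, smul_apply, smul_smul, pow_succ, mul_comm]

theorem HasFPowerSeriesAt.apply_eq_zero_of_isBigO {F : Type} [NormedAddCommGroup F]
    [NormedSpace ℂ F] {f : E → F} {p : FormalMultilinearSeries ℂ E F}
    (hf : HasFPowerSeriesAt f p 0) {k : ℕ} (hO : f =O[𝓝 0] fun x => ‖x‖ ^ k) :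
    ∀ j < k, ∀ y : E, p j (fun _ => y) = 0 := by
  intro j
  induction j using Nat.strong_induction_on with
  | _ j ih =>
    intro hj
    refine IsBigO.continuousMultilinearMap_apply_eq_zero ?_
    have h1 := hf.isBigO_sub_partialSum_pow (j + 1)
    simp only [zero_add] at h1
    have h2 : f =O[𝓝 0] fun x => ‖x‖ ^ (j + 1) := by
      refine hO.trans (IsBigO.of_bound 1 ?_)
      filter_upwards [Metric.ball_mem_nhds (0 : E) one_pos] with x hx
      rw [mem_ball_zero_iff] at hx
      simpa using pow_le_pow_of_le_one (norm_nonneg x) hx.le hj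
    refine (h2.sub h1).congr_left fun y => ?_
    rw [sub_sub_cancel, FormalMultilinearSeries.partialSum, Finset.sum_range_succ,
      Finset.sum_eq_zero, zero_add]
    intro i hi
    have hi' := Finset.mem_range.1 hi
    exact ih i hi' (hi'.trans hj) y

/-- A germ of order at least `k` is `tᵏ` times an analytic function in the variables `(t, w)` with
`x = t w`. -/
theorem AnalyticAt.exists_smul_pow_eq {F : Type} [NormedAddCommGroup F] [NormedSpace ℂ F]
    [CompleteSpace F] {f : E → F} (hf : AnalyticAt ℂ f 0) {k : ℕ}
    (hO : f =O[𝓝 0] fun x => ‖x‖ ^ k) :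
    ∃ G : ℂ × E → F, ∀ w, AnalyticAt ℂ G (0, w) ∧
      ∀ᶠ u in 𝓝 ((0 : ℂ), w), f (u.1 • u.2) = u.1 ^ k • G u := by
  obtain ⟨p, hp⟩ := hf
  -- The growth bound kills the low terms of p only on the diagonal, not as multilinear maps. They
  -- form a series `T` of the zero function, which is subtracted.
  let T : FormalMultilinearSeries ℂ E F := fun j => if j < k then p j else 0
  have hz := hp.apply_eq_zero_of_isBigO hO
  have hT0 : ∀ j (y : E), T j (fun _ => y) = 0 := by
    intro j y
    simp only [T]
    split_ifs with h
    · exact hz j h y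
    · rfl
  have hTr : T.radius = ⊤ := T.radius_eq_top_of_forall_image_add_eq_zero k fun m => by simp [T]
  have hT : HasFPowerSeriesAt (fun _ : E => (0 : F)) T 0 := by
    have h1 := (T.hasFPowerSeriesOnBall (by rw [hTr]; exact ENNReal.zero_lt_top)).hasFPowerSeriesAt
    have h2 : T.sum = fun _ => 0 := by
      ext y
      rw [FormalMultilinearSeries.sum]
      simp [hT0]
    rwa [h2] at h1
  refine HasFPowerSeriesAt.exists_smul_pow_eq k (p := p - T) ?_ ?_
  · have h0 : (f - fun _ => 0) = f := sub_zero f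
    exact h0 ▸ hp.sub hT
  · intro j hj
    change p j - T j = 0
    simp [T, hj]

end Hadamard

/-! ### Analytic curves of common zeros. -/

section ImplicitCurve

open MvPowerSeries Asymptotics
open scoped ContDiff

variable {n : ℕ}

/-- The chart x = t w of the blow-up of the origin: the quotient of g(t w) by tᵈ is analytic across
t = 0 and restricts there to the initial form. -/
theorem HasTaylor.exists_blowup {g : (Fin n → ℂ) → ℂ} {φ : MvPowerSeries (Fin n) ℂ}
    (hg : HasTaylor g φ) {d : ℕ} {L : MvPolynomial (Fin n) ℂ} (hL : HasInit φ d L) :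
    ∃ G : ℂ × (Fin n → ℂ) → ℂ, ∀ w, AnalyticAt ℂ G (0, w) ∧ G (0, w) = MvPolynomial.eval w L ∧
      ∀ᶠ u in 𝓝 ((0 : ℂ), w), g (u.1 • u.2) = u.1 ^ d * G u := by
  obtain ⟨G, hG⟩ := hg.1.exists_smul_pow_eq (hg.isBigO_of_le_order hL.le_order)
  refine ⟨G, fun w => ⟨(hG w).1, ?_, (hG w).2⟩⟩
  have hcont : Continuous fun t : ℂ => (t, w) := by fun_prop
  have h1 : Tendsto (fun t : ℂ => G (t, w)) (𝓝[≠] 0) (𝓝 (G (0, w))) :=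
    ((hG w).1.continuousAt.tendsto.comp (hcont.tendsto 0)).mono_left nhdsWithin_le_nhds
  refine tendsto_nhds_unique h1 ?_
  obtain ⟨B, hB0, hB⟩ := exists_bound_smul (hL.isBigO hg) (Bornology.isBounded_singleton (x := w))
  have h2 : ∀ᶠ t in 𝓝[≠] (0 : ℂ), ‖G (t, w) - MvPolynomial.eval w L‖ ≤ B * ‖t‖ := by
    filter_upwards [self_mem_nhdsWithin, nhdsWithin_le_nhds hB,
      nhdsWithin_le_nhds ((hcont.tendsto 0).eventually (hG w).2)] with t ht hBt hGt
    have h3 := hBt w rfl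
    rw [hGt, eval_smul_of_isHomogeneous hL.1, smul_eq_mul, ← mul_sub, norm_mul, norm_pow,
      pow_succ, mul_left_comm] at h3
    exact le_of_mul_le_mul_left h3 (pow_pos (norm_pos_iff.2 ht) d)
  rw [tendsto_iff_norm_sub_tendsto_zero]
  have h4 : Tendsto (fun t : ℂ => B * ‖t‖) (𝓝[≠] 0) (𝓝 0) := by
    have h : Continuous fun t : ℂ => B * ‖t‖ := by fun_prop
    have := (h.tendsto 0).mono_left (nhdsWithin_le_nhds (s := {0}ᶜ))
    simpa using this
  exact squeeze_zero' (Eventually.of_forall fun t => norm_nonneg _) h2 h4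

/-- If the initial forms of the germs `g j` are independent linear functions along the affine
subspace `p + ι z`, then there is an analytic curve of common zeros that is asymptotic to the
line spanned by `p`. -/
theorem exists_analytic_curve_of_hasInit {κ : Type} [Fintype κ] {g : κ → (Fin n → ℂ) → ℂ}
    {φ : κ → MvPowerSeries (Fin n) ℂ} (hg : ∀ j, HasTaylor (g j) (φ j)) {d : ℕ}
    {L : κ → MvPolynomial (Fin n) ℂ} (hL : ∀ j, HasInit (φ j) d (L j)) {p : Fin n → ℂ}
    (ι : (κ → ℂ) →L[ℂ] (Fin n → ℂ)) {a : κ → ℂ} (ha : ∀ j, a j ≠ 0)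
    (hLa : ∀ j z, MvPolynomial.eval (p + ι z) (L j) = a j * z j) :
    ∃ z : ℂ → κ → ℂ, AnalyticAt ℂ z 0 ∧ z 0 = 0 ∧
      ∀ᶠ t in 𝓝 (0 : ℂ), ∀ j, g j (t • (p + ι (z t))) = 0 := by
  classical
  choose G hG using fun j => (hg j).exists_blowup (hL j)
  let m : ℂ × (κ → ℂ) → ℂ × (Fin n → ℂ) := fun u => (u.1, p + ι u.2)
  have hm : AnalyticAt ℂ m (0, 0) :=
    analyticAt_fst.prod (analyticAt_const.add ((ι.analyticAt _).fun_comp analyticAt_snd))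
  have hm0 : m (0, 0) = (0, p) := by simp [m]
  let Φ : ℂ × (κ → ℂ) → κ → ℂ := fun u j => G j (m u)
  have hΦ : AnalyticAt ℂ Φ (0, 0) := by
    refine AnalyticAt.pi fun j => AnalyticAt.fun_comp (g := G j) ?_ hm
    rw [hm0]
    exact (hG j p).1
  have hΦ0 : ∀ z, Φ (0, z) = fun j => a j * z j := by
    intro z
    ext j
    rw [← hLa, ← (hG j (p + ι z)).2.1]
  have cdf : ContDiffAt ℂ ω Φ (0, 0) := hΦ.contDiffAt
  let A : (κ → ℂ) ≃L[ℂ] (κ → ℂ) := ContinuousLinearEquiv.piCongrRight fun j =>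
    ContinuousLinearEquiv.unitsEquivAut ℂ (Units.mk0 (a j) (ha j))
  have hA : ∀ z, A z = fun j => a j * z j := by
    intro z
    ext j
    simp [A, mul_comm]
  -- On t = 0 the map is exactly the diagonal linear map z ↦ (aⱼ zⱼ), so its partial derivative in z
  -- is invertible.
  have hcomp : fderiv ℂ Φ (0, 0) ∘L ContinuousLinearMap.inr ℂ ℂ (κ → ℂ) = A := by
    have h1 : HasFDerivAt (fun z : κ → ℂ => Φ (0, z))
        (fderiv ℂ Φ (0, 0) ∘L ContinuousLinearMap.inr ℂ ℂ (κ → ℂ)) 0 :=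
      HasFDerivAt.comp (g := Φ) (0 : κ → ℂ) hΦ.differentiableAt.hasFDerivAt
        (hasFDerivAt_prodMk_right (0 : ℂ) (0 : κ → ℂ))
    have h2 : (fun z : κ → ℂ => Φ (0, z)) = A := by
      ext1 z
      rw [hΦ0, hA]
    rw [h2] at h1
    exact h1.unique A.hasFDerivAt
  have hinv : (fderiv ℂ Φ (0, 0) ∘L ContinuousLinearMap.inr ℂ ℂ (κ → ℂ)).IsInvertible :=
    ⟨A, hcomp.symm⟩
  have hω : (ω : WithTop ℕ∞) ≠ 0 := by simp
  refine ⟨cdf.implicitFunction hω hinv, (cdf.contDiffAt_implicitFunction hω hinv).analyticAt,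
    cdf.implicitFunction_apply_self hω hinv, ?_⟩
  have hev := cdf.eventually_apply_implicitFunction hω hinv
  have hz := (cdf.contDiffAt_implicitFunction hω hinv).continuousAt
  have hz0 := cdf.implicitFunction_apply_self hω hinv
  set z := cdf.implicitFunction hω hinv
  simp only at hz hz0 hev
  have htend : Tendsto (fun t : ℂ => (t, p + ι (z t))) (𝓝 0) (𝓝 (0, p)) := by
    have h1 : ContinuousAt (fun t : ℂ => (t, p + ι (z t))) 0 :=
      continuousAt_id.prodMk (continuousAt_const.add (ι.continuous.continuousAt.comp hz))
    have h2 := h1.tendsto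
    simpa [hz0] using h2
  filter_upwards [hev, eventually_all.2 fun j => htend.eventually (hG j p).2.2] with t h1 h2 j
  have h3 : G j (t, p + ι (z t)) = 0 := by
    have := congrFun h1 j
    rw [hΦ0] at this
    simpa [Φ, m] using this
  rw [h2 j, h3, mul_zero]

/-- A germ that is, after multiplication by a formal series `δ`, a formal combination of germs that
vanish along an analytic curve, vanishes along this curve, if the initial form of `δ` does not
vanish at the tangent vector of the curve. -/
theorem eventually_eq_zero_on_curve {κ : Type} [Fintype κ] {g : κ → (Fin n → ℂ) → ℂ}
    {φ : κ → MvPowerSeries (Fin n) ℂ} (hg : ∀ j, HasTaylor (g j) (φ j))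
    {h : (Fin n → ℂ) → ℂ} {ψ : MvPowerSeries (Fin n) ℂ} (hh : HasTaylor h ψ)
    {δ : MvPowerSeries (Fin n) ℂ} {B : κ → MvPowerSeries (Fin n) ℂ}
    (hδ : δ * ψ = ∑ j, B j * φ j) {M : ℕ} {Λ : MvPolynomial (Fin n) ℂ} (hΛ : HasInit δ M Λ)
    {w : ℂ → Fin n → ℂ} (hw : AnalyticAt ℂ w 0) (hΛ0 : MvPolynomial.eval (w 0) Λ ≠ 0)
    (hzero : ∀ᶠ t in 𝓝 (0 : ℂ), ∀ j, g j (t • w t) = 0) :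
    ∀ᶠ t in 𝓝 (0 : ℂ), h (t • w t) = 0 := by
  have hx0 : AnalyticAt ℂ (fun t : ℂ => t • w t) 0 := analyticAt_id.smul hw
  have hcomp : AnalyticAt ℂ (fun t : ℂ => h (t • w t)) 0 := by
    refine AnalyticAt.fun_comp (g := h) ?_ hx0
    rw [zero_smul]
    exact hh.1
  refine eventually_eq_zero_of_forall_isBigO (f := fun t : ℂ => h (t • w t)) hcomp fun N => ?_
  -- Formal identities cannot be evaluated on the curve, but truncations can: D·h differs from a
  -- combination of the g j by O(tᴺ⁺ᴹ), and D is at least of size tᴹ there. Hence h is flat along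
  -- the curve.
  obtain ⟨D, hD⟩ := exists_polynomial_approx δ (N + M + 1)
  choose P hP using fun j => exists_polynomial_approx (B j) (N + M + 1)
  have hT : HasTaylor (fun x => MvPolynomial.eval x D * h x - ∑ j, MvPolynomial.eval x (P j) * g j x)
      (D * ψ - ∑ j, P j * φ j) :=
    ((hasTaylor_eval D).mul hh).sub (HasTaylor.sum fun j _ => (hasTaylor_eval (P j)).mul (hg j))
  have hord : ((N + M : ℕ) : ℕ∞) ≤ ((D : MvPowerSeries (Fin n) ℂ) * ψ
      - ∑ j, (P j : MvPowerSeries (Fin n) ℂ) * φ j).order := by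
    have e : (D : MvPowerSeries (Fin n) ℂ) * ψ - ∑ j, (P j : MvPowerSeries (Fin n) ℂ) * φ j
        = (∑ j, (B j - P j) * φ j) - (δ - D) * ψ := by
      simp only [sub_mul, Finset.sum_sub_distrib, ← hδ]
      ring
    have hle : ((N + M : ℕ) : ℕ∞) ≤ ((N + M + 1 : ℕ) : ℕ∞) := by exact_mod_cast Nat.le_succ _
    rw [e]
    exact le_order_sub (le_order_sum _ fun j _ => le_order_mul_right (hle.trans (hP j)))
      (le_order_mul_right (hle.trans hD))
  obtain ⟨r, hr, hball⟩ : ∃ r > 0, ∀ x ∈ Metric.closedBall (w 0) r,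
      MvPolynomial.eval x Λ ≠ 0 := by
    have := (analyticAt_eval Λ (w 0)).continuousAt.eventually_ne hΛ0
    obtain ⟨r, hr, h⟩ := Metric.nhds_basis_closedBall.eventually_iff.1 this
    exact ⟨r, hr, fun x hx => h hx⟩
  obtain ⟨b, hb0, hb⟩ := exists_bound_smul (hT.isBigO_of_le_order hord)
    (Metric.isBounded_closedBall (x := w 0) (r := r))
  obtain ⟨m, hm0, hm⟩ := exists_lower_bound_smul (hasTaylor_eval D)
    (hΛ.of_le_order_sub hD (by omega)) (isCompact_closedBall (w 0) r) hball
  have hpunct : ∀ᶠ t in 𝓝[≠] (0 : ℂ), ‖h (t • w t)‖ ≤ b / m * ‖t‖ ^ N := by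
    filter_upwards [self_mem_nhdsWithin, nhdsWithin_le_nhds hb, nhdsWithin_le_nhds hm,
      nhdsWithin_le_nhds hzero, nhdsWithin_le_nhds (hw.continuousAt.eventually_mem
        (Metric.closedBall_mem_nhds (w 0) hr))] with t ht h1 h2 h3 h4
    have h5 := h1 _ h4
    simp only [h3, mul_zero, Finset.sum_const_zero, sub_zero, norm_mul] at h5
    have ht0 : 0 < ‖t‖ := norm_pos_iff.2 ht
    have h7 : m * ‖t‖ ^ M * ‖h (t • w t)‖ ≤ b * ‖t‖ ^ (N + M) :=
      (mul_le_mul_of_nonneg_right (h2 _ h4) (norm_nonneg _)).trans h5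
    rw [div_mul_eq_mul_div, le_div_iff₀ hm0]
    refine le_of_mul_le_mul_left ?_ (pow_pos ht0 M)
    calc _ = m * ‖t‖ ^ M * ‖h (t • w t)‖ := by ring
      _ ≤ _ := h7
      _ = _ := by ring
  refine IsBigO.of_bound (b / m) ?_
  simp only [norm_pow, norm_norm]
  have h0 : ‖h ((0 : ℂ) • w 0)‖ ≤ b / m * ‖(0 : ℂ)‖ ^ N := by
    have hc : Continuous fun t : ℂ => b / m * ‖t‖ ^ N := by fun_prop
    exact le_of_tendsto_of_tendsto
      (hcomp.continuousAt.norm.tendsto.mono_left (nhdsWithin_le_nhds (s := {0}ᶜ)))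
      ((hc.tendsto 0).mono_left nhdsWithin_le_nhds) hpunct
  filter_upwards [eventually_nhdsWithin_iff.1 hpunct] with t ht
  rcases eq_or_ne t 0 with rfl | ht'
  · exact h0
  · exact ht ht'

end ImplicitCurve

/-! ### The case of no formal common factor. -/

section UnitCase

open MvPowerSeries Asymptotics

variable {n q : ℕ}

theorem HasInit.det {κ : Type*} [Fintype κ] [DecidableEq κ]
    {B : Matrix κ κ (MvPowerSeries (Fin n) ℂ)} {L : Matrix κ κ (MvPolynomial (Fin n) ℂ)} {D : ℕ}
    (h : ∀ i j, HasInit (B i j) D (L i j)) : HasInit B.det (Fintype.card κ * D) L.det := by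
  rw [Matrix.det_apply', Matrix.det_apply']
  refine HasInit.sum fun σ _ => ?_
  have h1 := (HasInit.const (n := n) ((Equiv.Perm.sign σ : ℤ) : ℂ)).mul
    (HasInit.prod (s := Finset.univ) fun i _ => h (σ i) i)
  simpa using h1

variable {y : Fin n → MvPowerSeries (Fin n) ℂ} {c : Fin q → Fin n → ℂ}

/-- The coefficient of `yⱼ` in `normalCoeff y c K`, if from each monomial `∏ yᵢ` of its expression
the factor with the index `s I` is taken out. -/
noncomputable def reducedCoeff (y : Fin n → MvPowerSeries (Fin n) ℂ) (c : Fin q → Fin n → ℂ)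
    (s : (Fin q → Fin n) → Fin n) (K : Fin q → Fin n) (j : Fin n) : MvPowerSeries (Fin n) ℂ :=
  ∑ I : Fin q → Fin n, if s I = j then C (coeffDet c I) * ((∏ a, pderiv ℂ (K a) (y (I a))) *
    ∏ i ∈ (coeffSupport c \ Finset.univ.image I).erase j, y i) else 0

theorem normalCoeff_eq_sum_reducedCoeff {J : Finset (Fin n)} (hJ : J ⊆ coeffSupport c)
    {s : (Fin q → Fin n) → Fin n}
    (hs : ∀ I, coeffDet c I ≠ 0 → s I ∈ J ∧ s I ∉ Finset.univ.image I) (K : Fin q → Fin n) :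
    normalCoeff y c K = ∑ j : J, reducedCoeff y c s K j * y j := by
  rw [Finset.sum_coe_sort J fun j => reducedCoeff y c s K j * y j]
  simp only [reducedCoeff, Finset.sum_mul]
  rw [Finset.sum_comm, normalCoeff]
  refine Finset.sum_congr rfl fun I _ => ?_
  by_cases hI : coeffDet c I = 0
  · simp [hI]
  · obtain ⟨h1, h2⟩ := hs I hI
    rw [Finset.sum_eq_single_of_mem _ h1 (fun j _ hj => by rw [if_neg (Ne.symm hj), zero_mul]),
      if_pos rfl, ← Finset.mul_prod_erase _ _ (Finset.mem_sdiff.2 ⟨hJ h1, h2⟩)]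
    ring

theorem hasInit_reducedCoeff (hy : ∀ i, (2 : ℕ∞) ≤ (y i - X i).order) {J : Finset (Fin n)}
    (hJ : J ⊆ coeffSupport c) {s : (Fin q → Fin n) → Fin n}
    (hs : ∀ I, coeffDet c I ≠ 0 → s I ∈ J ∧ s I ∉ Finset.univ.image I) (K : Fin q → Fin n)
    (j : Fin n) :
    HasInit (reducedCoeff y c s K j) ((coeffSupport c).card - q - 1)
      (if s K = j then MvPolynomial.C (coeffDet c K) *
        ∏ i ∈ (coeffSupport c \ Finset.univ.image K).erase j, MvPolynomial.X i else 0) := by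
  classical
  have h1 : HasInit (reducedCoeff y c s K j) ((coeffSupport c).card - q - 1)
      (∑ I : Fin q → Fin n, if I = K then (if s I = j then MvPolynomial.C (coeffDet c I) *
        ∏ i ∈ (coeffSupport c \ Finset.univ.image I).erase j, MvPolynomial.X i else 0) else 0) := by
    refine HasInit.sum fun I _ => ?_
    by_cases hI : coeffDet c I = 0
    · simpa [hI] using HasInit.zero _
    · by_cases hj : s I = j
      · subst hj
        obtain ⟨h1, h2⟩ := hs I hI
        have h3 := hasInit_normalCoeff_term hy K I
          ((coeffSupport c \ Finset.univ.image I).erase (s I)) (coeffDet c I)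
        rw [Finset.card_erase_of_mem (Finset.mem_sdiff.2 ⟨hJ h1, h2⟩), card_sdiff_image hI] at h3
        simpa using h3
      · simpa [hj] using HasInit.zero _
  simpa using h1

/-- Extension by zero of the coordinates with indices in `J`. -/
noncomputable def extendZero (J : Finset (Fin n)) : (J → ℂ) →L[ℂ] (Fin n → ℂ) :=
  ContinuousLinearMap.pi fun i =>
    if h : i ∈ J then ContinuousLinearMap.proj (R := ℂ) (φ := fun _ : J => ℂ) ⟨i, h⟩ else 0

theorem extendZero_apply_of_mem {J : Finset (Fin n)} (z : J → ℂ) (j : J) :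
    extendZero J z j = z j := by
  simp [extendZero]

theorem extendZero_apply_of_notMem {J : Finset (Fin n)} (z : J → ℂ) {i : Fin n} (hi : i ∉ J) :
    extendZero J z i = 0 := by
  simp [extendZero, hi]

/-- Let the components of `ω` have no common formal factor. If `J` is a set of less than `n` indices
that is not contained in the support of any nonzero minor, but each of whose subsets
`J \ {j}` is, then `ω` vanishes along a curve. -/
theorem frequently_eq_zero_of_minimal_nonface
    {ω : (Fin n → ℂ) → (Fin n → ℂ) [⋀^Fin q]→L[ℂ] ℂ}
    {Ω : (Fin n → MvPowerSeries (Fin n) ℂ) [⋀^Fin q]→ₗ[MvPowerSeries (Fin n) ℂ]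
      MvPowerSeries (Fin n) ℂ} (hΩ : HasTaylorForm ω Ω)
    (hy : ∀ i, (2 : ℕ∞) ≤ (y i - X i).order)
    {f : MvPowerSeries (Fin n) ℂ} (hf0 : constantCoeff f ≠ 0)
    (hfac : ∀ K : Fin q → Fin n, Ω (fun a => Pi.single (K a) 1) = f * normalCoeff y c K)
    {J : Finset (Fin n)} (hJ : J ⊆ coeffSupport c) {i₀ : Fin n} (hi₀ : i₀ ∉ J)
    (hblock : ∀ K, coeffDet c K ≠ 0 → ∃ j ∈ J, j ∉ Finset.univ.image K)
    (hface : ∀ j ∈ J, ∃ K, coeffDet c K ≠ 0 ∧ ∀ i ∈ J, i ∉ Finset.univ.image K → i = j) :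
    ∃ᶠ x in 𝓝[≠] 0, ω x = 0 := by
  classical
  -- Each monomial in the normal form contains some yⱼ with j ∈ J. The choice of one per monomial
  -- expresses the components as combinations of these yⱼ.
  obtain ⟨s, hs⟩ : ∃ s : (Fin q → Fin n) → Fin n, ∀ I, coeffDet c I ≠ 0 →
      s I ∈ J ∧ s I ∉ Finset.univ.image I := by
    have : ∀ I : Fin q → Fin n, ∃ j : Fin n, coeffDet c I ≠ 0 →
        j ∈ J ∧ j ∉ Finset.univ.image I := by
      intro I
      by_cases h : coeffDet c I = 0
      · exact ⟨i₀, fun h' => absurd h h'⟩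
      · obtain ⟨j, hj, hj'⟩ := hblock I h
        exact ⟨j, fun _ => ⟨hj, hj'⟩⟩
    choose s hs using this
    exact ⟨s, hs⟩
  choose K hK hKJ using fun j : J => hface j j.2
  have hsK : ∀ j : J, s (K j) = j := fun j => hKJ j _ (hs _ (hK j)).1 (hs _ (hK j)).2
  have hmemK : ∀ j : J, (j : Fin n) ∈ coeffSupport c \ Finset.univ.image (K j) := fun j =>
    Finset.mem_sdiff.2 ⟨hJ j.2, by have := (hs _ (hK j)).2; rwa [hsK j] at this⟩
  have hnotJ : ∀ j : J, ∀ i ∈ (coeffSupport c \ Finset.univ.image (K j)).erase (j : Fin n),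
      i ∉ J := by
    intro j i hi hiJ
    rw [Finset.mem_erase, Finset.mem_sdiff] at hi
    exact hi.1 (hKJ j i hiJ hi.2.2)
  -- A point of the coordinate subspace xⱼ = 0, j ∈ J, with all other coordinates nonzero. Near it
  -- the initial form of the component `K j` is a nonzero constant times the coordinate with index
  -- j.
  let p : Fin n → ℂ := fun i => if i ∈ J then 0 else 1
  have hT : ∀ K, HasTaylor (fun x => ω x fun a => Pi.single (K a) 1) (f * normalCoeff y c K) :=
    fun K => by rw [← hfac K]; exact hΩ K
  have hf := hasInit_constantCoeff f
  obtain ⟨z, hz, hz0, hzero⟩ := exists_analytic_curve_of_hasInit (p := p) (fun j : J => hT (K j))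
    (fun j => hf.mul (hasInit_normalCoeff hy c (K j))) (extendZero J)
    (a := fun j => constantCoeff f * coeffDet c (K j)) (fun j => mul_ne_zero hf0 (hK j)) (by
      intro j z
      rw [map_mul, map_mul, MvPolynomial.eval_C, MvPolynomial.eval_C, map_prod,
        ← Finset.mul_prod_erase _ _ (hmemK j), Finset.prod_eq_one, MvPolynomial.eval_X,
        Pi.add_apply, extendZero_apply_of_mem]
      · simp [p, mul_assoc]
      · intro i hi
        rw [MvPolynomial.eval_X, Pi.add_apply, extendZero_apply_of_notMem z (hnotJ j i hi)]
        simp [p, hnotJ j i hi])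
  let w : ℂ → Fin n → ℂ := fun t => p + extendZero J (z t)
  have hw : AnalyticAt ℂ w 0 :=
    analyticAt_const.add (((extendZero J).analyticAt _).fun_comp hz)
  have hw0 : w 0 = p := by simp [w, hz0]
  -- The matrix that expresses the components `K i` by the yⱼ. Its initial form is diagonal and
  -- invertible at p, since no other index of J is left in the monomial of `K i`.
  let B : Matrix J J (MvPowerSeries (Fin n) ℂ) := fun i j => reducedCoeff y c s (K i) j
  have hB : ∀ i j, HasInit (B i j) ((coeffSupport c).card - q - 1)
      (Matrix.diagonal (fun i : J => MvPolynomial.C (coeffDet c (K i)) *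
        ∏ k ∈ (coeffSupport c \ Finset.univ.image (K i)).erase (i : Fin n),
          (MvPolynomial.X k : MvPolynomial (Fin n) ℂ)) i j) := by
    intro i j
    have h1 := hasInit_reducedCoeff hy hJ hs (K i) j
    rw [hsK i] at h1
    rw [Matrix.diagonal_apply]
    by_cases hij : i = j
    · subst hij
      simpa using h1
    · have hij' : (i : Fin n) ≠ j := fun h => hij (Subtype.ext h)
      simpa [hij, hij'] using h1
  have hdet := HasInit.det hB
  rw [Matrix.det_diagonal] at hdet
  have hY : ∀ L, normalCoeff y c L = ∑ j : J, reducedCoeff y c s L j * y j :=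
    normalCoeff_eq_sum_reducedCoeff hJ hs
  have hcramer : ∀ j : J, B.det * y j = ∑ i : J, B.adjugate j i * normalCoeff y c (K i) := by
    intro j
    have h1 : B.adjugate.mulVec (B.mulVec fun j : J => y j) = B.det • fun j : J => y j := by
      rw [Matrix.mulVec_mulVec, Matrix.adjugate_mul, Matrix.smul_mulVec, Matrix.one_mulVec]
    have h2 := congrFun h1 j
    rw [Pi.smul_apply, smul_eq_mul] at h2
    rw [← h2, Matrix.mulVec, dotProduct]
    refine Finset.sum_congr rfl fun i _ => ?_
    rw [hY, Matrix.mulVec, dotProduct]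
  -- By Cramer's rule det B times any component is a formal combination of the components that
  -- vanish on the curve.
  have hall : ∀ L : Fin q → Fin n, ∀ᶠ t in 𝓝 (0 : ℂ),
      (ω (t • w t) fun a => Pi.single (L a) 1) = 0 := by
    intro L
    refine eventually_eq_zero_on_curve (fun j : J => hT (K j)) (hT L) (δ := B.det)
      (B := fun i => ∑ j : J, reducedCoeff y c s L j * B.adjugate j i) ?_ hdet hw ?_ hzero
    · calc B.det * (f * normalCoeff y c L)
          = ∑ j : J, f * (reducedCoeff y c s L j * (B.det * y j)) := by
            rw [hY, Finset.mul_sum, Finset.mul_sum]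
            exact Finset.sum_congr rfl fun j _ => by ring
        _ = ∑ j : J, ∑ i : J, reducedCoeff y c s L j * B.adjugate j i
              * (f * normalCoeff y c (K i)) := by
            refine Finset.sum_congr rfl fun j _ => ?_
            rw [hcramer, Finset.mul_sum, Finset.mul_sum]
            exact Finset.sum_congr rfl fun i _ => by ring
        _ = _ := by
            rw [Finset.sum_comm]
            exact Finset.sum_congr rfl fun i _ => by rw [Finset.sum_mul]
    · rw [hw0, map_prod]
      refine Finset.prod_ne_zero_iff.2 fun j _ => ?_
      rw [map_mul, MvPolynomial.eval_C, map_prod]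
      refine mul_ne_zero (hK j) (Finset.prod_ne_zero_iff.2 fun i hi => ?_)
      rw [MvPolynomial.eval_X]
      simp [p, hnotJ j i hi]
  have hx : Tendsto (fun t : ℂ => t • w t) (𝓝[≠] 0) (𝓝[≠] 0) := by
    refine tendsto_nhdsWithin_iff.2 ⟨?_, ?_⟩
    · have h1 : ContinuousAt (fun t : ℂ => t • w t) 0 := continuousAt_id.smul hw.continuousAt
      have h2 := h1.tendsto
      rw [zero_smul] at h2
      exact h2.mono_left nhdsWithin_le_nhds
    · filter_upwards [self_mem_nhdsWithin] with t ht h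
      refine ht ?_
      have h1 := congrFun h i₀
      simpa [w, p, hi₀, extendZero_apply_of_notMem] using h1
  refine hx.frequently (Eventually.frequently ?_)
  filter_upwards [nhdsWithin_le_nhds (eventually_all.2 hall)] with t ht
  exact form_eq_zero_of_basis ht

theorem coeffDet_update {I : Fin q → Fin n} (h : ∀ k l, c k (I l) = if k = l then 1 else 0)
    (k : Fin q) (j : Fin n) : coeffDet c (Function.update I k j) = c k j := by
  have h1 : (Matrix.of fun a l => c l (Function.update I k j a))
      = (1 : Matrix (Fin q) (Fin q) ℂ).updateRow k fun l => c l j := by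
    ext a l
    by_cases ha : a = k
    · subst ha
      simp
    · simp [Matrix.updateRow_apply, ha, h, Matrix.one_apply, eq_comm]
  rw [coeffDet, h1, ← Matrix.cramer_transpose_apply, Matrix.transpose_one, Matrix.cramer_one]
  rfl

/-- In matroid terms J is a circuit of the columns of c: a column j outside the basis I together
with the basis columns in its expansion. -/
theorem exists_minimal_nonface (hq : 1 ≤ q) (hqn : q + 2 ≤ n) {lam : Fin n → ℂ}
    (hlam : ∀ i, lam i ≠ 0) {I : Fin q → Fin n}
    (hI : ∀ k l, c k (I l) = if k = l then 1 else 0) (hsum : ∀ k, ∑ i, lam i * c k i = 0) :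
    ∃ J ⊆ coeffSupport c, (∃ i₀, i₀ ∉ J) ∧
      (∀ K, coeffDet c K ≠ 0 → ∃ j ∈ J, j ∉ Finset.univ.image K) ∧
      ∀ j ∈ J, ∃ K, coeffDet c K ≠ 0 ∧ ∀ i ∈ J, i ∉ Finset.univ.image K → i = j := by
  classical
  have hIdet : coeffDet c I ≠ 0 := by rw [coeffDet_eq_one hI]; exact one_ne_zero
  let k₀ : Fin q := ⟨0, hq⟩
  -- Otherwise the row k₀ is zero except for the entry 1 at I k₀, and the relation with λ reads λ_{I
  -- k₀} = 0.
  obtain ⟨j, hjI, hj⟩ : ∃ j, (∀ l, I l ≠ j) ∧ c k₀ j ≠ 0 := by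
    by_contra! hcon
    have h1 := hsum k₀
    rw [Finset.sum_eq_single (I k₀)] at h1
    · rw [hI, if_pos rfl, mul_one] at h1
      exact hlam _ h1
    · intro i _ hi
      by_cases hr : ∃ l, I l = i
      · obtain ⟨l, rfl⟩ := hr
        rw [hI, if_neg, mul_zero]
        rintro rfl
        exact hi rfl
      · push Not at hr
        rw [hcon i hr, mul_zero]
    · simp
  let A : Finset (Fin q) := Finset.univ.filter fun k => c k j ≠ 0
  have hA : ∀ k, k ∈ A ↔ c k j ≠ 0 := by simp [A]
  have hmem : ∀ i, i ∈ insert j (A.image I) ↔ i = j ∨ ∃ k, c k j ≠ 0 ∧ I k = i := by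
    intro i
    simp [hA]
  refine ⟨insert j (A.image I), ?_, ?_, ?_, ?_⟩
  · intro i hi
    rcases (hmem i).1 hi with rfl | ⟨k, -, rfl⟩
    · exact mem_coeffSupport.2 ⟨Function.update I k₀ i, by rwa [coeffDet_update hI], k₀, by simp⟩
    · exact mem_coeffSupport.2 ⟨I, hIdet, k, rfl⟩
  · by_contra! hcon
    have h1 : n ≤ (insert j (A.image I)).card := by
      rw [Finset.eq_univ_of_forall hcon, Finset.card_univ, Fintype.card_fin]
    have h2 := Finset.card_insert_le j (A.image I)
    have h3 := Finset.card_image_le (s := A) (f := I)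
    have h4 := Finset.card_le_univ A
    rw [Fintype.card_fin] at h4
    omega
  · intro K hK
    by_contra! hcon
    -- If K contained J, its independent columns would include the column j and the basis columns
    -- that span it.
    have hli : LinearIndependent ℂ fun (a : Fin q) (k : Fin q) => c k (K a) :=
      Matrix.linearIndependent_rows_of_det_ne_zero hK
    obtain ⟨a, -, ha⟩ := Finset.mem_image.1 (hcon j ((hmem j).2 (Or.inl rfl)))
    refine hli.notMem_span_image (s := {b | b ≠ a}) (x := a) (by simp) ?_
    have hrow : (fun k => c k (K a)) = ∑ k, c k j • (Pi.single k 1 : Fin q → ℂ) := by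
      ext l
      simp [ha, Finset.sum_apply, Pi.single_apply]
    rw [hrow]
    refine Submodule.sum_mem _ fun k _ => ?_
    by_cases hk : c k j = 0
    · rw [hk, zero_smul]
      exact Submodule.zero_mem _
    · obtain ⟨b, -, hb⟩ := Finset.mem_image.1 (hcon (I k) ((hmem _).2 (Or.inr ⟨k, hk, rfl⟩)))
      refine Submodule.smul_mem _ _ (Submodule.subset_span ⟨b, ?_, ?_⟩)
      · rintro rfl
        exact hjI k (hb.symm.trans ha)
      · ext l
        simp [hb, hI, Pi.single_apply]
  · intro i hi
    rcases (hmem i).1 hi with rfl | ⟨k, hk, rfl⟩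
    · refine ⟨I, hIdet, fun i' hi' hni => ?_⟩
      rcases (hmem i').1 hi' with rfl | ⟨k, -, rfl⟩
      · rfl
      · exact absurd (Finset.mem_image_of_mem I (Finset.mem_univ k)) hni
    -- Exchanging I k for j changes the minor 1 into cₖⱼ ≠ 0, and the new tuple covers J except I k.
    · refine ⟨Function.update I k j, by rwa [coeffDet_update hI], fun i' hi' hni => ?_⟩
      rcases (hmem i').1 hi' with rfl | ⟨l, -, rfl⟩
      · exact absurd (Finset.mem_image.2 ⟨k, Finset.mem_univ k, by simp⟩) hni
      · by_contra hne
        have hlk : l ≠ k := fun h => hne (by rw [h])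
        exact hni (Finset.mem_image.2 ⟨l, Finset.mem_univ l, by simp [hlk]⟩)

theorem IsFormalModel.frequently_eq_zero (hq : 1 ≤ q) (hqn : q + 2 ≤ n) {lam : Fin n → ℂ}
    (hlam : ∀ i, lam i ≠ 0) {ω : (Fin n → ℂ) → (Fin n → ℂ) [⋀^Fin q]→L[ℂ] ℂ}
    {Ω : (Fin n → MvPowerSeries (Fin n) ℂ) [⋀^Fin q]→ₗ[MvPowerSeries (Fin n) ℂ]
      MvPowerSeries (Fin n) ℂ} (hΩ : HasTaylorForm ω Ω) {Ξ : Fin n → MvPowerSeries (Fin n) ℂ}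
    {I : Fin q → Fin n} (h : IsFormalModel lam Ω Ξ y I c) (hΞ : Ξ ∈ alternatingKer Ω) :
    ∃ᶠ x in 𝓝[≠] 0, ω x = 0 := by
  obtain ⟨f, hf, hfac⟩ := h.exists_factorization
  by_cases hf0 : constantCoeff f = 0
  · refine frequently_eq_zero_of_constantCoeff_eq_zero (by omega) hΩ h.coord (I := I) ?_ hf hf0 hfac
    rw [coeffDet_eq_one h.coeff_base]
    exact one_ne_zero
  · obtain ⟨J, hJ, ⟨i₀, hi₀⟩, hblock, hface⟩ := exists_minimal_nonface hq hqn hlam h.coeff_base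
      (h.sum_lam_mul_eq_zero hΞ)
    exact frequently_eq_zero_of_minimal_nonface hΩ h.coord hf0 hfac hJ hi₀ hblock hface

end UnitCase

/-! ### Positive dimension from nonisolated points. -/

section GermDimension

variable {n : ℕ}

/-- The germ of an analytic function. -/
noncomputable def toHolomorphicGerm (f : (Fin n → ℂ) → ℂ) (hf : AnalyticAt ℂ f 0) : holomorphicGerms n :=
  ⟨(f : Germ (𝓝 (0 : Fin n → ℂ)) ℂ), f, hf, rfl⟩

theorem isUnit_toHolomorphicGerm {f : (Fin n → ℂ) → ℂ} (hf : AnalyticAt ℂ f 0) (h0 : f 0 ≠ 0) :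
    IsUnit (toHolomorphicGerm f hf) := by
  refine IsUnit.of_mul_eq_one (toHolomorphicGerm f⁻¹ (hf.inv h0)) (Subtype.ext ?_)
  refine Germ.coe_eq.2 ?_
  filter_upwards [hf.continuousAt.eventually_ne h0] with x hx
  exact mul_inv_cancel₀ hx

theorem eventually_eq_zero_of_mem_germVanishingIdeal {S : Set (Fin n → ℂ)} {f : (Fin n → ℂ) → ℂ}
    {hf : AnalyticAt ℂ f 0} (h : toHolomorphicGerm f hf ∈ germVanishingIdeal S) :
    ∀ᶠ x in 𝓝 0, x ∈ S → f x = 0 := by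
  obtain ⟨g, hg, hg0⟩ := h
  filter_upwards [Germ.coe_eq.1 hg, hg0] with x h1 h2 hx
  rw [← h1]
  exact h2 hx

/-- A germ of dimension at most zero is at most a point. -/
theorem germDim_pos_of_frequently {S : Set (Fin n → ℂ)} (h : ∃ᶠ x in 𝓝[≠] 0, x ∈ S) :
    0 < germDim S := by
  by_contra hdim
  have hle : Ring.KrullDimLE 0 (holomorphicGerms n ⧸ germVanishingIdeal S) :=
    Ring.krullDimLE_iff.2 (by simpa [germDim] using hdim)
  have hcoord : ∀ i : Fin n, AnalyticAt ℂ (fun x : Fin n → ℂ => x i) 0 := fun i =>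
    (ContinuousLinearMap.proj (R := ℂ) (φ := fun _ : Fin n => ℂ) i).analyticAt 0
  have hzero : ∀ i : Fin n, ∀ᶠ x in 𝓝 (0 : Fin n → ℂ), x ∈ S → x i = 0 := by
    intro i
    -- Coordinates vanish at 0, so they lie in the Jacobson radical. In dimension at most zero this
    -- is the nilradical, so a power of each coordinate vanishes on S near 0.
    have hjac : Ideal.Quotient.mk (germVanishingIdeal S) (toHolomorphicGerm _ (hcoord i))
        ∈ Ideal.jacobson (⊥ : Ideal (holomorphicGerms n ⧸ germVanishingIdeal S)) := by
      rw [Ideal.mem_jacobson_bot]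
      intro y
      obtain ⟨⟨_, g, hg, rfl⟩, rfl⟩ := Ideal.Quotient.mk_surjective y
      have hfg : AnalyticAt ℂ (fun x : Fin n → ℂ => x i * g x + 1) 0 :=
        ((hcoord i).mul hg).add analyticAt_const
      have hu := (isUnit_toHolomorphicGerm hfg (by simp)).map
        (Ideal.Quotient.mk (germVanishingIdeal S))
      rw [← map_mul, ← map_one (Ideal.Quotient.mk (germVanishingIdeal S)), ← map_add]
      exact hu
    rw [Ideal.jacobson_bot, Ring.jacobson_eq_nilradical_of_krullDimLE_zero, mem_nilradical] at hjac
    obtain ⟨N, hN⟩ := hjac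
    rw [← map_pow, Ideal.Quotient.eq_zero_iff_mem] at hN
    have hpow : toHolomorphicGerm (fun x : Fin n → ℂ => x i ^ N) ((hcoord i).pow N)
        ∈ germVanishingIdeal S := by
      convert hN using 1
      exact Subtype.ext rfl
    filter_upwards [eventually_eq_zero_of_mem_germVanishingIdeal hpow] with x hx hxS
    exact eq_zero_of_pow_eq_zero (hx hxS)
  refine h ?_
  rw [eventually_nhdsWithin_iff]
  filter_upwards [eventually_all.2 hzero] with x hx hne hxS
  exact hne (funext fun i => hx i hxS)

end GermDimension

/-! ### Invariance under linear changes of coordinates. -/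

section LinearChange

open VectorField

variable {n q : ℕ}

/-- The pullback of a vector field by a linear change of coordinates. -/
noncomputable def pullbackField (P : (Fin n → ℂ) ≃L[ℂ] (Fin n → ℂ)) (V : (Fin n → ℂ) → Fin n → ℂ) :
    (Fin n → ℂ) → Fin n → ℂ :=
  P.symm ∘ V ∘ P

/-- The pullback of a differential form by a linear change of coordinates. -/
noncomputable def pullbackForm (P : (Fin n → ℂ) ≃L[ℂ] (Fin n → ℂ))
    (ω : (Fin n → ℂ) → (Fin n → ℂ) [⋀^Fin q]→L[ℂ] ℂ) :
    (Fin n → ℂ) → (Fin n → ℂ) [⋀^Fin q]→L[ℂ] ℂ :=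
  fun x => (ω (P x)).compContinuousLinearMap (P : (Fin n → ℂ) →L[ℂ] (Fin n → ℂ))

variable {P : (Fin n → ℂ) ≃L[ℂ] (Fin n → ℂ)} {V W : (Fin n → ℂ) → Fin n → ℂ}
  {ω : (Fin n → ℂ) → (Fin n → ℂ) [⋀^Fin q]→L[ℂ] ℂ} {x : Fin n → ℂ}

theorem pullbackField_symm_pullbackField : pullbackField P (pullbackField P.symm V) = V := by
  ext1 x
  simp [pullbackField]

theorem fderiv_pullbackField (v : Fin n → ℂ) :
    fderiv ℂ (pullbackField P V) x v = P.symm (fderiv ℂ V (P x) (P v)) := by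
  rw [pullbackField, ContinuousLinearEquiv.comp_fderiv, ContinuousLinearEquiv.comp_right_fderiv]
  rfl

theorem lieBracket_pullbackField :
    lieBracket ℂ (pullbackField P V) (pullbackField P W) x = P.symm (lieBracket ℂ V W (P x)) := by
  simp only [lieBracket_eq, fderiv_pullbackField, map_sub]
  simp [pullbackField]

theorem mem_formKer_pullbackForm {v : Fin n → ℂ} :
    v ∈ formKer (pullbackForm P ω x) ↔ P v ∈ formKer (ω (P x)) := by
  have key : ∀ (w : Fin q → Fin n → ℂ) i, pullbackForm P ω x (Function.update w i v)
      = ω (P x) (Function.update (P ∘ w) i (P v)) := by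
    intro w i
    rw [pullbackForm, ContinuousAlternatingMap.compContinuousLinearMap_apply]
    congr 1
    exact Function.comp_update _ _ _ _
  constructor
  · intro h w i
    have := h (P.symm ∘ w) i
    rw [key] at this
    simpa [← Function.comp_assoc] using this
  · intro h w i
    rw [key]
    exact h _ i

theorem pullbackForm_eq_zero_iff : pullbackForm P ω x = 0 ↔ ω (P x) = 0 := by
  constructor
  · intro h
    ext w
    have := congrArg (fun α => α (P.symm ∘ w)) h
    simpa [pullbackForm, ← Function.comp_assoc] using this
  · intro h
    ext w
    simp [pullbackForm, h]

theorem finrank_formKer_pullbackForm :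
    Module.finrank ℂ (formKer (pullbackForm P ω x)) = Module.finrank ℂ (formKer (ω (P x))) := by
  have h1 : (formKer (pullbackForm P ω x)).map (P.toLinearEquiv : (Fin n → ℂ) →ₗ[ℂ] (Fin n → ℂ))
      = formKer (ω (P x)) := by
    ext v
    rw [Submodule.mem_map]
    constructor
    · rintro ⟨u, hu, rfl⟩
      exact mem_formKer_pullbackForm.1 hu
    · intro hv
      exact ⟨P.symm v, mem_formKer_pullbackForm.2 (by simpa using hv), by simp⟩
  rw [← h1, LinearEquiv.finrank_map_eq]

theorem tendsto_equiv : Tendsto P (𝓝 x) (𝓝 (P x)) := P.continuous.tendsto x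

theorem tendsto_equiv_zero : Tendsto P (𝓝 0) (𝓝 0) := by
  simpa using tendsto_equiv (P := P) (x := 0)

theorem isTangentAt_pullback (h : IsTangentAt V ω (P x)) :
    IsTangentAt (pullbackField P V) (pullbackForm P ω) x := by
  refine ⟨?_, ?_⟩
  · exact (P.symm.analyticAt _).comp (AnalyticAt.comp h.1 (P.analyticAt x))
  · filter_upwards [tendsto_equiv.eventually h.2] with y hy
    rw [mem_formKer_pullbackForm]
    simpa [pullbackField] using hy

theorem isTangentAt_of_pullback (h : IsTangentAt V (pullbackForm P ω) x) :
    IsTangentAt (pullbackField P.symm V) ω (P x) := by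
  refine ⟨?_, ?_⟩
  · refine (P.symm.symm.analyticAt _).comp (AnalyticAt.comp ?_ (P.symm.analyticAt _))
    simpa using h.1
  · have h1 : Tendsto P.symm (𝓝 (P x)) (𝓝 x) := by
      simpa using tendsto_equiv (P := P.symm) (x := P x)
    filter_upwards [h1.eventually h.2] with y hy
    rw [mem_formKer_pullbackForm] at hy
    simpa [pullbackField] using hy

theorem IsInfinitesimalAutomorphism.pullback (h : IsInfinitesimalAutomorphism V ω) :
    IsInfinitesimalAutomorphism (pullbackField P V) (pullbackForm P ω) := by
  filter_upwards [tendsto_equiv_zero.eventually h] with x hx W hW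
  have h1 := hx _ (isTangentAt_of_pullback hW)
  rw [mem_formKer_pullbackForm, ← pullbackField_symm_pullbackField (P := P) (V := W),
    lieBracket_pullbackField]
  simpa using h1

theorem IsIntegrableDistribution.of_pullback (h : IsIntegrableDistribution (pullbackForm P ω)) :
    IsIntegrableDistribution ω := by
  filter_upwards [(tendsto_equiv_zero (P := P.symm)).eventually h] with x hx V W hV hW
  have hPx : P (P.symm x) = x := P.apply_symm_apply x
  have h1 := hx (pullbackField P V) (pullbackField P W) (isTangentAt_pullback (by rwa [hPx]))
    (isTangentAt_pullback (by rwa [hPx]))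
  rw [mem_formKer_pullbackForm, lieBracket_pullbackField, hPx] at h1
  simpa using h1

theorem analyticAt_pullbackForm (h : AnalyticAt ℂ ω 0) : AnalyticAt ℂ (pullbackForm P ω) 0 := by
  refine ((ContinuousAlternatingMap.compContinuousLinearMapCLM (ι := Fin q) (F := ℂ)
    (P : (Fin n → ℂ) →L[ℂ] (Fin n → ℂ))).analyticAt _).fun_comp
    (AnalyticAt.fun_comp (g := ω) ?_ (P.analyticAt 0))
  simpa using h

/-- Linear coordinates that diagonalize the linear part of a nonresonant singularity. -/
theorem exists_diagonalizing_equiv {A : Module.End ℂ (Fin n → ℂ)} {lam : Fin n → ℂ}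
    (hlam : Function.Injective lam) (hA : ∀ i, A.HasEigenvalue (lam i)) :
    ∃ P : (Fin n → ℂ) ≃L[ℂ] (Fin n → ℂ), ∀ j,
      A (P (Pi.single j 1)) = lam j • P (Pi.single j 1) := by
  classical
  choose v hv using fun i => (hA i).exists_hasEigenvector
  have hli := Module.End.eigenvectors_linearIndependent' A lam hlam v hv
  let b := basisOfPiSpaceOfLinearIndependent hli
  have hb : ∀ j, b j = v j := fun j => by simp [b]
  refine ⟨b.equivFun.symm.toContinuousLinearEquiv, fun j => ?_⟩
  have h1 : b.equivFun.symm.toContinuousLinearEquiv (Pi.single j 1) = v j := by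
    rw [← hb j, LinearEquiv.coe_toContinuousLinearEquiv', Module.Basis.equivFun_symm_apply]
    simp [Pi.single_apply]
  rw [h1]
  exact (hv j).apply_eq_smul

end LinearChange

theorem mainTheorem4 (n q : ℕ) (hq : 1 ≤ q) (hqn : q + 2 ≤ n)
    (ξ : (Fin n → ℂ) → (Fin n → ℂ)) (hξ : IsNonResonantSingularity ξ)
    (ω : (Fin n → ℂ) → (Fin n → ℂ) [⋀^Fin q]→L[ℂ] ℂ) (hω : DefinesDistribution ω)
    (haut : IsInfinitesimalAutomorphism ξ ω) :
    IsIntegrableDistribution ω ∧ (IsTangentAt ξ ω 0 → 0 < germDim (singularSet ω)) := by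
  obtain ⟨han, h0, lam, hlam, heig⟩ := hξ
  -- Everything is pulled back by P, so that the linear part becomes diagonal; the conclusions are
  -- carried back by the invertibility of P.
  obtain ⟨P, hP⟩ := exists_diagonalizing_equiv hlam.injective heig
  have hξ' : AnalyticAt ℂ (pullbackField P ξ) 0 := by
    refine (P.symm.analyticAt _).comp (AnalyticAt.comp ?_ (P.analyticAt 0))
    simpa using han
  have hd : ∀ j, fderiv ℂ (pullbackField P ξ) 0 (Pi.single j 1) = lam j • Pi.single j 1 := by
    intro j
    have h1 : fderiv ℂ ξ 0 (P (Pi.single j 1)) = lam j • P (Pi.single j 1) := hP j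
    rw [fderiv_pullbackField, map_zero, h1, map_smul, P.symm_apply_apply]
  have hω' := analyticAt_pullbackForm (P := P) hω.analytic
  have hne : ∃ᶠ x in 𝓝 0, pullbackForm P ω x ≠ 0 := by
    refine ((tendsto_equiv_zero (P := P.symm)).frequently (hω.ne_zero.mono fun x hx => ?_))
    rw [Ne, pullbackForm_eq_zero_iff, P.apply_symm_apply]
    exact hx
  have hcodim : ∀ᶠ x in 𝓝 0, pullbackForm P ω x ≠ 0 →
      Module.finrank ℂ (formKer (pullbackForm P ω x)) + q = n := by
    filter_upwards [(tendsto_equiv_zero (P := P)).eventually hω.codim] with x hx hx0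
    rw [finrank_formKer_pullbackForm]
    exact hx fun h => hx0 (pullbackForm_eq_zero_iff.2 h)
  obtain ⟨Ω, Ξ, y, I, c, hΩ, hΞ, hmodel⟩ := exists_isFormalModel hlam hξ'
    (by simp [pullbackField, h0]) hd hω' hne hcodim haut.pullback
  refine ⟨(hmodel.isIntegrable hω' hΩ hcodim).of_pullback, fun htan => ?_⟩
  have htan' : IsTangentAt (pullbackField P ξ) (pullbackForm P ω) 0 :=
    isTangentAt_pullback (by rwa [map_zero])
  have hfreq := hmodel.frequently_eq_zero hq hqn hlam.ne_zero hΩ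
    ((hΩ.mem_ker_iff hΞ).1 htan'.2)
  have hPt : Tendsto P (𝓝[≠] 0) (𝓝[≠] 0) :=
    tendsto_nhdsWithin_iff.2 ⟨tendsto_equiv_zero.mono_left nhdsWithin_le_nhds, by
      filter_upwards [self_mem_nhdsWithin] with x hx h
      exact hx (P.map_eq_zero_iff.1 h)⟩
  exact germDim_pos_of_frequently
    (hPt.frequently (hfreq.mono fun x hx => pullbackForm_eq_zero_iff.1 hx))
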